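/- **Games.** An arena consists of two disjoint finite sets $V_0,V_1$ of positions (of Player $0$ and Player $1$), not both empty, and a set $E\subseteq (V_0\times V_1)\cup(V_1\times V_0)$ of edges such that each position of $V=V_0\cup V_1$ has an outgoing edge. A McNaughton game $\mathcal G=(V_0,V_1,E,W,(\mathcal F_0,\mathcal F_1))$ is given by an arena, a set $W\subseteq V$, and a partition of the power set $2^W$ into $\mathcal F_0$ and $\mathcal F_1$. A play is an infinite path $\rho$ in the arena; the owner of the current position chooses the next edge. With $\mathrm{Inf}(\rho)$ the set of positions that occur infinitely often in $\rho$, Player $\sigma$ wins $\rho$ iff $\mathrm{Inf}(\rho)\cap W\in\mathcal F_\sigma$. A strategy maps each finite history that ends in a position of the player to a successor of that position, and $\mathrm{Win}_\sigma(\mathcal G)$ is the set of positions from which Player $\sigma$ has a strategy that wins all plays consistent with it. An algorithm *decides* McNaughton games if, given a game, it computes the partition of $V$ into $\mathrm{Win}_0(\mathcal G)$ and $\mathrm{Win}_1(\mathcal G)$, i.e. for each $v\in V$ it outputs the unique $\sigma$ with $v\in \mathrm{Win}_\sigma(\mathcal G)$. **Complexity.** Games are given explicitly, by listing $V=\{0,\dots,n-1\}$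 with owner and membership in $W$ of each position, the edges, and the members of $\mathcal F_0$ (each coded as an $n$-bit number; $\mathcal F_1=2^W\setminus\mathcal F_0$ need not be listed). $|\mathcal G|$ is the number of bits of this representation. Algorithms are programs of a random access machine with indirect addressing whose arithmetic instructions are addition and truncated subtraction; every cell holds a number of $O(|V|)$ bits. Time is the number of executed instructions; space is the maximal total number of bits of the memory in use, input included (each cell counts one bit plus the length of its content). The constants in $O(\cdot)$ do not depend on the game. **Theorem.** Each of the following is true. 1. There is an algorithm that decides McNaughton games $\mathcal G$ in time $O(2^{|V|}\cdot\max(1,|W|)\cdot|E|)$ and space $O(|\mathcal G|+2^{|V|}|V|)$. 2. There is an algorithm that decides McNaughton games $\mathcal G$ in time $O(2^{|V|}|V||E|)$ and space $O(|\mathcal G|+2^{|V|})$. -/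

import Mathlib

open Filter

/-! ## Arenas, plays, McNaughton games, winning regions

Players are the elements `0, 1 : Fin 2`. -/

/-- A bipartite arena with position set `V`; `pos σ` is the set of positions of Player `σ`. -/
structure Arena (V : Type*) [Fintype V] [DecidableEq V] where
  pos : Fin 2 → Finset V
  pos_disjoint : pos 0 ∩ pos 1 = ∅
  pos_union : pos 0 ∪ pos 1 = Finset.univ
  E : Finset (V × V)
  bipartite : E ⊆ (pos 0 ×ˢ pos 1) ∪ (pos 1 ×ˢ pos 0)
  exists_out : ∀ v : V, ∃ u : V, (v, u) ∈ E

/-- A McNaughton game: an arena, a set `W` of positions, and the winning conditions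
`F 0`, `F 1`, which partition the power set of `W`. -/
structure McNaughtonGame (V : Type*) [Fintype V] [DecidableEq V] extends Arena V where
  W : Finset V
  F : Fin 2 → Finset (Finset V)
  F_union : F 0 ∪ F 1 = W.powerset
  F_disjoint : F 0 ∩ F 1 = ∅

namespace Arena

variable {V : Type*} [Fintype V] [DecidableEq V]

/-- An infinite path in the arena. -/
def IsPlay (A : Arena V) (ρ : ℕ → V) : Prop :=
  ∀ i : ℕ, (ρ i, ρ (i + 1)) ∈ A.E

/-- A strategy of Player `σ`: it maps every initial segment `v₀, …, v_k` of a play with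
`v_k` a position of Player `σ` to a successor of `v_k` (its other values are irrelevant). -/
structure Strategy (A : Arena V) (σ : Fin 2) where
  move : List V → V
  legal : ∀ (h : List V) (hne : h ≠ []), h.IsChain (fun u v => (u, v) ∈ A.E) →
    h.getLast hne ∈ A.pos σ → (h.getLast hne, move h) ∈ A.E

/-- Player `σ` follows the strategy `s` along `ρ`. -/
def Strategy.Consistent {A : Arena V} {σ : Fin 2} (s : A.Strategy σ) (ρ : ℕ → V) : Prop :=
  ∀ i : ℕ, ρ i ∈ A.pos σ → ρ (i + 1) = s.move ((List.range (i + 1)).map ρ)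

end Arena

/-- The set of positions that occur infinitely often. -/
def infinitySet {V : Type*} (ρ : ℕ → V) : Set V :=
  {v | ∃ᶠ i in atTop, ρ i = v}

namespace McNaughtonGame

/-- Player `σ` wins the play `ρ`: the set `Inf(ρ) ∩ W` belongs to `F σ`. -/
def WinsPlay {V : Type*} [Fintype V] [DecidableEq V] (G : McNaughtonGame V) (σ : Fin 2)
    (ρ : ℕ → V) : Prop :=
  ∃ X ∈ G.F σ, (X : Set V) = infinitySet ρ ∩ (G.W : Set V)

/-- The winning region of Player `σ`: the positions from which Player `σ` has a winning
strategy. -/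
def Win {V : Type*} [Fintype V] [DecidableEq V] (G : McNaughtonGame V) (σ : Fin 2) : Set V :=
  {v | ∃ s : G.toArena.Strategy σ, ∀ ρ : ℕ → V, G.toArena.IsPlay ρ → ρ 0 = v →
    s.Consistent ρ → G.WinsPlay σ ρ}

end McNaughtonGame

/-! ## Random access machines -/

namespace RAM

/-- The instructions of a random access machine whose memory cells `X₀, X₁, …` hold natural
numbers. All indices written in an instruction are constants. -/
inductive Instr where
  /-- `X_i ← c` -/
  | const (i c : ℕ)
  /-- `X_i ← X_j + X_k` -/
  | add (i j k : ℕ)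
  /-- `X_i ← max (X_j - X_k, 0)` -/
  | sub (i j k : ℕ)
  /-- `X_i ← X_{X_j}` -/
  | load (i j : ℕ)
  /-- `X_{X_i} ← X_j` -/
  | store (i j : ℕ)
  /-- go to instruction number `m` if `X_j > 0` -/
  | jump (j m : ℕ)

/-- A program: a list of instructions and the number of work cells that lie in front of the
input. -/
structure Program where
  code : List Instr
  work : ℕ

/-- A configuration: program counter and memory. Cells past the end of the list have never
been written and hold `0`. -/
structure Config where
  pc : ℕ
  mem : List ℕ

/-- The content of the cell with address `a`. -/
def read (m : List ℕ) (a : ℕ) : ℕ := m.getD a 0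

/-- Write `x` into the cell with address `a`, extending the memory in use up to `a` if
necessary. -/
def write (m : List ℕ) (a x : ℕ) : List ℕ :=
  (m ++ List.replicate (a + 1 - m.length) 0).set a x

/-- The effect of one instruction. -/
def exec (c : Config) : Instr → Config
  | .const i x => ⟨c.pc + 1, write c.mem i x⟩
  | .add i j k => ⟨c.pc + 1, write c.mem i (read c.mem j + read c.mem k)⟩
  | .sub i j k => ⟨c.pc + 1, write c.mem i (read c.mem j - read c.mem k)⟩
  | .load i j => ⟨c.pc + 1, write c.mem i (read c.mem (read c.mem j))⟩
  | .store i j => ⟨c.pc + 1, write c.mem (read c.mem i) (read c.mem j)⟩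
  | .jump j m => if 0 < read c.mem j then ⟨m, c.mem⟩ else ⟨c.pc + 1, c.mem⟩

/-- One step of the machine; it has halted once the program counter has left the code. -/
def step (p : Program) (c : Config) : Config :=
  match p.code[c.pc]? with
  | some ins => exec c ins
  | none => c

/-- The machine has halted. -/
def Halted (p : Program) (c : Config) : Prop := p.code.length ≤ c.pc

/-- The start configuration: zeros in the work cells, followed by the input. -/
def start (p : Program) (inp : List ℕ) : Config :=
  ⟨0, List.replicate p.work 0 ++ inp⟩

/-- The configuration after `t` steps. -/
def run (p : Program) (inp : List ℕ) (t : ℕ) : Config :=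
  (step p)^[t] (start p inp)

/-- The number of bits needed to write down a list of memory cells: each cell costs one bit
(as a separator) plus the length of the binary expansion of its content. -/
def bitLength (m : List ℕ) : ℕ := (m.map (fun x => Nat.size x + 1)).sum

/-- On input `inp` the program halts after at most `time` steps with a memory that satisfies
`post`, and all the way to this point the memory in use (input included) has a bit length of at
most `space` and each cell holds a number of at most `word` bits. -/
def ComputesWithin (p : Program) (inp : List ℕ) (post : List ℕ → Prop)
    (time space word : ℕ) : Prop :=
  ∃ t ≤ time, Halted p (run p inp t) ∧ post (run p inp t).mem ∧
    ∀ s ≤ t, bitLength (run p inp s).mem ≤ space ∧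
      ∀ x ∈ (run p inp s).mem, Nat.size x ≤ word

end RAM

/-! ## Explicitly given McNaughton games as inputs -/

namespace McNaughtonGame

variable {n : ℕ}

/-- The `n`-bit binary number that codes a set of positions. -/
def setCode (X : Finset (Fin n)) : ℕ := ∑ v ∈ X, 2 ^ (v : ℕ)

/-- `inp` is an explicit representation of the game `G` with positions `0, …, n - 1`: the
numbers `n`, `|E|`, `|F 0|`; for each position its owner and whether it lies in `W`; a list of
the edges; a list of (the codes of) the members of `F 0`. The two lists are without repetition
and in any order. As `F 1` is the rest of the power set of `W`, it is not listed. -/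
def IsRepresentation (G : McNaughtonGame (Fin n)) (inp : List ℕ) : Prop :=
  ∃ (es : List (Fin n × Fin n)) (fs : List (Finset (Fin n))),
    es.Nodup ∧ es.toFinset = G.E ∧ fs.Nodup ∧ fs.toFinset = G.F 0 ∧
    inp = [n, es.length, fs.length] ++
      (List.finRange n).flatMap
        (fun v => [if v ∈ G.pos 0 then 0 else 1, if v ∈ G.W then 1 else 0]) ++
      es.flatMap (fun e => [(e.1 : ℕ), (e.2 : ℕ)]) ++
      fs.map setCode

/-- The `n` cells from address `base` on contain, for each position `v`, the player who wins
`G` from `v`: the entry is `0` or `1`, and it is `σ` exactly if `v` lies in the winning region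
of Player `σ`. -/
def IsSolution (G : McNaughtonGame (Fin n)) (base : ℕ) (m : List ℕ) : Prop :=
  ∀ v : Fin n, (∃ σ : Fin 2, RAM.read m (base + v) = σ) ∧
    ∀ σ : Fin 2, RAM.read m (base + v) = σ ↔ v ∈ G.Win σ

end McNaughtonGame

/-- The program decides McNaughton games: for every McNaughton game on `n ≥ 1` positions and
every explicit representation of the game, it replaces the front part of the input by the
partition of the positions into the two winning regions, within the given numbers of steps, bits
of memory, and bits per cell. The second argument of `space` is the size of the representation. -/
def DecidesMcNaughton (p : RAM.Program)
    (time : ∀ {n : ℕ}, McNaughtonGame (Fin n) → ℕ)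
    (space : ∀ {n : ℕ}, McNaughtonGame (Fin n) → ℕ → ℕ)
    (word : ∀ {n : ℕ}, McNaughtonGame (Fin n) → ℕ) : Prop :=
  ∀ (n : ℕ), 0 < n → ∀ (G : McNaughtonGame (Fin n)) (inp : List ℕ), G.IsRepresentation inp →
    RAM.ComputesWithin p inp (G.IsSolution p.work)
      (time G) (space G (RAM.bitLength inp)) (word G)

/-! ## Winning regions of subgames via certificates -/

namespace McNaughtonGame

universe u

variable {V : Type u} [Fintype V] [DecidableEq V] (G : McNaughtonGame V)

/-! The algorithm is a dynamic program over the sets `X` of positions. It does not store winning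
regions: for each `X` and each player it records only whether this player wins the subgame on `X`
from at least one position, together with one such position if witnesses are kept.

Let `X` be a subarena and let `σ` be its owner, that is, `X ∩ W ∈ F σ`. For `w ∈ X ∩ W`, call what
the `σ`-attractor of `w` leaves of `X` the residue of `w`. If `σ` wins everywhere on each of these
residues, then `σ` wins everywhere on `X`: the positions of `X ∩ W` serve cyclically as targets;
inside the attractor of the current target the play is forced there, and outside of it a winning
strategy on the residue is followed. Either every target is reached infinitely often, so that `Inf ∩
W = X ∩ W`, or the play remains in one residue and is won there (`mem_winIn_of_residues`).
Conversely, a residue is a trap for `σ`, so whatever the opponent wins there is also won on `X`.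
Hence the opponent wins somewhere on `X` if and only if the table says so for one of at most `|W|`
residues (`TableOk.entry_opponent`).

If the opponent wins nowhere, the owner wins everywhere, by determinacy. If the opponent wins from
`v`, then the whole opponent attractor of `v` is lost for `σ`, and removing it does not change the
region of `σ` (`IsResidue.winIn_eq`); so `σ` wins somewhere on `X` if and only if this holds on that
smaller set (`TableOk.entry_owner`). With a recorded witness `v` this takes a single further
attractor, and an entry takes as many bits as a number up to `n`. Without witnesses all `v ∈ X` are
tried: positive answers remain sound because every residue is a trap, and an entry is a single bit.
This trade-off separates the two claims.

The regions of the whole game are recovered from the table without storing regions of subgames: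
Player 0 wins from `v` exactly if `v` lies in some trap `X` for Player 1 in which Player 1 wins
nowhere (`exists_marked_iff`). Sets are processed in the order of their binary codes, in which
proper subsets come first (`setCode_lt_of_ssubset`). An attractor costs `O(n + |E|)` by counters and
predecessor lists (`wp_attractor`), and `n ≤ |E|`.

Winning in subgames is expressed by certificates (`IsCert`), which are easy to glue, restrict and
multiply; `Win_eq_winIn` relates them to strategies. The procedure is written in a small structured
language. Its compiler is verified once (`Cmd.code_correct`, `computesWithin_of_exec`), and
`wp_decideGames` gives correctness and running time of the structured program. -/

theorem fin2_sub_sub (σ : Fin 2) : 1 - (1 - σ) = σ := sub_sub_cancel 1 σ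

theorem mem_pos_sub (σ : Fin 2) (v : V) : v ∈ G.pos (1 - σ) ↔ v ∉ G.pos σ := by
  have h1 : v ∈ G.pos 0 ∨ v ∈ G.pos 1 := by
    rw [← Finset.mem_union, G.pos_union]; exact Finset.mem_univ v
  have h2 : ¬ (v ∈ G.pos 0 ∧ v ∈ G.pos 1) := by
    rw [← Finset.mem_inter, G.pos_disjoint]; exact Finset.notMem_empty v
  match σ with
  | 0 => change v ∈ G.pos 1 ↔ _; tauto
  | 1 => change v ∈ G.pos 0 ↔ _; tauto

omit [Fintype V] [DecidableEq V] in
theorem infinitySet_shift (ρ : ℕ → V) (k : ℕ) :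
    infinitySet (fun i => ρ (i + k)) = infinitySet ρ := by
  ext v
  simp only [infinitySet, Set.mem_ofPred_eq, frequently_atTop]
  constructor
  · intro h a
    obtain ⟨b, hb, e⟩ := h a
    exact ⟨b + k, by omega, e⟩
  · intro h a
    obtain ⟨b, hb, e⟩ := h (a + k)
    exact ⟨b - k, by omega, by rw [← e]; congr 1; omega⟩

theorem winsPlay_shift {σ : Fin 2} {ρ : ℕ → V} (k : ℕ) :
    G.WinsPlay σ (fun i => ρ (i + k)) ↔ G.WinsPlay σ ρ := by
  simp only [WinsPlay, infinitySet_shift]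

theorem not_both_winsPlay (σ : Fin 2) (ρ : ℕ → V) (h0 : G.WinsPlay σ ρ)
    (h1 : G.WinsPlay (1 - σ) ρ) : False := by
  obtain ⟨X, hX, e⟩ := h0
  obtain ⟨Y, hY, e'⟩ := h1
  have : X = Y := by exact_mod_cast e.trans e'.symm
  subst this
  have : X ∈ G.F 0 ∩ G.F 1 := by
    match σ with
    | 0 => exact Finset.mem_inter.2 ⟨hX, hY⟩
    | 1 => exact Finset.mem_inter.2 ⟨hY, hX⟩
  rw [G.F_disjoint] at this
  exact Finset.notMem_empty _ this

/-- Each position of `X` has a successor in `X`. -/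
def Subarena (X : Finset V) : Prop := ∀ v ∈ X, ∃ u ∈ X, (v, u) ∈ G.E

/-- A transition system whose states are labelled with positions of the subgame on `X`, which
answers all moves of the opponent of `σ`, and all of whose infinite paths are won by `σ`. -/
structure IsCert (σ : Fin 2) (X : Finset V) {S : Type u} (π : S → V) (R : S → S → Prop) :
    Prop where
  mem : ∀ s, π s ∈ X
  own : ∀ s, π s ∈ G.pos σ → ∃ s', R s s' ∧ (π s, π s') ∈ G.E
  opp : ∀ s, π s ∉ G.pos σ → ∀ u ∈ X, (π s, u) ∈ G.E → ∃ s', R s s' ∧ π s' = u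
  win : ∀ p : ℕ → S, (∀ i, R (p i) (p (i + 1))) → G.WinsPlay σ (fun i => π (p i))

/-- The winning region of `σ` in the subgame on `X`. -/
def winIn (σ : Fin 2) (X : Finset V) : Set V :=
  {v | ∃ (S : Type u) (π : S → V) (R : S → S → Prop), G.IsCert σ X π R ∧ ∃ s, π s = v}

variable {G}

theorem winIn_subset {σ : Fin 2} {X : Finset V} {v : V} (h : v ∈ G.winIn σ X) : v ∈ X := by
  obtain ⟨S, π, R, hc, s, rfl⟩ := h
  exact hc.mem s

theorem IsCert.mem_winIn {σ : Fin 2} {X : Finset V} {S : Type u} {π : S → V} {R : S → S → Prop}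
    (h : G.IsCert σ X π R) (s : S) : π s ∈ G.winIn σ X := ⟨S, π, R, h, s, rfl⟩

/-- Transitions within the members of a family. -/
def sigmaRel {ι : Type u} {S : ι → Type u} (R : ∀ w, S w → S w → Prop) (x y : Σ w, S w) : Prop :=
  ∃ h : x.1 = y.1, R y.1 (h ▸ x.2) y.2

/-- A transition never changes the index, so an infinite path through the disjoint union is a path
of a single member of the family. -/
theorem sigmaRel_path_wins {σ : Fin 2} {ι : Type u} {S : ι → Type u} {π : ∀ w, S w → V}
    {R : ∀ w, S w → S w → Prop}
    (win : ∀ w, ∀ p : ℕ → S w, (∀ i, R w (p i) (p (i + 1))) → G.WinsPlay σ (fun i => π w (p i)))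
    (p : ℕ → Σ w, S w) (hp : ∀ i, sigmaRel R (p i) (p (i + 1))) :
    G.WinsPlay σ (fun i => π (p i).1 (p i).2) := by
  obtain ⟨v, hv⟩ : ∃ v, v = (p 0).1 := ⟨_, rfl⟩
  have h : ∀ i, ∃ x : S v, p i = ⟨v, x⟩ := by
    intro i
    induction i with
    | zero => subst hv; exact ⟨(p 0).2, rfl⟩
    | succ i ih =>
      obtain ⟨x, hx⟩ := ih
      obtain ⟨h, -⟩ := hp i
      rw [hx] at h
      match p (i + 1), h with
      | ⟨w, y⟩, h => simp only at h; subst h; exact ⟨y, rfl⟩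
  choose q hq using h
  have := win v q (fun i => by
    obtain ⟨h, hr⟩ := hp i
    revert h hr
    rw [hq i, hq (i + 1)]
    exact fun _ hr => hr)
  have e : (fun i => π (p i).1 (p i).2) = fun i => π v (q i) := funext fun i => by rw [hq i]
  rw [e]
  exact this

variable (G) in
/-- A single certificate for the whole winning region. -/
theorem exists_universal_cert (σ : Fin 2) (X : Finset V) :
    ∃ (S : Type u) (π : S → V) (R : S → S → Prop), G.IsCert σ X π R ∧
      ∀ v ∈ G.winIn σ X, ∃ s, π s = v := by
  choose S π R hc s hs using fun v : G.winIn σ X => v.2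
  refine ⟨Σ v, S v, fun x => π x.1 x.2, sigmaRel R, ⟨?_, ?_, ?_, ?_⟩, ?_⟩
  · exact fun x => (hc x.1).mem x.2
  · rintro ⟨v, x⟩ hx
    obtain ⟨s', h1, h2⟩ := (hc v).own x hx
    exact ⟨⟨v, s'⟩, ⟨rfl, h1⟩, h2⟩
  · rintro ⟨v, x⟩ hx u hu he
    obtain ⟨s', h1, h2⟩ := (hc v).opp x hx u hu he
    exact ⟨⟨v, s'⟩, ⟨rfl, h1⟩, h2⟩
  · exact sigmaRel_path_wins fun w => (hc w).win
  · exact fun v hv => ⟨⟨⟨v, hv⟩, s ⟨v, hv⟩⟩, hs ⟨v, hv⟩⟩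

/-- A certificate may be left towards positions that are known to be won. -/
theorem mem_winIn_of_escape {σ : Fin 2} {X : Finset V} {S : Type u} (π : S → V)
    (R : S → S → Prop) (mem : ∀ s, π s ∈ X)
    (own : ∀ s, π s ∈ G.pos σ → (∃ s', R s s' ∧ (π s, π s') ∈ G.E) ∨
      ∃ u ∈ G.winIn σ X, (π s, u) ∈ G.E)
    (opp : ∀ s, π s ∉ G.pos σ → ∀ u ∈ X, (π s, u) ∈ G.E →
      (∃ s', R s s' ∧ π s' = u) ∨ u ∈ G.winIn σ X)
    (win : ∀ p : ℕ → S, (∀ i, R (p i) (p (i + 1))) → G.WinsPlay σ (fun i => π (p i)))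
    (s : S) : π s ∈ G.winIn σ X := by
  obtain ⟨T, π', R', hc, hT⟩ := G.exists_universal_cert σ X
  -- Passing from `S` to `T` is unrestricted. This is harmless: it happens at most once on a path,
  -- and the winner does not depend on a finite prefix.
  let R'' : S ⊕ T → S ⊕ T → Prop := fun x y =>
    match x, y with
    | .inl a, .inl b => R a b
    | .inl _, .inr _ => True
    | .inr _, .inl _ => False
    | .inr a, .inr b => R' a b
  refine ⟨S ⊕ T, Sum.elim π π', R'', ⟨?_, ?_, ?_, ?_⟩, .inl s, rfl⟩
  · rintro (a | a)
    exacts [mem a, hc.mem a]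
  · rintro (a | a) ha
    · rcases own a ha with ⟨s', h1, h2⟩ | ⟨u, hu, he⟩
      · exact ⟨.inl s', h1, h2⟩
      · obtain ⟨t, rfl⟩ := hT u hu
        exact ⟨.inr t, trivial, he⟩
    · obtain ⟨t, h1, h2⟩ := hc.own a ha
      exact ⟨.inr t, h1, h2⟩
  · rintro (a | a) ha u hu he
    · rcases opp a ha u hu he with ⟨s', h1, h2⟩ | hw
      · exact ⟨.inl s', h1, h2⟩
      · obtain ⟨t, rfl⟩ := hT u hw
        exact ⟨.inr t, trivial, rfl⟩
    · obtain ⟨t, h1, h2⟩ := hc.opp a ha u hu he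
      exact ⟨.inr t, h1, h2⟩
  · intro p hp
    by_cases h : ∃ k t, p k = .inr t
    · obtain ⟨k, t, hk⟩ := h
      have h : ∀ i, ∃ t, p (i + k) = .inr t := by
        intro i
        induction i with
        | zero => exact ⟨t, by simpa using hk⟩
        | succ i ih =>
          obtain ⟨t, ht⟩ := ih
          have h1 := hp (i + k)
          rw [ht] at h1
          have e : i + 1 + k = i + k + 1 := by omega
          rw [e]
          match hq : p (i + k + 1) with
          | .inl a => rw [hq] at h1; exact h1.elim
          | .inr a => exact ⟨a, rfl⟩
      choose q hq using h
      rw [← G.winsPlay_shift k]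
      have := hc.win q (fun i => by
        have h1 := hp (i + k)
        have e : i + 1 + k = i + k + 1 := by omega
        rw [← e, hq, hq] at h1
        exact h1)
      simpa only [hq, Sum.elim_inr] using this
    · have h : ∀ i, ∃ t, p i = .inl t := by
        intro i
        match hq : p i with
        | .inl a => exact ⟨a, rfl⟩
        | .inr a => exact (h ⟨i, a, hq⟩).elim
      choose q hq using h
      have := win q (fun i => by
        have h1 := hp i
        rw [hq, hq] at h1
        exact h1)
      simpa only [hq, Sum.elim_inl] using this

variable (G) in
/-- `Y` is a part of `X` which `σ` cannot leave and in which the opponent can stay. -/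
structure IsTrap (σ : Fin 2) (X Y : Finset V) : Prop where
  sub : Y ⊆ X
  closed : ∀ u ∈ Y, u ∈ G.pos σ → ∀ v ∈ X, (u, v) ∈ G.E → v ∈ Y
  stay : ∀ u ∈ Y, u ∉ G.pos σ → ∃ v ∈ Y, (u, v) ∈ G.E

theorem IsTrap.subarena {σ : Fin 2} {X Y : Finset V} (h : G.IsTrap σ X Y) (hX : G.Subarena X) :
    G.Subarena Y := by
  intro u hu
  by_cases hp : u ∈ G.pos σ
  · obtain ⟨v, hv, he⟩ := hX u (h.sub hu)
    exact ⟨v, h.closed u hu hp v hv he, he⟩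
  · exact h.stay u hu hp

/-- A trap for the opponent preserves wins. -/
theorem IsTrap.winIn_subset {σ : Fin 2} {X Y : Finset V} (h : G.IsTrap (1 - σ) X Y) :
    G.winIn σ Y ⊆ G.winIn σ X := by
  rintro v ⟨S, π, R, hc, s, rfl⟩
  refine IsCert.mem_winIn ⟨fun s => h.sub (hc.mem s), hc.own, ?_, hc.win⟩ s
  intro s hs u hu he
  exact hc.opp s hs u (h.closed _ (hc.mem s) ((G.mem_pos_sub _ _).2 hs) u hu he) he

/-- A system with one state and no transitions suffices: the first move already escapes to a won
position. -/
theorem winIn_of_own {σ : Fin 2} {X : Finset V} {v u : V} (hv : v ∈ X) (hp : v ∈ G.pos σ)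
    (hu : u ∈ G.winIn σ X) (he : (v, u) ∈ G.E) : v ∈ G.winIn σ X := by
  refine mem_winIn_of_escape (S := PUnit) (fun _ => v) (fun _ _ => False) (fun _ => hv)
    (fun _ _ => .inr ⟨u, hu, he⟩) (fun _ h => (h hp).elim) (fun p hp => (hp 0).elim) .unit

theorem winIn_of_opp {σ : Fin 2} {X : Finset V} {v : V} (hv : v ∈ X) (hp : v ∉ G.pos σ)
    (hu : ∀ u ∈ X, (v, u) ∈ G.E → u ∈ G.winIn σ X) : v ∈ G.winIn σ X := by
  refine mem_winIn_of_escape (S := PUnit) (fun _ => v) (fun _ _ => False) (fun _ => hv)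
    (fun _ h => (hp h).elim) (fun _ _ u hu' he => .inr (hu u hu' he))
    (fun p hp => (hp 0).elim) .unit

/-- Two certificates for opposite players run against each other on the pairs of states with equal
labels: at each position one of them chooses the move and the other one answers it. The resulting
path would be won by both. -/
theorem winIn_disjoint {σ : Fin 2} {X : Finset V} {v : V} (h0 : v ∈ G.winIn σ X)
    (h1 : v ∈ G.winIn (1 - σ) X) : False := by
  obtain ⟨S, π, R, hc, s, hs⟩ := h0
  obtain ⟨T, ϖ, Q, hd, t, ht⟩ := h1
  have key : ∀ x : {x : S × T // π x.1 = ϖ x.2}, ∃ y : {x : S × T // π x.1 = ϖ x.2},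
      R x.1.1 y.1.1 ∧ Q x.1.2 y.1.2 := by
    rintro ⟨⟨a, b⟩, hab⟩
    simp only at hab
    by_cases hp : π a ∈ G.pos σ
    · obtain ⟨a', h1, h2⟩ := hc.own a hp
      obtain ⟨b', h3, h4⟩ := hd.opp b (by rw [← hab, G.mem_pos_sub]; exact not_not.2 hp) (π a')
        (hc.mem a') (by rw [← hab]; exact h2)
      exact ⟨⟨(a', b'), h4.symm⟩, h1, h3⟩
    · obtain ⟨b', h1, h2⟩ := hd.own b (by rw [← hab, G.mem_pos_sub]; exact hp)
      obtain ⟨a', h3, h4⟩ := hc.opp a hp (ϖ b') (hd.mem b') (by rw [hab]; exact h2)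
      exact ⟨⟨(a', b'), h4⟩, h3, h1⟩
  choose f hf using key
  let p : ℕ → {x : S × T // π x.1 = ϖ x.2} := fun i => f^[i] ⟨(s, t), hs.trans ht.symm⟩
  have hp : ∀ i, p (i + 1) = f (p i) := fun i => Function.iterate_succ_apply' _ _ _
  have w0 := hc.win (fun i => (p i).1.1) (fun i => by rw [hp]; exact (hf _).1)
  have w1 := hd.win (fun i => (p i).1.2) (fun i => by rw [hp]; exact (hf _).2)
  simp only [fun i => (p i).2] at w0
  exact G.not_both_winsPlay σ _ w0 w1

/-! ## Attractors -/

variable (G) in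
/-- The positions of `X` from which `σ` can enforce a visit of `w` within `k` moves. -/
def attrN (σ : Fin 2) (X : Finset V) (w : V) : ℕ → Set V
  | 0 => {w}
  | k + 1 => attrN σ X w k ∪ {v | v ∈ X ∧
      ((v ∈ G.pos σ ∧ ∃ u ∈ attrN σ X w k, u ∈ X ∧ (v, u) ∈ G.E) ∨
       (v ∉ G.pos σ ∧ ∀ u ∈ X, (v, u) ∈ G.E → u ∈ attrN σ X w k))}

variable (G) in
/-- The positions of `X` from which `σ` can enforce a visit of `w`. -/
def attr (σ : Fin 2) (X : Finset V) (w : V) : Set V := ⋃ k, G.attrN σ X w k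

theorem attrN_mono {σ : Fin 2} {X : Finset V} {w : V} : Monotone (G.attrN σ X w) :=
  monotone_nat_of_le_succ fun _ => Set.subset_union_left

theorem mem_attr_self {σ : Fin 2} {X : Finset V} {w : V} : w ∈ G.attr σ X w :=
  Set.mem_iUnion.2 ⟨0, rfl⟩

theorem mem_attr_of_own {σ : Fin 2} {X : Finset V} {w v u : V} (hv : v ∈ X) (hp : v ∈ G.pos σ)
    (hX : u ∈ X) (hu : u ∈ G.attr σ X w) (he : (v, u) ∈ G.E) : v ∈ G.attr σ X w := by
  obtain ⟨k, hk⟩ := Set.mem_iUnion.1 hu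
  exact Set.mem_iUnion.2 ⟨k + 1, .inr ⟨hv, .inl ⟨hp, u, hk, hX, he⟩⟩⟩

/-- There are only finitely many successors, so one level of the increasing chain `attrN` contains
all of them. -/
theorem mem_attr_of_opp {σ : Fin 2} {X : Finset V} {w v : V} (hv : v ∈ X) (hp : v ∉ G.pos σ)
    (hu : ∀ u ∈ X, (v, u) ∈ G.E → u ∈ G.attr σ X w) : v ∈ G.attr σ X w := by
  have h : ∀ u : V, ∃ k, u ∈ X → (v, u) ∈ G.E → u ∈ G.attrN σ X w k := by
    intro u
    by_cases h : u ∈ X ∧ (v, u) ∈ G.E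
    · obtain ⟨k, hk⟩ := Set.mem_iUnion.1 (hu u h.1 h.2)
      exact ⟨k, fun _ _ => hk⟩
    · exact ⟨0, fun h1 h2 => (h ⟨h1, h2⟩).elim⟩
  choose k hk using h
  refine Set.mem_iUnion.2 ⟨(Finset.univ.sup k) + 1, .inr ⟨hv, .inr ⟨hp, fun u h1 h2 => ?_⟩⟩⟩
  exact attrN_mono (Finset.le_sup (f := k) (Finset.mem_univ u)) (hk u h1 h2)

variable (G) in
/-- `Y` is the complement in `X` of the `σ`-attractor of `w`. -/
structure IsResidue (σ : Fin 2) (X : Finset V) (w : V) (Y : Finset V) : Prop where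
  trap : G.IsTrap σ X Y
  attr : ∀ v ∈ X, v ∉ Y → v ∈ G.attr σ X w
  notMem : w ∉ Y

variable (G) in
-- A position outside the attractor has no attracted successor if it belongs to `σ`, and some
-- successor that is not attracted if it belongs to the opponent. So the complement of the attractor
-- is a trap.
theorem exists_residue (σ : Fin 2) (X : Finset V) (w : V) : ∃ Y, G.IsResidue σ X w Y := by
  classical
  refine ⟨X.filter (· ∉ G.attr σ X w), ⟨Finset.filter_subset _ _, ?_, ?_⟩, ?_, ?_⟩
  · intro u hu hp v hv he
    rw [Finset.mem_filter] at hu ⊢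
    exact ⟨hv, fun h => hu.2 (mem_attr_of_own hu.1 hp hv h he)⟩
  · intro u hu hp
    rw [Finset.mem_filter] at hu
    by_contra! h
    refine hu.2 (mem_attr_of_opp hu.1 hp fun v hv he => ?_)
    by_contra hn
    exact h v (Finset.mem_filter.2 ⟨hv, hn⟩) he
  · intro v hv h
    by_contra hn
    exact h (Finset.mem_filter.2 ⟨hv, hn⟩)
  · intro h
    exact (Finset.mem_filter.1 h).2 mem_attr_self

/-- By induction on the level: a won target extends backwards along every forced move. -/
theorem attr_subset_winIn {σ : Fin 2} {X : Finset V} {w : V} (hw : w ∈ G.winIn σ X) :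
    G.attr σ X w ⊆ G.winIn σ X := by
  refine Set.iUnion_subset fun k => ?_
  induction k with
  | zero => rintro v rfl; exact hw
  | succ k ih =>
    rintro v (h | ⟨hv, ⟨hp, u, hu, -, he⟩ | ⟨hp, h⟩⟩)
    · exact ih h
    · exact winIn_of_own hv hp (ih hu) he
    · exact winIn_of_opp hv hp fun u hu he => ih (h u hu he)

/-- Removing the `σ`-attractor of a position won by `σ` leaves the opponent's region. -/
theorem IsResidue.winIn_eq {σ : Fin 2} {X Y : Finset V} {w : V} (h : G.IsResidue σ X w Y)
    (hw : w ∈ G.winIn σ X) : G.winIn (1 - σ) Y = G.winIn (1 - σ) X := by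
  refine Set.Subset.antisymm (IsTrap.winIn_subset (by rw [fin2_sub_sub]; exact h.trap)) ?_
  intro v hv
  obtain ⟨S, π, R, hc, hS⟩ := G.exists_universal_cert (1 - σ) X
  obtain ⟨s, rfl⟩ := hS v hv
  refine IsCert.mem_winIn ⟨fun s => ?_, hc.own, ?_, hc.win⟩ s
  · by_contra hn
    -- A certificate of the opponent on `X` never meets the attractor, since the attractor is won by
    -- `σ`. So it is already a certificate on the residue.
    exact winIn_disjoint (attr_subset_winIn hw (h.attr _ (hc.mem s) hn)) (hc.mem_winIn s)
  · exact fun s hs u hu he => hc.opp s hs u (h.trap.sub hu) he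

theorem IsResidue.winIn_subset {σ : Fin 2} {X Y : Finset V} {w : V} (h : G.IsResidue σ X w Y) :
    G.winIn (1 - σ) Y ⊆ G.winIn (1 - σ) X :=
  IsTrap.winIn_subset (by rw [fin2_sub_sub]; exact h.trap)

/-- The winning region is a trap for the opponent and is won within itself. -/
theorem exists_trap_of_mem_winIn {σ : Fin 2} {X : Finset V} {v : V} (hv : v ∈ G.winIn σ X) :
    ∃ Y, G.IsTrap (1 - σ) X Y ∧ v ∈ Y ∧ ∀ y ∈ Y, y ∈ G.winIn σ Y := by
  classical
  obtain ⟨S, π, R, hc, hS⟩ := G.exists_universal_cert σ X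
  have hmem : ∀ u, u ∈ X.filter (· ∈ G.winIn σ X) ↔ ∃ s, π s = u := by
    intro u
    rw [Finset.mem_filter]
    exact ⟨fun h => hS u h.2, by rintro ⟨s, rfl⟩; exact ⟨hc.mem s, hc.mem_winIn s⟩⟩
  -- The winning region is exactly the set of labels of the universal certificate, so closure under
  -- moves can be read off from the certificate.
  refine ⟨X.filter (· ∈ G.winIn σ X), ⟨Finset.filter_subset _ _, ?_, ?_⟩, ?_, ?_⟩
  · intro u hu hp w hw he
    obtain ⟨s, rfl⟩ := (hmem u).1 hu
    obtain ⟨s', -, rfl⟩ := hc.opp s ((G.mem_pos_sub _ _).1 hp) w hw he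
    exact (hmem _).2 ⟨s', rfl⟩
  · intro u hu hp
    obtain ⟨s, rfl⟩ := (hmem u).1 hu
    rw [G.mem_pos_sub, not_not] at hp
    obtain ⟨s', -, h⟩ := hc.own s hp
    exact ⟨_, (hmem _).2 ⟨s', rfl⟩, h⟩
  · exact (hmem v).2 (hS v hv)
  · intro y hy
    obtain ⟨s, rfl⟩ := (hmem y).1 hy
    refine IsCert.mem_winIn ⟨fun s => (hmem _).2 ⟨s, rfl⟩, hc.own, ?_, hc.win⟩ s
    exact fun s hs u hu he => hc.opp s hs u (Finset.mem_of_mem_filter u hu) he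

end McNaughtonGame

/-! ### Cyclic pursuit of targets, and determinacy of subgames. -/

namespace McNaughtonGame

universe u

variable {V : Type u} [Fintype V] [DecidableEq V] {G : McNaughtonGame V}

theorem fin2_eq_or (σ ρ : Fin 2) : σ = ρ ∨ σ = 1 - ρ := by revert σ ρ; decide

/-- The play stays in `X` and visits all of `X ∩ W` again and again, so `Inf ∩ W` is exactly `X ∩
W`. -/
theorem winsPlay_of_frequently {σ : Fin 2} {X : Finset V} (hF : X ∩ G.W ∈ G.F σ) {ρ : ℕ → V}
    (hX : ∀ i, ρ i ∈ X) (h : ∀ w ∈ X ∩ G.W, ∀ k, ∃ i ≥ k, ρ i = w) : G.WinsPlay σ ρ := by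
  refine ⟨_, hF, ?_⟩
  ext v
  simp only [infinitySet, frequently_atTop, Finset.coe_inter, Set.mem_inter_iff,
    Finset.mem_coe, Set.mem_ofPred_eq, and_congr_left_iff]
  intro hv
  refine ⟨fun hx => h v (Finset.mem_inter.2 ⟨hx, hv⟩), fun hi => ?_⟩
  obtain ⟨i, -, rfl⟩ := hi 0
  exact hX i

omit [Fintype V] [DecidableEq V] in
theorem exists_recurrent_enumeration {Z : Finset V} (hZ : Z.Nonempty) :
    ∃ f : ℕ → V, (∀ i, f i ∈ Z) ∧ ∀ w ∈ Z, ∀ k, ∃ i ≥ k, f i = w := by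
  have hl : 0 < Z.toList.length := by rw [Finset.length_toList]; exact hZ.card_pos
  refine ⟨fun i => Z.toList[i % Z.toList.length]'(Nat.mod_lt _ hl),
    fun i => Finset.mem_toList.1 (List.getElem_mem _), fun w hw k => ?_⟩
  obtain ⟨j, hj, e⟩ := List.mem_iff_getElem.1 (Finset.mem_toList.2 hw)
  refine ⟨j + Z.toList.length * k, ?_, ?_⟩
  · have := Nat.le_mul_of_pos_left k hl
    omega
  · simp only [Nat.add_mul_mod_self_left, Nat.mod_eq_of_lt hj, e]

/-- If the positions of `W` that occur in `X` form a set won by `σ`, and `σ` wins everywhere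
once the attractor of any such position is removed, then `σ` wins everywhere in `X`. -/
theorem mem_winIn_of_residues {σ : Fin 2} {X : Finset V} (hX : G.Subarena X)
    (hF : X ∩ G.W ∈ G.F σ) (Y : V → Finset V)
    (hY : ∀ w ∈ X ∩ G.W, G.IsResidue σ X w (Y w))
    (hwin : ∀ w ∈ X ∩ G.W, ∀ y ∈ Y w, y ∈ G.winIn σ (Y w)) {v : V} (hv : v ∈ X) :
    v ∈ G.winIn σ X := by
  classical
  rcases (X ∩ G.W).eq_empty_or_nonempty with hZ | hZ
  · refine IsCert.mem_winIn (S := {x // x ∈ X}) (π := Subtype.val) (R := fun _ _ => True)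
      ⟨fun s => s.2, fun s _ => ?_, fun s _ u hu he => ⟨⟨u, hu⟩, trivial, rfl⟩,
        fun p _ => winsPlay_of_frequently hF (fun i => (p i).2) ?_⟩ ⟨v, hv⟩
    · obtain ⟨u, hu, he⟩ := hX s s.2
      exact ⟨⟨u, hu⟩, trivial, he⟩
    · rw [hZ]
      exact fun w hw => (Finset.notMem_empty w hw).elim
  obtain ⟨f, hfZ, hf⟩ := exists_recurrent_enumeration hZ
  choose S π R hc hS using fun w => G.exists_universal_cert σ (Y w)
  -- A state consists of the index `i` of the current target `f i` and either a position from which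
  -- this target is being attracted, or a state of the certificate for the residue of `f i`.
  let ok : ℕ × (V ⊕ Σ w, S w) → Prop := fun x => match x.2 with
    | .inl u => u ∈ X ∧ u ∈ G.attr σ X (f x.1)
    | .inr a => a.1 = f x.1
  let lab : V ⊕ (Σ w, S w) → V := Sum.elim id (fun a => π a.1 a.2)
  have hex : ∀ i u, u ∈ G.attr σ X (f i) → ∃ k, u ∈ G.attrN σ X (f i) k :=
    fun i u h => Set.mem_iUnion.1 h
  let rk : ℕ → V → ℕ := fun i u => sInf {k | u ∈ G.attrN σ X (f i) k}
  -- The index advances only at the target itself. Elsewhere in the attractor the rank must fall. A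
  -- certificate state is followed by another one of the same member, or by an entry into the
  -- attractor.
  let T : ℕ × (V ⊕ Σ w, S w) → ℕ × (V ⊕ Σ w, S w) → Prop := fun x y => match x.2 with
    | .inl u => (u = f x.1 ∧ y.1 = x.1 + 1) ∨
        (u ≠ f x.1 ∧ y.1 = x.1 ∧ ∃ u', y.2 = .inl u' ∧ rk x.1 u' < rk x.1 u)
    | .inr a => y.1 = x.1 ∧ ((∃ b, y.2 = .inr b ∧ sigmaRel R a b) ∨ ∃ u', y.2 = .inl u')
  have labX : ∀ x, ok x → lab x.2 ∈ X := by
    rintro ⟨i, u | ⟨w, s⟩⟩ h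
    · exact h.1
    · obtain rfl : w = f i := h
      exact (hY _ (hfZ i)).trap.sub ((hc _).mem s)
  have place : ∀ i, ∀ u ∈ X, ∃ y, ok (i, y) ∧ lab y = u := by
    intro i u hu
    by_cases h : u ∈ Y (f i)
    · obtain ⟨s, hs⟩ := hS _ u (hwin _ (hfZ i) u h)
      exact ⟨.inr ⟨f i, s⟩, rfl, hs⟩
    · exact ⟨.inl u, ⟨hu, (hY _ (hfZ i)).attr u hu h⟩, rfl⟩
  have down : ∀ i u, u ∈ X → u ∈ G.attr σ X (f i) → u ≠ f i → ∃ k, k < rk i u ∧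
      ((u ∈ G.pos σ ∧ ∃ u' ∈ G.attrN σ X (f i) k, u' ∈ X ∧ (u, u') ∈ G.E) ∨
       (u ∉ G.pos σ ∧ ∀ u' ∈ X, (u, u') ∈ G.E → u' ∈ G.attrN σ X (f i) k)) := by
    intro i u hu ha hne
    have hmem : u ∈ G.attrN σ X (f i) (rk i u) := Nat.sInf_mem (hex i u ha)
    match hk : rk i u with
    | 0 => rw [hk] at hmem; exact (hne hmem).elim
    | k + 1 =>
      rw [hk] at hmem
      rcases hmem with h | ⟨-, h⟩
      · have : rk i u ≤ k := Nat.sInf_le h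
        omega
      · exact ⟨k, Nat.lt_succ_self k, h⟩
  have rk_le : ∀ i u k, u ∈ G.attrN σ X (f i) k → rk i u ≤ k := fun i u k h => Nat.sInf_le h
  have cert : G.IsCert σ X (S := {x // ok x}) (fun x => lab x.1.2) (fun x y => T x.1 y.1) := by
    refine ⟨fun x => labX x.1 x.2, ?_, ?_, ?_⟩
    · rintro ⟨⟨i, u | ⟨w, s⟩⟩, hok⟩ hp
      · by_cases hu : u = f i
        · obtain ⟨u', h1, h2⟩ := hX u hok.1
          obtain ⟨y, hy, rfl⟩ := place (i + 1) u' h1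
          exact ⟨⟨(i + 1, y), hy⟩, .inl ⟨hu, rfl⟩, h2⟩
        · obtain ⟨k, hk, ⟨-, u', h1, h2, h3⟩ | ⟨h, -⟩⟩ := down i u hok.1 hok.2 hu
          · exact ⟨⟨(i, .inl u'), h2, Set.mem_iUnion.2 ⟨k, h1⟩⟩,
              .inr ⟨hu, rfl, u', rfl, (rk_le _ _ _ h1).trans_lt hk⟩, h3⟩
          · exact (h hp).elim
      · obtain rfl : w = f i := hok
        obtain ⟨s', h1, h2⟩ := (hc _).own s hp
        exact ⟨⟨(i, .inr ⟨_, s'⟩), rfl⟩, ⟨rfl, .inl ⟨_, rfl, rfl, h1⟩⟩, h2⟩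
    · rintro ⟨⟨i, u | ⟨w, s⟩⟩, hok⟩ hp u' hu' he
      · by_cases hu : u = f i
        · obtain ⟨y, hy, h⟩ := place (i + 1) u' hu'
          exact ⟨⟨(i + 1, y), hy⟩, .inl ⟨hu, rfl⟩, h⟩
        · obtain ⟨k, hk, ⟨h, -⟩ | ⟨-, h⟩⟩ := down i u hok.1 hok.2 hu
          · exact (hp h).elim
          · exact ⟨⟨(i, .inl u'), hu', Set.mem_iUnion.2 ⟨k, h u' hu' he⟩⟩,
              .inr ⟨hu, rfl, u', rfl, (rk_le _ _ _ (h u' hu' he)).trans_lt hk⟩, rfl⟩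
      · obtain rfl : w = f i := hok
        by_cases h : u' ∈ Y (f i)
        · obtain ⟨s', h1, h2⟩ := (hc _).opp s hp u' h he
          exact ⟨⟨(i, .inr ⟨_, s'⟩), rfl⟩, ⟨rfl, .inl ⟨_, rfl, rfl, h1⟩⟩, h2⟩
        · exact ⟨⟨(i, .inl u'), hu', (hY _ (hfZ i)).attr u' hu' h⟩, ⟨rfl, .inr ⟨_, rfl⟩⟩, rfl⟩
    · intro p hp
      have step : ∀ j, (p (j + 1)).1.1 = (p j).1.1 ∨
          ((p (j + 1)).1.1 = (p j).1.1 + 1 ∧ lab (p j).1.2 = f (p j).1.1) := by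
        intro j
        have h := hp j
        rcases hu : (p j).1.2 with u | a
        · simp only [T, hu] at h
          rcases h with ⟨h1, h2⟩ | ⟨-, h, -⟩
          · exact .inr ⟨h2, h1⟩
          · exact .inl h
        · simp only [T, hu] at h
          exact .inl h.1
      have mono : Monotone (fun j => (p j).1.1) := monotone_nat_of_le_succ fun j => by
        rcases step j with h | h <;> omega
      -- If the index is unbounded, it passes each `i`, and it can leave `i` only at `f i`; as the
      -- enumeration is recurrent, every position of `X ∩ W` is visited infinitely often. If the
      -- index is bounded, it is eventually constant.
      by_cases hb : ∀ k, ∃ j, k < (p j).1.1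
      · refine winsPlay_of_frequently hF (fun i => labX _ (p i).2) fun w hw N => ?_
        obtain ⟨i, hi, rfl⟩ := hf w hw (p N).1.1
        obtain ⟨j, hj, hmin⟩ : ∃ j, i < (p j).1.1 ∧ ∀ j' < j, ¬ i < (p j').1.1 :=
          ⟨Nat.find (hb i), Nat.find_spec (hb i), fun _ => Nat.find_min (hb i)⟩
        have hN : N < j := by
          by_contra hn
          have : (p j).1.1 ≤ (p N).1.1 := mono (not_lt.1 hn)
          omega
        obtain ⟨j', rfl⟩ : ∃ j', j = j' + 1 := ⟨j - 1, by omega⟩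
        have h1 := hmin j' (Nat.lt_succ_self _)
        rcases step j' with h | ⟨h, h'⟩
        · omega
        · have e : (p j').1.1 = i := by omega
          exact ⟨j', by omega, by rw [← e]; exact h'⟩
      · push Not at hb
        obtain ⟨k, hk⟩ := hb
        obtain ⟨N, hN⟩ : ∃ N, ∀ j ≥ N, (p j).1.1 = (p N).1.1 := by
          obtain ⟨N, hN⟩ := WellFounded.has_min
            (measure fun j => k - (p j).1.1).wf Set.univ ⟨0, trivial⟩
          refine ⟨N, fun j hj => ?_⟩
          have h1 := hN.2 j trivial
          have h2 : (p N).1.1 ≤ (p j).1.1 := mono hj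
          have h3 := hk j
          change ¬ (k - (p j).1.1 < k - (p N).1.1) at h1
          omega
        -- With a constant index the attracting phase cannot be entered: it never returns to the
        -- certificate without reaching the target, its rank falls at each step, and reaching the
        -- target would advance the index. So the path remains in one certificate.
        have hinl : ∀ r, ∀ j ≥ N, ∀ u, (p j).1.2 = .inl u → rk (p j).1.1 u = r → False := by
          intro r
          induction r using Nat.strong_induction_on with
          | _ r ih =>
            intro j hj u hu hr
            have h := hp j
            have h1 := hN j hj
            have h2 := hN (j + 1) (by omega)
            simp only [T, hu] at h
            rcases h with ⟨-, h⟩ | ⟨-, h, u', h3, h4⟩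
            · omega
            · exact ih _ (hr ▸ h4) (j + 1) (by omega) u' h3 (by rw [h])
        have hinr : ∀ j, ∃ a, (p (j + N)).1.2 = .inr a := by
          intro j
          match h : (p (j + N)).1.2 with
          | .inl u => exact (hinl _ _ (Nat.le_add_left _ _) u h rfl).elim
          | .inr a => exact ⟨a, rfl⟩
        choose q hq using hinr
        rw [← G.winsPlay_shift N]
        have := sigmaRel_path_wins (G := G) (σ := σ) (π := π) (fun w => (hc w).win) q
          (fun j => by
            have h := hp (j + N)
            have e : j + N + 1 = j + 1 + N := by omega
            rw [e] at h
            simp only [T, hq] at h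
            rcases h with ⟨-, ⟨b, hb, h⟩ | ⟨u', h⟩⟩
            · obtain rfl : q (j + 1) = b := by simpa using hb
              exact h
            · simp at h)
        have e : (fun j => lab (p (j + N)).1.2) = fun j => π (q j).1 (q j).2 :=
          funext fun j => by rw [hq j]; rfl
        rw [e]
        exact this
  obtain ⟨y, hy, rfl⟩ := place 0 v hv
  exact cert.mem_winIn ⟨(0, y), hy⟩

variable (G) in
theorem exists_mem_F (X : Finset V) : ∃ σ, X ∩ G.W ∈ G.F σ := by
  have h : X ∩ G.W ∈ G.F 0 ∪ G.F 1 := by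
    rw [G.F_union]; exact Finset.mem_powerset.2 Finset.inter_subset_right
  rcases Finset.mem_union.1 h with h | h
  exacts [⟨0, h⟩, ⟨1, h⟩]

/-- Determinacy of subgames. -/
theorem Subarena.determined {X : Finset V} (hX : G.Subarena X) (σ : Fin 2) {v : V} (hv : v ∈ X) :
    v ∈ G.winIn σ X ∨ v ∈ G.winIn (1 - σ) X := by
  -- The claim is symmetric in the players, so `σ` may be taken as the owner of `X`.
  suffices h : ∃ σ, ∀ v ∈ X, v ∈ G.winIn σ X ∨ v ∈ G.winIn (1 - σ) X by
    obtain ⟨ρ, h⟩ := h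
    have := h v hv
    have e : σ = ρ ∨ σ = 1 - ρ := fin2_eq_or σ ρ
    rcases e with rfl | rfl
    · exact this
    · rw [fin2_sub_sub]; exact this.symm
  clear hv v σ
  induction X using Finset.strongInduction with
  | H X ih =>
    obtain ⟨σ, hF⟩ := G.exists_mem_F X
    refine ⟨σ, ?_⟩
    choose Y hY using G.exists_residue σ X
    by_cases h : ∀ w ∈ X ∩ G.W, ∀ y ∈ Y w, y ∈ G.winIn σ (Y w)
    · exact fun v hv => .inl (mem_winIn_of_residues hX hF Y (fun w _ => hY w) h hv)
    · push Not at h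
      obtain ⟨w, hw, y, hy, hn⟩ := h
      have sub : ∀ {τ : Fin 2} {w : V} {Y : Finset V}, w ∈ X → G.IsResidue τ X w Y → Y ⊂ X :=
        fun hw h => (Finset.ssubset_iff_of_subset h.trap.sub).2 ⟨_, hw, h.notMem⟩
      have det : ∀ Y, Y ⊂ X → G.Subarena Y → ∀ y ∈ Y, y ∈ G.winIn σ Y ∨ y ∈ G.winIn (1 - σ) Y := by
        intro Y hY hs y hy
        obtain ⟨ρ, h⟩ := ih Y hY hs
        have e : σ = ρ ∨ σ = 1 - ρ := fin2_eq_or σ ρ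
        rcases e with rfl | rfl
        · exact h y hy
        · rw [fin2_sub_sub]; exact (h y hy).symm
      have hy' : y ∈ G.winIn (1 - σ) X := (hY w).winIn_subset
        ((det _ (sub (Finset.mem_inter.1 hw).1 (hY w)) ((hY w).trap.subarena hX) y hy).resolve_left
          hn)
      -- The opponent wins from `y`, hence on the whole attractor of `y`. The rest `Z` is determined
      -- by induction: wins of `σ` carry over because `Z` is a trap for the opponent, and wins of
      -- the opponent carry over because leaving `Z` leads into the attractor.
      obtain ⟨Z, hZ⟩ := G.exists_residue (1 - σ) X y
      have hyX : y ∈ X := winIn_subset hy'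
      intro v hv
      by_cases hvZ : v ∈ Z
      · have hd := det Z (sub hyX hZ) (hZ.trap.subarena hX)
        rcases hd v hvZ with h | h
        · left
          have := hZ.winIn_subset
          rw [fin2_sub_sub] at this
          exact this h
        · right
          classical
          obtain ⟨S, π, R, hc, hS⟩ := G.exists_universal_cert (1 - σ) Z
          obtain ⟨s, rfl⟩ := hS v h
          refine mem_winIn_of_escape π R (fun s => hZ.trap.sub (hc.mem s))
            (fun s hs => .inl (hc.own s hs)) (fun s hs u hu he => ?_) hc.win s
          by_cases huZ : u ∈ Z
          · exact .inl (hc.opp s hs u huZ he)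
          · exact .inr (attr_subset_winIn hy' (hZ.attr u hu huZ))
      · exact .inr (attr_subset_winIn hy' (hZ.attr v hv hvZ))

variable (G) in
theorem subarena_univ : G.Subarena Finset.univ := fun v _ =>
  (G.exists_out v).imp fun _ h => ⟨Finset.mem_univ _, h⟩

/-! ## Winning strategies -/

/-- The history is used to track a state of the certificate, which is updated by the moves actually
seen. As long as the labels match the play, the certificate supplies the next move, and the tracked
states form a path of the certificate. -/
theorem IsCert.mem_Win {σ : Fin 2} {S : Type u} {π : S → V} {R : S → S → Prop}
    (hc : G.IsCert σ Finset.univ π R) (s₀ : S) : π s₀ ∈ G.Win σ := by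
  classical
  choose out hout using G.exists_out
  let good : S → S → Prop := fun s s' => R s s' ∧ (π s, π s') ∈ G.E
  let upd : S → V → S := fun s u => if h : ∃ s', R s s' ∧ π s' = u then h.choose else s
  let st : List V → S := fun h => h.tail.foldl upd s₀
  let move : List V → V := fun h =>
    if hm : ∃ hne : h ≠ [], π (st h) = h.getLast hne ∧ ∃ s', good (st h) s' then
      π hm.choose_spec.2.choose
    else if hne : h ≠ [] then out (h.getLast hne) else π s₀
  refine ⟨⟨move, ?_⟩, ?_⟩
  · intro h hne _ _
    by_cases hm : ∃ hne : h ≠ [], π (st h) = h.getLast hne ∧ ∃ s', good (st h) s'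
    · simp only [move, dif_pos hm]
      have := hm.choose_spec.2.choose_spec.2
      have e : h.getLast hne = π (st h) := hm.choose_spec.1.symm
      exact (congrArg (fun x => (x, π hm.choose_spec.2.choose) ∈ G.E) e).mpr this
    · simp only [move, dif_neg hm, dif_pos hne]
      exact hout _
  · intro ρ hρ h0 hcon
    let q : ℕ → S := fun i => st ((List.range (i + 1)).map ρ)
    have hq0 : q 0 = s₀ := rfl
    have hqs : ∀ i, q (i + 1) = upd (q i) (ρ (i + 1)) := by
      intro i
      simp only [q, st]
      rw [List.range_succ (n := i + 1), List.map_append, List.tail_append_of_ne_nil (by simp),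
        List.foldl_append]
      rfl
    have key : ∀ i, π (q i) = ρ i → R (q i) (q (i + 1)) ∧ π (q (i + 1)) = ρ (i + 1) := by
      intro i hi
      suffices h : ∃ s', R (q i) s' ∧ π s' = ρ (i + 1) by
        rw [hqs]
        simp only [upd, dif_pos h]
        exact h.choose_spec
      by_cases hp : ρ i ∈ G.pos σ
      · have hm : ∃ hne : (List.range (i + 1)).map ρ ≠ [],
            π (st ((List.range (i + 1)).map ρ)) = ((List.range (i + 1)).map ρ).getLast hne ∧
            ∃ s', good (st ((List.range (i + 1)).map ρ)) s' :=
          ⟨by simp, hi.trans (by simp [List.range_succ]), hc.own (q i) (by rw [hi]; exact hp)⟩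
        refine ⟨_, hm.choose_spec.2.choose_spec.1, ?_⟩
        rw [hcon i hp]
        simp only [move, dif_pos hm]
      · exact hc.opp (q i) (by rw [hi]; exact hp) _ (Finset.mem_univ _) (by rw [hi]; exact hρ i)
    have hall : ∀ i, π (q i) = ρ i := by
      intro i
      induction i with
      | zero => rw [h0, hq0]
      | succ i ih => exact (key i ih).2
    have := hc.win q (fun i => (key i (hall i)).1)
    simpa only [hall] using this

/-- Both strategies are played against each other from `v`. -/
theorem not_mem_both_Win {v : V} (h0 : v ∈ G.Win 0) (h1 : v ∈ G.Win 1) : False := by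
  classical
  obtain ⟨s, hs⟩ := h0
  obtain ⟨t, ht⟩ := h1
  let nxt : List V → V := fun h =>
    if h.getLastD v ∈ G.pos 0 then s.move h else t.move h
  let H : ℕ → List V := fun i => (fun h => h ++ [nxt h])^[i] [v]
  have hH : ∀ i, H (i + 1) = H i ++ [nxt (H i)] := fun i => Function.iterate_succ_apply' _ _ _
  let ρ : ℕ → V := fun i => (H i).getLastD v
  have hρs : ∀ i, ρ (i + 1) = nxt (H i) := fun i => by simp [ρ, hH]
  have hmap : ∀ i, H i = (List.range (i + 1)).map ρ := by
    intro i
    induction i with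
    | zero => simp [H, ρ]
    | succ i ih =>
      rw [hH, List.range_succ, List.map_append, ← ih, List.map_singleton, hρs]
  have hp01 : ∀ u : V, u ∉ G.pos 0 → u ∈ G.pos 1 := fun u hu => (G.mem_pos_sub 0 u).2 hu
  have c0 : s.Consistent ρ := by
    intro i hi
    have hi' : (H i).getLastD v ∈ G.pos 0 := hi
    rw [hρs, ← hmap]
    simp only [nxt, if_pos hi']
  have c1 : t.Consistent ρ := by
    intro i hi
    have hi' : (H i).getLastD v ∉ G.pos 0 := (G.mem_pos_sub 0 _).1 hi
    rw [hρs, ← hmap]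
    simp only [nxt, if_neg hi']
  -- Strategies are legal only on histories that are paths, so legality of the next move and the
  -- path property of the history are proved together.
  have hchain : ∀ i, (ρ i, ρ (i + 1)) ∈ G.E ∧
      ((List.range (i + 1)).map ρ).IsChain (fun u v => (u, v) ∈ G.E) := by
    intro i
    have hstep : ∀ i, ((List.range (i + 1)).map ρ).IsChain (fun u v => (u, v) ∈ G.E) →
        (ρ i, ρ (i + 1)) ∈ G.E := by
      intro i hc
      have hlast : ((List.range (i + 1)).map ρ).getLast (by simp) = ρ i := by
        simp [List.range_succ]
      by_cases hp : ρ i ∈ G.pos 0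
      · have := s.legal _ (by simp) hc (by rw [hlast]; exact hp)
        rw [hlast, ← c0 i hp] at this
        exact this
      · have := t.legal _ (by simp) hc (by rw [hlast]; exact hp01 _ hp)
        rw [hlast, ← c1 i (hp01 _ hp)] at this
        exact this
    induction i with
    | zero => exact ⟨hstep 0 (by simp), by simp⟩
    | succ i ih =>
      have hc : ((List.range (i + 1 + 1)).map ρ).IsChain (fun u v => (u, v) ∈ G.E) := by
        rw [List.range_succ, List.map_append, List.isChain_append]
        refine ⟨ih.2, by simp, ?_⟩
        intro x hx y hy
        simp [List.range_succ] at hx hy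
        subst hx hy
        exact ih.1
      exact ⟨hstep _ hc, hc⟩
  have h0 : ρ 0 = v := by simp [ρ, H]
  exact G.not_both_winsPlay 0 ρ (hs ρ (fun i => (hchain i).1) h0 c0)
    (ht ρ (fun i => (hchain i).1) h0 c1)

variable (G) in
-- Only the passage from certificates to strategies is constructed. The converse follows from
-- determinacy by certificates and from the fact that no position is won by both players.
theorem Win_eq_winIn (σ : Fin 2) : G.Win σ = G.winIn σ Finset.univ := by
  have sub : ∀ σ, G.winIn σ Finset.univ ⊆ G.Win σ := by
    rintro σ v ⟨S, π, R, hc, s, rfl⟩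
    exact hc.mem_Win s
  refine Set.Subset.antisymm (fun v hv => ?_) (sub σ)
  rcases G.subarena_univ.determined σ (Finset.mem_univ v) with h | h
  · exact h
  · have h' := sub _ h
    match σ with
    | 0 => exact (not_mem_both_Win hv h').elim
    | 1 => exact (not_mem_both_Win h' hv).elim

end McNaughtonGame

/-! ## A structured language over the random access machine

Programs are built from scalar variables and arrays. Variables live in the cells `0, …, 30`, the
cell `31` holds the address at which the arrays start, the cells `32, …, 63` are used to evaluate
expressions, the input follows from cell `64` on, and the arrays are interleaved behind it: entry
`i` of the array with index `j` has the address `base + 16 * i + j`. -/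

namespace RAM

set_option linter.constructorNameAsVariable false

/-- `x` is the code of the current set `X`, `z` that of `X ∩ W`, and `y` that of what an attractor
leaves. `pl` is the player whose attractor is computed, `op` the player whose table entries are
looked up, and `q` the answer. `w` and `hi` delimit a scan, `sp` is the height of the stack, and
`any` is `v + 1` for some `v ∈ X`. -/
inductive Var where
  | n | m | k | full | p | i | t | x | y | z | any | bad | pl | op | q | w | hi | sp | j | u
  deriving DecidableEq

/-- `head` and `nxt` link the edges with a common target. `fl` is the indicator of `F 0`, indexed by
codes. `tab` holds the entry of `X` for Player `τ` at twice the code of `X` plus `τ`. `deg` counts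
successors in `X`, `cnt` and `stk` serve the attractor, and `res` marks positions found to be won by
Player 0. -/
inductive Arr where
  | own | inW | pow | src | tgt | nxt | head | fl | tab | inX | inXW | deg | cnt | stk | res
  deriving DecidableEq

def Var.idx : Var → ℕ
  | n => 0 | m => 1 | k => 2 | full => 3 | p => 4 | i => 5 | t => 6 | x => 7 | y => 8 | z => 9
  | any => 10 | bad => 11 | pl => 12 | op => 13 | q => 14 | w => 15 | hi => 16 | sp => 17
  | j => 18 | u => 19

def Arr.idx : Arr → ℕ
  | own => 0 | inW => 1 | pow => 2 | src => 3 | tgt => 4 | nxt => 5 | head => 6 | fl => 7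
  | tab => 8 | inX => 9 | inXW => 10 | deg => 11 | cnt => 12 | stk => 13 | res => 14

theorem Var.idx_lt (x : Var) : x.idx < 31 := by cases x <;> decide

theorem Arr.idx_lt (a : Arr) : a.idx < 16 := by cases a <;> decide

theorem Var.idx_injective {x y : Var} (h : x.idx = y.idx) : x = y := by
  cases x <;> cases y <;> first | rfl | (exfalso; revert h; decide)

theorem Arr.idx_injective {x y : Arr} (h : x.idx = y.idx) : x = y := by
  cases x <;> cases y <;> first | rfl | (exfalso; revert h; decide)

/-- The state of a structured program; `clk` counts the executed commands and tests. -/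
structure State where
  v : Var → ℕ
  a : Arr → ℕ → ℕ
  inp : ℕ → ℕ
  clk : ℕ

namespace State

def tick (s : State) : State := { s with clk := s.clk + 1 }

def setv (s : State) (x : Var) (c : ℕ) : State :=
  { s with v := fun y => if y = x then c else s.v y, clk := s.clk + 1 }

def seta (s : State) (b : Arr) (i c : ℕ) : State :=
  { s with a := fun b' i' => if b' = b then (if i' = i then c else s.a b i') else s.a b' i',
           clk := s.clk + 1 }

def seti (s : State) (i c : ℕ) : State :=
  { s with inp := fun i' => if i' = i then c else s.inp i', clk := s.clk + 1 }

variable (s : State) (x y : Var) (b b' : Arr) (i i' c : ℕ)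

@[simp] theorem tick_v : s.tick.v = s.v := rfl
@[simp] theorem tick_a : s.tick.a = s.a := rfl
@[simp] theorem tick_inp : s.tick.inp = s.inp := rfl
@[simp] theorem tick_clk : s.tick.clk = s.clk + 1 := rfl
@[simp] theorem setv_v : (s.setv x c).v y = if y = x then c else s.v y := rfl
@[simp] theorem setv_a : (s.setv x c).a = s.a := rfl
@[simp] theorem setv_inp : (s.setv x c).inp = s.inp := rfl
@[simp] theorem setv_clk : (s.setv x c).clk = s.clk + 1 := rfl
@[simp] theorem seta_v : (s.seta b i c).v = s.v := rfl
@[simp] theorem seta_a : (s.seta b i c).a b' i' =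
    if b' = b then (if i' = i then c else s.a b i') else s.a b' i' := rfl
@[simp] theorem seta_inp : (s.seta b i c).inp = s.inp := rfl
@[simp] theorem seta_clk : (s.seta b i c).clk = s.clk + 1 := rfl
@[simp] theorem seti_v : (s.seti i c).v = s.v := rfl
@[simp] theorem seti_a : (s.seti i c).a = s.a := rfl
@[simp] theorem seti_inp : (s.seti i c).inp i' = if i' = i then c else s.inp i' := rfl
@[simp] theorem seti_clk : (s.seti i c).clk = s.clk + 1 := rfl

end State

inductive Expr where
  | lit (c : ℕ)
  | var (x : Var)
  | add (e f : Expr)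
  | sub (e f : Expr)
  | get (b : Arr) (e : Expr)

namespace Expr

@[simp] def eval (s : State) : Expr → ℕ
  | lit c => c
  | var x => s.v x
  | add e f => e.eval s + f.eval s
  | sub e f => e.eval s - f.eval s
  | get b e => s.a b (e.eval s)

/-- The number of cells needed for the evaluation. -/
def depth : Expr → ℕ
  | lit _ => 1
  | var _ => 1
  | add e f => max e.depth (f.depth + 1)
  | sub e f => max e.depth (f.depth + 1)
  | get _ e => max e.depth 2

/-- A bound on the values in terms of a bound on the values of variables and array entries. -/
def weight : Expr → ℕ
  | lit c => c
  | var _ => 1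
  | add e f => e.weight + f.weight
  | sub e f => e.weight + f.weight
  | get _ e => e.weight + 1

end Expr

inductive Cmd where
  | skip
  | set (x : Var) (e : Expr)
  | put (b : Arr) (e f : Expr)
  | inp (x : Var) (e : Expr)
  | out (e f : Expr)
  | seq (c d : Cmd)
  | ite (e : Expr) (c d : Cmd)
  | loop (e : Expr) (c : Cmd)

infixr:60 " ;; " => Cmd.seq

/-- Bounds within which a structured program has to stay: `len` is the length of the input,
`size` the length of the arrays, and `top`, `acap`, `icap` bound the values of the variables, the
arrays, and the cells of the input. -/
structure Limits where
  len : ℕ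
  size : ℕ
  top : ℕ
  acap : ℕ → ℕ → ℕ
  icap : ℕ → ℕ

/-- Big-step semantics; a command is only executed if it respects the limits. -/
inductive Exec (l : Limits) : Cmd → State → State → Prop
  | skip (s) : Exec l .skip s s
  | set (x e s) (h : Expr.eval s e ≤ l.top) : Exec l (.set x e) s (s.setv x (e.eval s))
  | put (b e f s) (h : Expr.eval s e < l.size)
      (h' : Expr.eval s f ≤ l.acap b.idx (Expr.eval s e)) :
      Exec l (.put b e f) s (s.seta b (e.eval s) (f.eval s))
  | inp (x e s) (h : Expr.eval s e < l.len) (h' : s.inp (Expr.eval s e) ≤ l.top) :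
      Exec l (.inp x e) s (s.setv x (s.inp (e.eval s)))
  | out (e f s) (h : Expr.eval s e < l.len) (h' : Expr.eval s f ≤ l.icap (Expr.eval s e)) :
      Exec l (.out e f) s (s.seti (e.eval s) (f.eval s))
  | seq (c d s s' s'') (h : Exec l c s s') (h' : Exec l d s' s'') : Exec l (.seq c d) s s''
  | iteT (e c d s s') (h : 0 < Expr.eval s e) (h' : Exec l c s.tick s') :
      Exec l (.ite e c d) s s'
  | iteF (e c d s s') (h : Expr.eval s e = 0) (h' : Exec l d s.tick s') :
      Exec l (.ite e c d) s s'
  | loopF (e c s) (h : Expr.eval s e = 0) : Exec l (.loop e c) s s.tick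
  | loopT (e c s s' s'') (h : 0 < Expr.eval s e) (h' : Exec l c s.tick s')
      (h'' : Exec l (.loop e c) s' s'') : Exec l (.loop e c) s s''

/-! ### Compilation -/

/-- The value is left in the cell `t`, and the cells above `t` are scratch. A copy is an addition to
zero, and four doublings multiply an index by the stride 16. -/
def Expr.code : Expr → ℕ → List Instr
  | .lit c, t => [.const t c]
  | .var x, t => [.const t 0, .add t t x.idx]
  | .add e f, t => e.code t ++ f.code (t + 1) ++ [.add t t (t + 1)]
  | .sub e f, t => e.code t ++ f.code (t + 1) ++ [.sub t t (t + 1)]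
  | .get b e, t => e.code t ++ [.add t t t, .add t t t, .add t t t, .add t t t, .add t t 31,
      .const (t + 1) b.idx, .add t t (t + 1), .load t t]

/-- The second argument is the position of the code in the program, needed because jump targets are
absolute. An unconditional jump tests a cell that has just been set to 1. -/
def Cmd.code : Cmd → ℕ → List Instr
  | .skip, _ => []
  | .set x e, _ => e.code 32 ++ [.const 33 0, .add x.idx 32 33]
  | .put b e f, _ => e.code 32 ++ ([.add 32 32 32, .add 32 32 32, .add 32 32 32, .add 32 32 32,
      .add 32 32 31, .const 33 b.idx, .add 32 32 33] ++ (f.code 33 ++ [.store 32 33]))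
  | .inp x e, _ => e.code 32 ++ [.const 33 64, .add 32 32 33, .load 32 32, .const 33 0,
      .add x.idx 32 33]
  | .out e f, _ => e.code 32 ++ ([.const 33 64, .add 32 32 33] ++ (f.code 33 ++ [.store 32 33]))
  | .seq c d, o => c.code o ++ d.code (o + (c.code o).length)
  | .ite e c d, o =>
    let l := (e.code 32).length
    let D := d.code (o + l + 1)
    let C := c.code (o + l + 1 + D.length + 2)
    e.code 32 ++ ([.jump 32 (o + l + 1 + D.length + 2)] ++ (D ++
      ([.const 32 1, .jump 32 (o + l + 1 + D.length + 2 + C.length)] ++ C)))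
  | .loop e c, o =>
    let l := (e.code 32).length
    let C := c.code (o + l + 3)
    e.code 32 ++ ([.jump 32 (o + l + 3), .const 32 1, .jump 32 (o + l + 3 + C.length + 2)] ++
      (C ++ [.const 32 1, .jump 32 o]))

/-- From a start cell up to 40, depth 24 stays below the cell 64, where the input begins. Weight 64
bounds the value by `64 * top`. -/
def Expr.fits (e : Expr) : Bool := e.weight ≤ 64 && e.depth ≤ 24

/-- All expressions are small enough to be evaluated in the cells reserved for this purpose. -/
def Cmd.fits : Cmd → Bool
  | .skip => true
  | .set _ e => e.fits
  | .put _ e f => e.fits && f.fits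
  | .inp _ e => e.fits
  | .out e f => e.fits && f.fits
  | .seq c d => c.fits && d.fits
  | .ite e c d => e.fits && (c.fits && d.fits)
  | .loop e c => e.fits && c.fits

/-! ### Memory access, machine runs and code fragments. -/

theorem read_write (m : List ℕ) (a x b : ℕ) :
    read (write m a x) b = if b = a then x else read m b := by
  unfold read write
  rw [List.getD_eq_getElem?_getD, List.getElem?_set, List.getD_eq_getElem?_getD]
  by_cases h : a = b
  · subst h
    simp only [if_true]
    rw [if_pos (by simp; omega)]
    rfl
  · rw [if_neg h, if_neg (Ne.symm h)]
    rw [List.getElem?_append]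
    split_ifs with h1
    · rfl
    · rw [List.getElem?_replicate, List.getElem?_eq_none (by omega : m.length ≤ b)]
      split_ifs <;> rfl

theorem length_write (m : List ℕ) (a x : ℕ) : (write m a x).length = max m.length (a + 1) := by
  simp [write]; omega

/-- The machine gets from `c` to `c'` in `t` steps, and `P` holds for the memory throughout. -/
def Reach (p : Program) (P : List ℕ → Prop) (c c' : Config) (t : ℕ) : Prop :=
  (step p)^[t] c = c' ∧ ∀ s ≤ t, P ((step p)^[s] c).mem

theorem Reach.refl {p : Program} {P : List ℕ → Prop} {c : Config} (h : P c.mem) :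
    Reach p P c c 0 := ⟨rfl, fun s hs => by obtain rfl : s = 0 := by omega
                                            exact h⟩

theorem Reach.trans {p : Program} {P : List ℕ → Prop} {c c' c'' : Config} {t t' : ℕ}
    (h : Reach p P c c' t) (h' : Reach p P c' c'' t') : Reach p P c c'' (t + t') := by
  refine ⟨by rw [Nat.add_comm, Function.iterate_add_apply, h.1, h'.1], fun s hs => ?_⟩
  by_cases hst : s ≤ t
  · exact h.2 s hst
  · obtain ⟨r, rfl⟩ : ∃ r, s = r + t := ⟨s - t, by omega⟩
    rw [Function.iterate_add_apply, h.1]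
    exact h'.2 r (by omega)

/-- The instructions `is` stand in the program from position `o` on. -/
def CodeAt (p : Program) (o : ℕ) (is : List Instr) : Prop :=
  ∀ i (h : i < is.length), p.code[o + i]? = some is[i]

theorem codeAt_cons {p : Program} {o : ℕ} {i : Instr} {is : List Instr} :
    CodeAt p o (i :: is) ↔ p.code[o]? = some i ∧ CodeAt p (o + 1) is := by
  constructor
  · intro h
    refine ⟨h 0 (by simp), fun j hj => ?_⟩
    have := h (j + 1) (by simpa using hj)
    rw [← Nat.add_assoc, Nat.add_right_comm] at this
    simpa using this
  · rintro ⟨h, h'⟩ j hj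
    match j with
    | 0 => exact h
    | j + 1 =>
      have := h' j (by simpa using hj)
      rw [← Nat.add_assoc, Nat.add_right_comm]
      simpa using this

theorem codeAt_append {p : Program} {o : ℕ} {is js : List Instr} :
    CodeAt p o (is ++ js) ↔ CodeAt p o is ∧ CodeAt p (o + is.length) js := by
  induction is generalizing o with
  | nil => simp [CodeAt]
  | cons i is ih =>
    rw [List.cons_append, codeAt_cons, codeAt_cons, ih, and_assoc]
    simp [Nat.add_assoc, Nat.add_comm 1]

theorem Reach.head {p : Program} {P : List ℕ → Prop} {o : ℕ} {m : List ℕ} {i : Instr}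
    {c' : Config} {t : ℕ} (hi : p.code[o]? = some i) (hm : P m)
    (h : Reach p P (exec ⟨o, m⟩ i) c' t) : Reach p P ⟨o, m⟩ c' (t + 1) := by
  have e : step p ⟨o, m⟩ = exec ⟨o, m⟩ i := by simp only [step, hi]
  refine ⟨by rw [Function.iterate_succ_apply, e, h.1], fun s hs => ?_⟩
  match s with
  | 0 => exact hm
  | s + 1 =>
    rw [Function.iterate_succ_apply, e]
    exact h.2 s (by omega)

/-! ### The memory layout and bounds on the contents of cells. -/

namespace Limits

variable (l : Limits)

/-- The bound on the content of the cell with address `a`. -/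
def cell (a : ℕ) : ℕ :=
  -- A value up to `64 * top` is multiplied by 16 when an address is computed; adding the base and
  -- the index of the array stays below `2048 * top`.
  if a < 32 then l.top else if a < 64 then 2048 * l.top else
    if a < 64 + l.len then l.icap (a - 64) else
      l.acap ((a - 64 - l.len) % 16) ((a - 64 - l.len) / 16)

/-- The memory respects the limits. -/
def Holds (m : List ℕ) : Prop :=
  m.length ≤ 64 + l.len + 16 * l.size ∧ ∀ a, read m a ≤ l.cell a

/-- The memory `m` represents the state `s`. -/
structure Rel (s : State) (m : List ℕ) : Prop where
  holds : l.Holds m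
  v : ∀ x : Var, read m x.idx = s.v x
  base : read m 31 = 64 + l.len
  inp : ∀ i < l.len, read m (64 + i) = s.inp i
  a : ∀ (b : Arr) i, read m (64 + l.len + 16 * i + b.idx) = s.a b i

/-- The limits are consistent. -/
structure Ok : Prop where
  base : 64 + l.len ≤ l.top
  acap : ∀ j i, l.acap j i ≤ l.top
  icap : ∀ i, l.icap i ≤ l.top

theorem cell_arr (b : Arr) (i : ℕ) : l.cell (64 + l.len + 16 * i + b.idx) = l.acap b.idx i := by
  have := b.idx_lt
  rw [cell, if_neg (by omega), if_neg (by omega), if_neg (by omega)]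
  congr 1 <;> omega

theorem cell_inp {i : ℕ} (h : i < l.len) : l.cell (64 + i) = l.icap i := by
  rw [cell, if_neg (by omega), if_neg (by omega), if_pos (by omega)]
  congr 1; omega

variable {l}

theorem Holds.write {m : List ℕ} {a x : ℕ} (h : l.Holds m)
    (ha : a < 64 + l.len + 16 * l.size) (hx : x ≤ l.cell a) : l.Holds (write m a x) := by
  refine ⟨by rw [length_write]; have := h.1; omega, fun b => ?_⟩
  rw [read_write]
  split_ifs with hb
  · rw [hb]; exact hx
  · exact h.2 b

theorem Rel.write_temp {s : State} {m : List ℕ} {t x : ℕ} (h : l.Rel s m) (ht : 32 ≤ t)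
    (ht' : t < 64) (hx : x ≤ 2048 * l.top) : l.Rel s (write m t x) := by
  refine ⟨h.holds.write (by omega) ?_, fun y => ?_, ?_, fun i hi => ?_, fun b i => ?_⟩
  · rw [cell, if_neg (by omega), if_pos ht']; exact hx
  all_goals rw [read_write]
  · have := y.idx_lt
    rw [if_neg (by omega), h.v]
  · rw [if_neg (by omega), h.base]
  · rw [if_neg (by omega), h.inp i hi]
  · rw [if_neg (by omega), h.a]

theorem Rel.write_var {s : State} {m : List ℕ} {x : Var} {c : ℕ} (h : l.Rel s m)
    (hx : c ≤ l.top) : l.Rel (s.setv x c) (write m x.idx c) := by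
  have hi := x.idx_lt
  refine ⟨h.holds.write (by omega) ?_, fun y => ?_, ?_, fun i hi => ?_, fun b i => ?_⟩
  · rw [cell, if_pos (by omega)]; exact hx
  all_goals rw [read_write]
  · rw [State.setv_v]
    by_cases e : y = x
    · rw [if_pos (by rw [e]), if_pos e]
    · rw [if_neg (fun h => e (Var.idx_injective h)), if_neg e, h.v]
  · rw [if_neg (by omega), h.base]
  · rw [if_neg (by omega), h.inp i hi, State.setv_inp]
  · rw [if_neg (by omega), h.a, State.setv_a]

/-- Array indices are below the stride 16, so distinct pairs of array and index have distinct
addresses. -/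
theorem Rel.write_arr {s : State} {m : List ℕ} {b : Arr} {i c : ℕ} (h : l.Rel s m)
    (hi : i < l.size) (hc : c ≤ l.acap b.idx i) :
    l.Rel (s.seta b i c) (write m (64 + l.len + 16 * i + b.idx) c) := by
  have hb := b.idx_lt
  refine ⟨h.holds.write (by omega) (by rw [cell_arr]; exact hc), fun y => ?_, ?_,
    fun i hi => ?_, fun b' i' => ?_⟩
  all_goals rw [read_write]
  · have := y.idx_lt
    rw [if_neg (by omega), h.v, State.seta_v]
  · rw [if_neg (by omega), h.base]
  · rw [if_neg (by omega), h.inp i hi, State.seta_inp]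
  · have hb' := b'.idx_lt
    rw [State.seta_a]
    by_cases e : b' = b
    · rw [if_pos e]
      by_cases e' : i' = i
      · rw [if_pos (by rw [e, e']), if_pos e']
      · rw [if_neg (by omega), if_neg e', h.a, e]
    · rw [if_neg (fun h => e (Arr.idx_injective (by omega))), if_neg e, h.a]

theorem Rel.write_inp {s : State} {m : List ℕ} {i c : ℕ} (h : l.Rel s m)
    (hi : i < l.len) (hc : c ≤ l.icap i) : l.Rel (s.seti i c) (write m (64 + i) c) := by
  refine ⟨h.holds.write (by omega) (by rw [cell_inp _ hi]; exact hc), fun y => ?_, ?_,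
    fun i hi => ?_, fun b' i' => ?_⟩
  all_goals rw [read_write]
  · have := y.idx_lt
    rw [if_neg (by omega), h.v, State.seti_v]
  · rw [if_neg (by omega), h.base]
  · rw [State.seti_inp]
    split_ifs with h1 h2 h2
    · rfl
    · omega
    · omega
    · exact h.inp _ hi
  · rw [if_neg (by omega), h.a, State.seti_a]

theorem Rel.eval_le {s : State} {m : List ℕ} (h : l.Rel s m) (hl : l.Ok) (e : Expr) :
    e.eval s ≤ e.weight * l.top := by
  have h1 : 64 ≤ l.top := le_trans (Nat.le_add_right _ _) hl.base
  induction e with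
  | lit c => exact Nat.le_mul_of_pos_right c (by omega)
  | var x =>
    have := h.holds.2 x.idx
    have hx := x.idx_lt
    rw [h.v, cell, if_pos (by omega)] at this
    simpa [Expr.weight] using this
  | add e f he hf => rw [Expr.eval, Expr.weight, Nat.add_mul]; omega
  | sub e f he hf => rw [Expr.eval, Expr.weight, Nat.add_mul]; omega
  | get b e he =>
    have := h.holds.2 (64 + l.len + 16 * e.eval s + b.idx)
    rw [h.a, cell_arr] at this
    have h2 := hl.acap b.idx (e.eval s)
    rw [Expr.eval, Expr.weight, Nat.add_mul]
    omega

end Limits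

/-! ### Correctness of the compiler. -/

variable {l : Limits}

/-- The address of an array entry is computed in the cell `t` from the index in this cell. -/
theorem reach_address {p : Program} (hl : l.Ok) {b : Arr} {t o : ℕ} {s : State} {m : List ℕ}
    {is : List Instr}
    (hc : CodeAt p o ([.add t t t, .add t t t, .add t t t, .add t t t, .add t t 31,
      .const (t + 1) b.idx, .add t t (t + 1)] ++ is))
    (h : l.Rel s m) (ht : 32 ≤ t) (ht' : t + 1 < 64) (hv : read m t ≤ 64 * l.top) :
    ∃ m', Reach p l.Holds ⟨o, m⟩ ⟨o + 7, m'⟩ 7 ∧ l.Rel s m' ∧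
      read m' t = 64 + l.len + 16 * read m t + b.idx ∧
      ∀ c, 32 ≤ c → c < t → read m' c = read m c := by
  have hb := b.idx_lt
  have h1 := hl.base
  simp only [List.cons_append, codeAt_cons] at hc
  obtain ⟨c1, c2, c3, c4, c5, c6, c7, -⟩ := hc
  have key : ∀ {m : List ℕ} {t' x : ℕ}, l.Rel s m → t ≤ t' → t' ≤ t + 1 → x ≤ 2048 * l.top →
      l.Rel s (write m t' x) := fun h h1 h2 h3 => h.write_temp (by omega) (by omega) h3
  have w1 := key h le_rfl (by omega) (x := read m t + read m t) (by omega)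
  set m1 := write m t (read m t + read m t) with hm1
  have e1 : read m1 t = 2 * read m t := by rw [hm1, read_write, if_pos rfl]; omega
  have w2 := key w1 le_rfl (by omega) (x := read m1 t + read m1 t) (by omega)
  set m2 := write m1 t (read m1 t + read m1 t) with hm2
  have e2 : read m2 t = 4 * read m t := by rw [hm2, read_write, if_pos rfl]; omega
  have w3 := key w2 le_rfl (by omega) (x := read m2 t + read m2 t) (by omega)
  set m3 := write m2 t (read m2 t + read m2 t) with hm3
  have e3 : read m3 t = 8 * read m t := by rw [hm3, read_write, if_pos rfl]; omega
  have w4 := key w3 le_rfl (by omega) (x := read m3 t + read m3 t) (by omega)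
  set m4 := write m3 t (read m3 t + read m3 t) with hm4
  have e4 : read m4 t = 16 * read m t := by rw [hm4, read_write, if_pos rfl]; omega
  have hb4 := w4.base
  have w5 := key w4 le_rfl (by omega) (x := read m4 t + read m4 31) (by omega)
  set m5 := write m4 t (read m4 t + read m4 31) with hm5
  have e5 : read m5 t = 16 * read m t + (64 + l.len) := by
    rw [hm5, read_write, if_pos rfl]; omega
  have w6 := key w5 (t' := t + 1) (by omega) le_rfl (x := b.idx) (by omega)
  set m6 := write m5 (t + 1) b.idx with hm6
  have e6 : read m6 t = 16 * read m t + (64 + l.len) := by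
    rw [hm6, read_write, if_neg (by omega), e5]
  have e6' : read m6 (t + 1) = b.idx := by rw [hm6, read_write, if_pos rfl]
  have w7 := key w6 le_rfl (by omega) (x := read m6 t + read m6 (t + 1)) (by omega)
  set m7 := write m6 t (read m6 t + read m6 (t + 1)) with hm7
  refine ⟨m7, ?_, w7, ?_, fun c hc hc' => ?_⟩
  · exact .head c1 h.holds <| .head c2 w1.holds <| .head c3 w2.holds <| .head c4 w3.holds <|
      .head c5 w4.holds <| .head c6 w5.holds <| .head c7 w6.holds <| .refl w7.holds
  · rw [hm7, read_write, if_pos rfl]; omega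
  · simp only [hm7, hm6, hm5, hm4, hm3, hm2, hm1, read_write]
    simp only [if_neg (show c ≠ t by omega), if_neg (show c ≠ t + 1 by omega)]

/-- That scratch cells below `t` are left alone is part of the induction: the second operand is
evaluated at `t + 1` while the first one waits in `t`. -/
theorem Expr.code_correct {p : Program} (hl : l.Ok) {s : State} (e : Expr) :
    ∀ {t o : ℕ} {m : List ℕ}, CodeAt p o (e.code t) → l.Rel s m → 32 ≤ t → t + e.depth ≤ 64 →
      e.weight ≤ 64 → ∃ m', Reach p l.Holds ⟨o, m⟩ ⟨o + (e.code t).length, m'⟩ (e.code t).length ∧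
        l.Rel s m' ∧ read m' t = e.eval s ∧ ∀ c, 32 ≤ c → c < t → read m' c = read m c := by
  have h1 := hl.base
  have hle : ∀ {e : Expr} {m : List ℕ}, l.Rel s m → e.weight ≤ 64 → e.eval s ≤ 64 * l.top :=
    fun h hw => (h.eval_le hl _).trans (Nat.mul_le_mul_right _ hw)
  induction e with
  | lit c =>
    intro t o m hc h ht hd hw
    simp only [Expr.code, codeAt_cons, Expr.depth] at hc hd
    have h2 := hle h hw
    have w := h.write_temp (t := t) (x := c) ht (by omega) (by rw [Expr.eval] at h2; omega)
    refine ⟨_, .head hc.1 h.holds (.refl w.holds), w, by rw [read_write, if_pos rfl]; rfl, ?_⟩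
    intro c hc hc'
    rw [read_write, if_neg (by omega)]
  | var x =>
    intro t o m hc h ht hd hw
    simp only [Expr.code, codeAt_cons, Expr.depth] at hc hd
    have h2 := hle h hw
    have hx := x.idx_lt
    have w := h.write_temp (t := t) (x := 0) ht (by omega) (by omega)
    have e1 : read (write m t 0) t + read (write m t 0) x.idx = s.v x := by
      rw [read_write, if_pos rfl, w.v, Nat.zero_add]
    have w' := w.write_temp (t := t) (x := read (write m t 0) t + read (write m t 0) x.idx) ht
      (by omega) (by rw [e1]; rw [Expr.eval] at h2; omega)
    refine ⟨_, .head hc.1 h.holds (.head hc.2.1 w.holds (.refl w'.holds)), w', ?_, ?_⟩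
    · rw [read_write, if_pos rfl, e1]; rfl
    · intro c hc hc'
      rw [read_write, if_neg (by omega), read_write, if_neg (by omega)]
  | add e f he hf =>
    intro t o m hc h ht hd hw
    have h2 := hle h hw
    simp only [Expr.code, codeAt_append, codeAt_cons, Expr.depth, Expr.weight,
      List.length_append] at hc hd hw
    obtain ⟨m1, r1, w1, e1, f1⟩ := he hc.1.1 h ht (by omega) (by omega)
    obtain ⟨m2, r2, w2, e2, f2⟩ := hf hc.1.2 w1 (by omega) (by omega) (by omega)
    have e3 : read m2 t + read m2 (t + 1) = (e.add f).eval s := by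
      rw [e2, f2 t (by omega) (by omega), e1]; rfl
    have w3 := w2.write_temp (t := t) (x := read m2 t + read m2 (t + 1)) ht (by omega)
      (by rw [e3]; omega)
    refine ⟨_, ?_, w3, by rw [read_write, if_pos rfl, e3], ?_⟩
    · simp only [Expr.code, List.length_append, List.length_cons, List.length_nil, zero_add]
      refine (r1.trans r2).trans ?_
      rw [Nat.add_assoc] at hc
      rw [← Nat.add_assoc, ← Nat.add_assoc]
      rw [← Nat.add_assoc] at hc
      exact .head hc.2.1 w2.holds (.refl w3.holds)
    · intro c hc hc'
      rw [read_write, if_neg (by omega), f2 c hc (by omega), f1 c hc hc']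
  | sub e f he hf =>
    intro t o m hc h ht hd hw
    have h2 := hle h hw
    simp only [Expr.code, codeAt_append, codeAt_cons, Expr.depth, Expr.weight,
      List.length_append] at hc hd hw
    obtain ⟨m1, r1, w1, e1, f1⟩ := he hc.1.1 h ht (by omega) (by omega)
    obtain ⟨m2, r2, w2, e2, f2⟩ := hf hc.1.2 w1 (by omega) (by omega) (by omega)
    have e3 : read m2 t - read m2 (t + 1) = (e.sub f).eval s := by
      rw [e2, f2 t (by omega) (by omega), e1]; rfl
    have w3 := w2.write_temp (t := t) (x := read m2 t - read m2 (t + 1)) ht (by omega)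
      (by rw [e3]; omega)
    refine ⟨_, ?_, w3, by rw [read_write, if_pos rfl, e3], ?_⟩
    · simp only [Expr.code, List.length_append, List.length_cons, List.length_nil, zero_add]
      refine (r1.trans r2).trans ?_
      rw [← Nat.add_assoc, ← Nat.add_assoc]
      rw [← Nat.add_assoc] at hc
      exact .head hc.2.1 w2.holds (.refl w3.holds)
    · intro c hc hc'
      rw [read_write, if_neg (by omega), f2 c hc (by omega), f1 c hc hc']
  | get b e he =>
    intro t o m hc h ht hd hw
    simp only [Expr.code, codeAt_append, Expr.depth, Expr.weight] at hc hd hw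
    have h2 := hle (e := e) h (by omega)
    obtain ⟨m1, r1, w1, e1, f1⟩ := he hc.1 h ht (by omega) (by omega)
    obtain ⟨m2, r2, w2, e2, f2⟩ := reach_address hl (is := [.load t t]) hc.2 w1 ht (by omega)
      (by rw [e1]; exact h2)
    have hc2 : p.code[o + (e.code t).length + 7]? = some (.load t t) := by
      have := hc.2
      simp only [codeAt_cons] at this
      exact this.2.2.2.2.2.2.2.1
    have e3 : read m2 (read m2 t) = (Expr.get b e).eval s := by
      rw [e2, e1, w2.a]; rfl
    have h3 := (h.holds.2 (64 + l.len + 16 * e.eval s + b.idx))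
    rw [h.a, l.cell_arr] at h3
    have h4 := h3.trans (hl.acap _ _)
    have w3 := w2.write_temp (t := t) (x := read m2 (read m2 t)) ht (by omega)
      (by rw [e3, Expr.eval]; omega)
    refine ⟨_, ?_, w3, by rw [read_write, if_pos rfl, e3], ?_⟩
    · simp only [Expr.code, List.length_append, List.length_cons, List.length_nil]
      exact (r1.trans (r2.trans (.head hc2 w2.holds (.refl w3.holds))))
    · intro c hc hc'
      rw [read_write, if_neg (by omega), f2 c hc (by omega), f1 c hc hc']

theorem Expr.fits_iff {e : Expr} : e.fits = true ↔ e.weight ≤ 64 ∧ e.depth ≤ 24 := by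
  simp [Expr.fits]

theorem Expr.reach {p : Program} (hl : l.Ok) {s : State} {e : Expr} {t o : ℕ} {m : List ℕ}
    (hc : CodeAt p o (e.code t)) (h : l.Rel s m) (ht : 32 ≤ t) (ht' : t ≤ 40)
    (hf : e.fits = true) :
    ∃ m', Reach p l.Holds ⟨o, m⟩ ⟨o + (e.code t).length, m'⟩ (e.code t).length ∧
        l.Rel s m' ∧ read m' t = e.eval s ∧ ∀ c, 32 ≤ c → c < t → read m' c = read m c := by
  rw [Expr.fits_iff] at hf
  exact Expr.code_correct hl e hc h ht (by omega) hf.1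

theorem Reach.done {p : Program} {P : List ℕ → Prop} {o o' : ℕ} {m m' : List ℕ} (ho : o = o')
    (hm : m = m') (h : P m') : Reach p P ⟨o, m⟩ ⟨o', m'⟩ 0 := by
  subst ho hm
  exact .refl h

theorem Limits.Rel.tick {s : State} {m : List ℕ} (h : l.Rel s m) : l.Rel s.tick m :=
  ⟨h.holds, h.v, h.base, h.inp, h.a⟩

/-- Compiled code does what the structured program does; `K` bounds the number of machine steps
for a unit of the clock. -/
theorem Cmd.code_correct {p : Program} (hl : l.Ok) {K : ℕ} {c : Cmd} {s s' : State}
    (he : Exec l c s s') : ∀ {o : ℕ} {m : List ℕ}, CodeAt p o (c.code o) → c.fits = true →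
      (c.code o).length ≤ K → l.Rel s m →
      ∃ m' t, Reach p l.Holds ⟨o, m⟩ ⟨o + (c.code o).length, m'⟩ t ∧ l.Rel s' m' ∧
        t + K * s.clk ≤ K * s'.clk := by
  have h1 := hl.base
  -- Each tick pays for the instructions belonging to its own command or test, of which there are at
  -- most as many as the code has, hence at most `K`; the parts of a compound command pay for
  -- themselves.
  induction he with
  | skip s =>
    intro o m _ _ _ h
    exact ⟨m, 0, .refl h.holds, h, by omega⟩
  | set x e s hx =>
    intro o m hc hf hK h
    simp only [Cmd.code, codeAt_append, codeAt_cons] at hc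
    obtain ⟨m1, r1, w1, e1, f1⟩ := Expr.reach hl hc.1 h le_rfl (by omega) hf
    have w2 := w1.write_temp (t := 33) (x := 0) (by omega) (by omega) (by omega)
    set m2 := write m1 33 0 with hm2
    have e2 : read m2 32 + read m2 33 = e.eval s := by
      simp [hm2, read_write, e1]
    have w3 := w2.write_var (x := x) (c := read m2 32 + read m2 33) (by rw [e2]; exact hx)
    rw [e2] at w3
    refine ⟨_, _, r1.trans (.head hc.2.1 w1.holds (.head hc.2.2.1 w2.holds
      (.done (by simp only [Cmd.code, List.length_append, List.length_cons, List.length_nil]; omega)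
        (by rw [← e2]) w3.holds))), w3, ?_⟩
    · simp only [Cmd.code, List.length_append, List.length_cons, List.length_nil] at hK
      rw [State.setv_clk, Nat.mul_add]; omega
  | put b e f s hi hx =>
    intro o m hc hf hK h
    simp only [Cmd.fits, Bool.and_eq_true] at hf
    rw [Cmd.code, codeAt_append] at hc
    obtain ⟨m1, r1, w1, e1, f1⟩ := Expr.reach hl hc.1 h le_rfl (by omega) hf.1
    have hw := (Expr.fits_iff.1 hf.1).1
    obtain ⟨m2, r2, w2, e2, f2⟩ := reach_address hl hc.2 w1 le_rfl (by omega)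
      (by rw [e1]; exact (h.eval_le hl e).trans (Nat.mul_le_mul_right _ hw))
    have hc2 := (codeAt_append.1 hc.2).2
    simp only [codeAt_append, codeAt_cons] at hc2
    obtain ⟨m3, r3, w3, e3, f3⟩ := Expr.reach hl hc2.1 w2 (t := 33) (by omega) (by omega) hf.2
    have e4 : read m3 32 = 64 + l.len + 16 * e.eval s + b.idx := by
      rw [f3 32 le_rfl (by omega), e2, e1]
    have w4 := w3.write_arr (b := b) hi hx
    refine ⟨_, _, r1.trans (r2.trans (r3.trans (.head hc2.2.1 w3.holds
      (.done (by simp only [Cmd.code, List.length_append, List.length_cons, List.length_nil]; omega)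
        (by rw [e4, e3]) w4.holds)))), w4, ?_⟩
    · simp only [Cmd.code, List.length_append, List.length_cons, List.length_nil] at hK
      rw [State.seta_clk, Nat.mul_add]; omega
  | inp x e s hi hx =>
    intro o m hc hf hK h
    simp only [Cmd.code, codeAt_append, codeAt_cons] at hc
    obtain ⟨c0, c1, c2, c3, c4, c5, -⟩ := hc
    obtain ⟨m1, r1, w1, e1, f1⟩ := Expr.reach hl c0 h le_rfl (by omega) hf
    have w2 := w1.write_temp (t := 33) (x := 64) (by omega) (by omega) (by omega)
    set m2 := write m1 33 64 with hm2
    have e2 : read m2 32 + read m2 33 = 64 + e.eval s := by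
      simp [hm2, read_write, e1]; omega
    have w3 := w2.write_temp (t := 32) (x := read m2 32 + read m2 33) (by omega) (by omega)
      (by omega)
    set m3 := write m2 32 (read m2 32 + read m2 33) with hm3
    have e3 : read m3 (read m3 32) = s.inp (e.eval s) := by
      rw [show read m3 32 = 64 + e.eval s by rw [hm3, read_write, if_pos rfl, e2]]
      rw [w3.inp _ hi]
    have w4 := w3.write_temp (t := 32) (x := read m3 (read m3 32)) (by omega) (by omega)
      (by rw [e3]; omega)
    set m4 := write m3 32 (read m3 (read m3 32)) with hm4
    have w5 := w4.write_temp (t := 33) (x := 0) (by omega) (by omega) (by omega)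
    set m5 := write m4 33 0 with hm5
    have e5 : read m5 32 + read m5 33 = s.inp (e.eval s) := by
      simp only [hm5, hm4, read_write, e3]; rfl
    have w6 := w5.write_var (x := x) (c := read m5 32 + read m5 33) (by rw [e5]; exact hx)
    rw [e5] at w6
    refine ⟨_, _, r1.trans (.head c1 w1.holds <| .head c2 w2.holds <| .head c3 w3.holds <|
      .head c4 w4.holds <| .head c5 w5.holds <|
      .done (by simp only [Cmd.code, List.length_append, List.length_cons, List.length_nil]; omega)
        (by rw [← e5]) w6.holds), w6, ?_⟩
    · simp only [Cmd.code, List.length_append, List.length_cons, List.length_nil] at hK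
      rw [State.setv_clk, Nat.mul_add]; omega
  | out e f s hi hx =>
    intro o m hc hf hK h
    simp only [Cmd.fits, Bool.and_eq_true] at hf
    simp only [Cmd.code, codeAt_append, codeAt_cons] at hc
    obtain ⟨c0, ⟨c1, c2, -⟩, c3, c4, -⟩ := hc
    obtain ⟨m1, r1, w1, e1, f1⟩ := Expr.reach hl c0 h le_rfl (by omega) hf.1
    have w2 := w1.write_temp (t := 33) (x := 64) (by omega) (by omega) (by omega)
    set m2 := write m1 33 64 with hm2
    have e2 : read m2 32 + read m2 33 = 64 + e.eval s := by
      simp [hm2, read_write, e1]; omega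
    have w3 := w2.write_temp (t := 32) (x := read m2 32 + read m2 33) (by omega) (by omega)
      (by omega)
    set m3 := write m2 32 (read m2 32 + read m2 33) with hm3
    obtain ⟨m4, r4, w4, e4, f4⟩ := Expr.reach hl c3 w3 (t := 33) (by omega) (by omega) hf.2
    have e5 : read m4 32 = 64 + e.eval s := by
      rw [f4 32 le_rfl (by omega), hm3, read_write, if_pos rfl, e2]
    have w5 := w4.write_inp hi hx
    refine ⟨_, _, r1.trans (.head c1 w1.holds <| .head c2 w2.holds <|
      r4.trans <| .head c4 w4.holds <|
      .done (by simp only [Cmd.code, List.length_append, List.length_cons, List.length_nil]; omega)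
        (by rw [e5, e4]) w5.holds), w5, ?_⟩
    · simp only [Cmd.code, List.length_append, List.length_cons, List.length_nil] at hK
      rw [State.seti_clk, Nat.mul_add]; omega
  | seq c d s s' s'' _ _ ihc ihd =>
    intro o m hc hf hK h
    simp only [Cmd.fits, Bool.and_eq_true] at hf
    simp only [Cmd.code, codeAt_append, List.length_append] at hc hK ⊢
    obtain ⟨m1, t1, r1, w1, b1⟩ := ihc hc.1 hf.1 (by omega) h
    obtain ⟨m2, t2, r2, w2, b2⟩ := ihd hc.2 hf.2 (by omega) w1
    exact ⟨m2, _, by rw [← Nat.add_assoc]; exact r1.trans r2, w2, by omega⟩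
  | iteT e c d s s' hx _ ih =>
    intro o m hc hf hK h
    simp only [Cmd.fits, Bool.and_eq_true] at hf
    simp only [Cmd.code, codeAt_append, codeAt_cons, List.length_append, List.length_cons,
      List.length_nil, zero_add, Nat.reduceAdd] at hc hK ⊢
    obtain ⟨c0, ⟨c1, -⟩, -, -, c2⟩ := hc
    obtain ⟨m1, r1, w1, e1, f1⟩ := Expr.reach hl c0 h le_rfl (by omega) hf.1
    obtain ⟨m2, t2, r2, w2, b2⟩ := ih c2 hf.2.1 (by omega) w1.tick
    refine ⟨m2, (e.code 32).length + (t2 + 1), r1.trans (.head c1 w1.holds ?_), w2, ?_⟩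
    · simp only [exec]
      rw [if_pos (by rw [e1]; exact hx)]
      convert r2 using 2
      omega
    · rw [State.tick_clk, Nat.mul_add] at b2
      omega
  | iteF e c d s s' hx _ ih =>
    intro o m hc hf hK h
    simp only [Cmd.fits, Bool.and_eq_true] at hf
    simp only [Cmd.code, codeAt_append, codeAt_cons, List.length_append, List.length_cons,
      List.length_nil, zero_add, Nat.reduceAdd] at hc hK ⊢
    obtain ⟨c0, ⟨c1, -⟩, c2, ⟨c3, c4, -⟩, -⟩ := hc
    obtain ⟨m1, r1, w1, e1, f1⟩ := Expr.reach hl c0 h le_rfl (by omega) hf.1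
    obtain ⟨m2, t2, r2, w2, b2⟩ := ih c2 hf.2.2 (by omega) w1.tick
    have w3 := w2.write_temp (t := 32) (x := 1) (by omega) (by omega) (by omega)
    refine ⟨_, (e.code 32).length + (t2 + 2 + 1),
      r1.trans (.head c1 w1.holds ?_), w3, ?_⟩
    · simp only [exec]
      rw [if_neg (by rw [e1, hx]; simp)]
      refine r2.trans ?_
      refine .head c3 w2.holds (.head c4 w3.holds ?_)
      simp only [exec]
      rw [if_pos (by rw [read_write, if_pos rfl]; simp)]
      exact .done (by omega) rfl w3.holds
    · rw [State.tick_clk, Nat.mul_add] at b2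
      omega
  | loopF e c s hx =>
    intro o m hc hf hK h
    simp only [Cmd.fits, Bool.and_eq_true] at hf
    simp only [Cmd.code, codeAt_append, codeAt_cons, List.length_append, List.length_cons,
      List.length_nil, zero_add, Nat.reduceAdd] at hc hK ⊢
    obtain ⟨c0, ⟨c1, c2, c3, -⟩, -⟩ := hc
    obtain ⟨m1, r1, w1, e1, f1⟩ := Expr.reach hl c0 h le_rfl (by omega) hf.1
    have w2 := w1.write_temp (t := 32) (x := 1) (by omega) (by omega) (by omega)
    refine ⟨_, (e.code 32).length + 3, r1.trans (.head c1 w1.holds ?_), w2.tick, ?_⟩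
    · simp only [exec]
      rw [if_neg (by rw [e1, hx]; simp)]
      refine .head c2 w1.holds (.head c3 w2.holds ?_)
      simp only [exec]
      rw [if_pos (by rw [read_write, if_pos rfl]; simp)]
      exact .done (by omega) rfl w2.holds
    · rw [State.tick_clk, Nat.mul_add]
      omega
  | loopT e c s s' s'' hx _ _ ih ih' =>
    intro o m hc hf hK h
    have hc' := hc
    have hf' := hf
    have hK' := hK
    simp only [Cmd.fits, Bool.and_eq_true] at hf
    simp only [Cmd.code, codeAt_append, codeAt_cons, List.length_append, List.length_cons,
      List.length_nil, zero_add, Nat.reduceAdd] at hc hK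
    obtain ⟨c0, ⟨c1, -, -, -⟩, c2, c3, c4, -⟩ := hc
    obtain ⟨m1, r1, w1, e1, f1⟩ := Expr.reach hl c0 h le_rfl (by omega) hf.1
    obtain ⟨m2, t2, r2, w2, b2⟩ := ih c2 hf.2 (by omega) w1.tick
    have w3 := w2.write_temp (t := 32) (x := 1) (by omega) (by omega) (by omega)
    obtain ⟨m4, t4, r4, w4, b4⟩ := ih' hc' hf' hK' w3
    refine ⟨m4, (e.code 32).length + (t2 + (t4 + 1 + 1) + 1),
      r1.trans (.head c1 w1.holds ?_), w4, ?_⟩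
    · simp only [exec]
      rw [if_pos (by rw [e1]; exact hx)]
      refine r2.trans ?_
      refine .head c3 w2.holds (.head c4 w3.holds ?_)
      simp only [exec]
      rw [if_pos (by rw [read_write, if_pos rfl]; simp)]
      exact r4
    · rw [State.tick_clk, Nat.mul_add] at b2
      omega

/-! ### From structured programs to machine programs -/

def State.init (inp : List ℕ) : State := ⟨fun _ => 0, fun _ _ => 0, fun i => inp.getD i 0, 0⟩

/-- The machine program first computes the address at which the arrays start, from the numbers
`n`, `|E|`, `|F 0|` at the beginning of the input. -/
def Cmd.program (c : Cmd) : Program where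
  code := [.add 31 64 64, .add 31 31 65, .add 31 31 65, .add 31 31 66, .const 32 67,
    .add 31 31 32] ++ c.code 6
  work := 64

theorem bitLength_eq (m : List ℕ) :
    bitLength m = ∑ a ∈ Finset.range m.length, (Nat.size (read m a) + 1) := by
  unfold bitLength read
  induction m using List.reverseRecOn with
  | nil => rfl
  | append_singleton m x ih =>
    rw [List.map_append, List.sum_append, ih, List.length_append, List.length_singleton,
      Finset.sum_range_succ]
    congr 1
    · refine Finset.sum_congr rfl fun a ha => ?_
      rw [List.getD_append _ _ _ _ (Finset.mem_range.1 ha)]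
    · simp

theorem Limits.Holds.bitLength_le {m : List ℕ} (h : l.Holds m) :
    bitLength m ≤ ∑ a ∈ Finset.range (64 + l.len + 16 * l.size), (Nat.size (l.cell a) + 1) := by
  rw [bitLength_eq]
  refine (Finset.sum_le_sum fun a _ => Nat.succ_le_succ (Nat.size_le_size (h.2 a))).trans ?_
  exact Finset.sum_le_sum_of_subset (Finset.range_subset_range.2 h.1)

theorem Limits.Ok.cell_le (hl : l.Ok) (a : ℕ) : l.cell a ≤ 2048 * l.top := by
  unfold Limits.cell
  split_ifs
  · omega
  · exact le_rfl
  · have := hl.icap (a - 64); omega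
  · have := hl.acap ((a - 64 - l.len) % 16) ((a - 64 - l.len) / 16); omega

theorem read_start (c : Cmd) (inp : List ℕ) (a : ℕ) :
    read (start c.program inp).mem a = if a < 64 then 0 else inp.getD (a - 64) 0 := by
  change (List.replicate 64 0 ++ inp).getD a 0 = _
  rw [List.getD_eq_getElem?_getD, List.getElem?_append, List.length_replicate,
    List.getD_eq_getElem?_getD]
  split_ifs with h
  · rw [List.getElem?_replicate, if_pos h]; rfl
  · rfl

/-- The prelude of six instructions turns the header of the input into the base address `64 + len`.
From there on compiler correctness applies, and the cell bounds, which hold after every machine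
step, give both space and word length. -/
theorem computesWithin_of_exec {c : Cmd} {inp : List ℕ} {post : List ℕ → Prop}
    {time space word : ℕ} {s : State} (hl : l.Ok) (hlen : l.len = inp.length)
    (h3 : inp.length = 3 + 2 * inp.getD 0 0 + 2 * inp.getD 1 0 + inp.getD 2 0)
    (hcap : ∀ i, inp.getD i 0 ≤ l.icap i) (hc : c.fits = true) (he : Exec l c (.init inp) s)
    (hpost : ∀ m, (∀ i < l.len, read m (64 + i) = s.inp i) → post m)
    (htime : (c.code 6).length * s.clk + 6 ≤ time)
    (hspace : ∑ a ∈ Finset.range (64 + l.len + 16 * l.size), (Nat.size (l.cell a) + 1) ≤ space)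
    (hword : Nat.size (2048 * l.top) ≤ word) :
    ComputesWithin c.program inp post time space word := by
  have h1 := hl.base
  have hm0 : l.Holds (start c.program inp).mem := by
    refine ⟨?_, fun a => ?_⟩
    · change (List.replicate 64 0 ++ inp).length ≤ _
      rw [List.length_append, List.length_replicate]; omega
    · rw [read_start, Limits.cell]
      split_ifs with h2 h3 h3
      · omega
      · omega
      · omega
      · exact hcap _
      · rw [List.getD_eq_default _ _ (by omega)]; omega
  have hw31 : ∀ {m : List ℕ} {x : ℕ}, l.Holds m → x ≤ l.top → l.Holds (write m 31 x) :=
    fun h hx => h.write (by omega) (by rw [Limits.cell, if_pos (by omega)]; exact hx)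
  set m0 := (start c.program inp).mem with hm0'
  have e64 : read m0 64 = inp.getD 0 0 := read_start c inp 64
  have e65 : read m0 65 = inp.getD 1 0 := read_start c inp 65
  have e66 : read m0 66 = inp.getD 2 0 := read_start c inp 66
  have e31 : read m0 31 = 0 := read_start c inp 31
  set m1 := write m0 31 (read m0 64 + read m0 64) with h1'
  have w1 := hw31 (x := read m0 64 + read m0 64) hm0 (by omega)
  have f1 : read m1 31 = 2 * inp.getD 0 0 := by rw [h1', read_write, if_pos rfl]; omega
  have g1 : read m1 65 = inp.getD 1 0 := by rw [h1', read_write, if_neg (by omega), e65]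
  set m2 := write m1 31 (read m1 31 + read m1 65) with h2'
  have w2 := hw31 (x := read m1 31 + read m1 65) w1 (by omega)
  have f2 : read m2 31 = 2 * inp.getD 0 0 + inp.getD 1 0 := by
    rw [h2', read_write, if_pos rfl]; omega
  have g2 : read m2 65 = inp.getD 1 0 := by rw [h2', read_write, if_neg (by omega), g1]
  set m3 := write m2 31 (read m2 31 + read m2 65) with h3'
  have w3 := hw31 (x := read m2 31 + read m2 65) w2 (by omega)
  have f3 : read m3 31 = 2 * inp.getD 0 0 + 2 * inp.getD 1 0 := by
    rw [h3', read_write, if_pos rfl]; omega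
  have g3 : read m3 66 = inp.getD 2 0 := by
    rw [h3', read_write, if_neg (by omega), h2', read_write, if_neg (by omega), h1', read_write,
      if_neg (by omega), e66]
  set m4 := write m3 31 (read m3 31 + read m3 66) with h4'
  have w4 := hw31 (x := read m3 31 + read m3 66) w3 (by omega)
  have f4 : read m4 31 = 2 * inp.getD 0 0 + 2 * inp.getD 1 0 + inp.getD 2 0 := by
    rw [h4', read_write, if_pos rfl]; omega
  set m5 := write m4 32 67 with h5'
  have w5 : l.Holds m5 := w4.write (by omega)
    (by rw [Limits.cell, if_neg (by omega), if_pos (by omega)]; omega)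
  have f5 : read m5 31 = 2 * inp.getD 0 0 + 2 * inp.getD 1 0 + inp.getD 2 0 := by
    rw [h5', read_write, if_neg (by omega), f4]
  have g5 : read m5 32 = 67 := by rw [h5', read_write, if_pos rfl]
  set m6 := write m5 31 (read m5 31 + read m5 32) with h6'
  have w6 := hw31 (x := read m5 31 + read m5 32) w5 (by omega)
  have f6 : read m6 31 = 64 + l.len := by
    rw [h6', read_write, if_pos rfl]; omega
  have other : ∀ a, a ≠ 31 → a ≠ 32 → read m6 a = if a < 64 then 0 else inp.getD (a - 64) 0 := by
    intro a ha ha'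
    simp only [h6', h5', h4', h3', h2', h1', read_write, if_neg ha, if_neg ha']
    exact read_start c inp a
  have hrel : l.Rel (.init inp) m6 := by
    refine ⟨w6, fun x => ?_, f6, fun i hi => ?_, fun b i => ?_⟩
    · have := x.idx_lt
      rw [other _ (by omega) (by omega), if_pos (by omega)]; rfl
    · rw [other _ (by omega) (by omega), if_neg (by omega), Nat.add_sub_cancel_left]; rfl
    · rw [other _ (by omega) (by omega), if_neg (by omega),
        List.getD_eq_default _ _ (by omega)]; rfl
  have hcode : CodeAt c.program 0 ([.add 31 64 64, .add 31 31 65, .add 31 31 65, .add 31 31 66,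
      .const 32 67, .add 31 31 32] ++ c.code 6) := by
    intro i hi
    rw [Nat.zero_add]
    exact List.getElem?_eq_getElem hi
  rw [codeAt_append, show 0 + ([.add 31 64 64, .add 31 31 65, .add 31 31 65, .add 31 31 66,
    .const 32 67, .add 31 31 32] : List Instr).length = 6 from rfl] at hcode
  obtain ⟨hc1, hc2⟩ := hcode
  simp only [codeAt_cons] at hc1
  obtain ⟨c1, c2, c3, c4, c5, c6, -⟩ := hc1
  obtain ⟨m, t, r, w, b⟩ := Cmd.code_correct hl he hc2 hc le_rfl hrel
  have hr : Reach c.program l.Holds (start c.program inp) _ (t + 6) :=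
    .head c1 hm0 <| .head c2 w1 <| .head c3 w2 <| .head c4 w3 <| .head c5 w4 <| .head c6 w5 r
  refine ⟨t + 6, ?_, ?_, ?_, fun s hs => ⟨(hr.2 s hs).bitLength_le.trans hspace, fun x hx => ?_⟩⟩
  · have : (State.init inp).clk = 0 := rfl
    rw [this] at b
    exact le_trans (by omega) htime
  · rw [run, hr.1, Halted]
    simp [Cmd.program]; omega
  · rw [run, hr.1]
    exact hpost m w.inp
  · obtain ⟨i, hi, rfl⟩ := List.mem_iff_getElem.1 hx
    have := (hr.2 s hs).2 i
    change read (run c.program inp s).mem i ≤ _ at this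
    rw [read, List.getD_eq_getElem _ _ hi] at this
    exact (Nat.size_le_size (this.trans (hl.cell_le i))).trans hword

/-! ### Weakest preconditions -/

/-- Whether a command may change a given variable. -/
def Cmd.wv : Cmd → Var → Bool
  | .skip, _ => false
  | .set x _, y => x = y
  | .put _ _ _, _ => false
  | .inp x _, y => x = y
  | .out _ _, _ => false
  | .seq c d, y => c.wv y || d.wv y
  | .ite _ c d, y => c.wv y || d.wv y
  | .loop _ c, y => c.wv y

/-- Whether a command may change a given array. -/
def Cmd.wa : Cmd → Arr → Bool
  | .put b _ _, b' => b = b'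
  | .seq c d, y => c.wa y || d.wa y
  | .ite _ c d, y => c.wa y || d.wa y
  | .loop _ c, y => c.wa y
  | _, _ => false

/-- Whether a command may change the input. -/
def Cmd.wi : Cmd → Bool
  | .out _ _ => true
  | .seq c d => c.wi || d.wi
  | .ite _ c d => c.wi || d.wi
  | .loop _ c => c.wi
  | _ => false

/-- The states agree on everything that `c` does not change. -/
structure Same (c : Cmd) (s s' : State) : Prop where
  v : ∀ x, c.wv x = false → s'.v x = s.v x
  a : ∀ b, c.wa b = false → s'.a b = s.a b
  inp : c.wi = false → s'.inp = s.inp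

theorem Same.refl (c : Cmd) (s : State) : Same c s s :=
  ⟨fun _ _ => rfl, fun _ _ => rfl, fun _ => rfl⟩

theorem Same.trans {c : Cmd} {s s' s'' : State} (h : Same c s s') (h' : Same c s' s'') :
    Same c s s'' :=
  ⟨fun x hx => (h'.v x hx).trans (h.v x hx), fun x hx => (h'.a x hx).trans (h.a x hx),
    fun hx => (h'.inp hx).trans (h.inp hx)⟩

/-- What a command may write is computed from its syntax, so the frame conditions needed later can
be closed by evaluation. -/
theorem Exec.same {c : Cmd} {s s' : State} (h : Exec l c s s') : Same c s s' := by
  induction h with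
  | skip s => exact .refl _ _
  | set x e s _ =>
    refine ⟨fun y hy => ?_, fun _ _ => rfl, fun _ => rfl⟩
    rw [State.setv_v, if_neg (by rintro rfl; simp [Cmd.wv] at hy)]
  | put b e f s _ _ =>
    refine ⟨fun _ _ => rfl, fun b' hb => ?_, fun _ => rfl⟩
    funext i
    rw [State.seta_a, if_neg (by rintro rfl; simp [Cmd.wa] at hb)]
  | inp x e s _ _ =>
    refine ⟨fun y hy => ?_, fun _ _ => rfl, fun _ => rfl⟩
    rw [State.setv_v, if_neg (by rintro rfl; simp [Cmd.wv] at hy)]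
  | out e f s _ _ => exact ⟨fun _ _ => rfl, fun _ _ => rfl, fun h => by simp [Cmd.wi] at h⟩
  | seq c d s s' s'' _ _ hc hd =>
    refine ⟨fun x hx => ?_, fun x hx => ?_, fun hx => ?_⟩
    · have h : c.wv x = false ∧ d.wv x = false := by simpa [Cmd.wv] using hx
      rw [hd.v x h.2, hc.v x h.1]
    · have h : c.wa x = false ∧ d.wa x = false := by simpa [Cmd.wa] using hx
      rw [hd.a x h.2, hc.a x h.1]
    · have h : c.wi = false ∧ d.wi = false := by simpa [Cmd.wi] using hx
      rw [hd.inp h.2, hc.inp h.1]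
  | iteT e c d s s' _ _ h =>
    refine ⟨fun x hx => ?_, fun x hx => ?_, fun hx => ?_⟩
    · exact h.v x (by simpa [Cmd.wv] using hx : _ ∧ _).1
    · exact h.a x (by simpa [Cmd.wa] using hx : _ ∧ _).1
    · exact h.inp (by simpa [Cmd.wi] using hx : _ ∧ _).1
  | iteF e c d s s' _ _ h =>
    refine ⟨fun x hx => ?_, fun x hx => ?_, fun hx => ?_⟩
    · exact h.v x (by simpa [Cmd.wv] using hx : _ ∧ _).2
    · exact h.a x (by simpa [Cmd.wa] using hx : _ ∧ _).2
    · exact h.inp (by simpa [Cmd.wi] using hx : _ ∧ _).2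
  | loopF e c s _ => exact ⟨fun _ _ => rfl, fun _ _ => rfl, fun _ => rfl⟩
  | loopT e c s s' s'' _ _ _ h h' =>
    exact .trans ⟨fun x hx => h.v x hx, fun x hx => h.a x hx, fun hx => h.inp hx⟩ h'

/-- Started in `s`, the command `c` ends in a state that satisfies `Q`. -/
def WP (l : Limits) (c : Cmd) (Q : State → Prop) (s : State) : Prop := ∃ s', Exec l c s s' ∧ Q s'

theorem WP.mono {c : Cmd} {Q Q' : State → Prop} {s : State} (h : WP l c Q s)
    (hQ : ∀ s', Q s' → Same c s s' → Q' s') : WP l c Q' s := by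
  obtain ⟨s', he, hq⟩ := h
  exact ⟨s', he, hQ s' hq he.same⟩

theorem wp_skip {Q : State → Prop} {s : State} : WP l .skip Q s ↔ Q s :=
  ⟨fun ⟨_, h, hQ⟩ => by cases h; exact hQ, fun h => ⟨s, .skip s, h⟩⟩

theorem wp_set {x : Var} {e : Expr} {Q : State → Prop} {s : State} :
    WP l (.set x e) Q s ↔ e.eval s ≤ l.top ∧ Q (s.setv x (e.eval s)) :=
  ⟨fun ⟨_, h, hQ⟩ => by cases h with | set _ _ _ h => exact ⟨h, hQ⟩,
    fun ⟨h, hQ⟩ => ⟨_, .set x e s h, hQ⟩⟩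

theorem wp_put {b : Arr} {e f : Expr} {Q : State → Prop} {s : State} :
    WP l (.put b e f) Q s ↔ (e.eval s < l.size ∧ f.eval s ≤ l.acap b.idx (e.eval s)) ∧
      Q (s.seta b (e.eval s) (f.eval s)) :=
  ⟨fun ⟨_, h, hQ⟩ => by cases h with | put _ _ _ _ h h' => exact ⟨⟨h, h'⟩, hQ⟩,
    fun ⟨⟨h, h'⟩, hQ⟩ => ⟨_, .put b e f s h h', hQ⟩⟩

theorem wp_inp {x : Var} {e : Expr} {Q : State → Prop} {s : State} :
    WP l (.inp x e) Q s ↔ (e.eval s < l.len ∧ s.inp (e.eval s) ≤ l.top) ∧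
      Q (s.setv x (s.inp (e.eval s))) :=
  ⟨fun ⟨_, h, hQ⟩ => by cases h with | inp _ _ _ h h' => exact ⟨⟨h, h'⟩, hQ⟩,
    fun ⟨⟨h, h'⟩, hQ⟩ => ⟨_, .inp x e s h h', hQ⟩⟩

theorem wp_out {e f : Expr} {Q : State → Prop} {s : State} :
    WP l (.out e f) Q s ↔ (e.eval s < l.len ∧ f.eval s ≤ l.icap (e.eval s)) ∧
      Q (s.seti (e.eval s) (f.eval s)) :=
  ⟨fun ⟨_, h, hQ⟩ => by cases h with | out _ _ _ h h' => exact ⟨⟨h, h'⟩, hQ⟩,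
    fun ⟨⟨h, h'⟩, hQ⟩ => ⟨_, .out e f s h h', hQ⟩⟩

theorem wp_seq {c d : Cmd} {Q : State → Prop} {s : State} :
    WP l (c ;; d) Q s ↔ WP l c (WP l d Q) s :=
  ⟨fun ⟨_, h, hQ⟩ => by cases h with | seq _ _ _ s' _ h h' => exact ⟨s', h, _, h', hQ⟩,
    fun ⟨_, he, s'', he', hq⟩ => ⟨s'', .seq _ _ _ _ _ he he', hq⟩⟩

theorem wp_ite {e : Expr} {c d : Cmd} {Q : State → Prop} {s : State} :
    WP l (.ite e c d) Q s ↔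
      (0 < e.eval s → WP l c Q s.tick) ∧ (e.eval s = 0 → WP l d Q s.tick) := by
  constructor
  · rintro ⟨s', h, hQ⟩
    cases h with
    | iteT _ _ _ _ _ h h' => exact ⟨fun _ => ⟨_, h', hQ⟩, fun h0 => by omega⟩
    | iteF _ _ _ _ _ h h' => exact ⟨fun h0 => by omega, fun _ => ⟨_, h', hQ⟩⟩
  · rintro ⟨h, h'⟩
    rcases Nat.eq_zero_or_pos (e.eval s) with h0 | h0
    · obtain ⟨s', he, hq⟩ := h' h0
      exact ⟨s', .iteF _ _ _ _ _ h0 he, hq⟩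
    · obtain ⟨s', he, hq⟩ := h h0
      exact ⟨s', .iteT _ _ _ _ _ h0 he, hq⟩

/-- Loops with an invariant and a variant. -/
theorem WP.loop (I : ℕ → State → Prop) {e : Expr} {c : Cmd} {Q : State → Prop} {s : State} {k : ℕ}
    (h0 : I k s)
    (hbody : ∀ k s', I k s' → Same c s s' → 0 < e.eval s' →
      WP l c (fun s'' => ∃ k' < k, I k' s'') s'.tick)
    (hend : ∀ k s', I k s' → Same c s s' → e.eval s' = 0 → Q s'.tick) :
    WP l (.loop e c) Q s := by
  -- The agreement with the initial state outside of what the body writes is carried along, so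
  -- invariants need to mention only what changes.
  suffices h : ∀ k s', I k s' → Same c s s' → WP l (.loop e c) Q s' from h k s h0 (.refl _ _)
  clear h0 k
  intro k
  induction k using Nat.strong_induction_on with
  | _ k ih =>
    intro s' hI hs
    rcases Nat.eq_zero_or_pos (e.eval s') with he | he
    · exact ⟨_, .loopF _ _ _ he, hend k s' hI hs he⟩
    · obtain ⟨s1, hx, k', hk, hI'⟩ := hbody k s' hI hs he
      have hs1 : Same c s' s1 := ⟨hx.same.v, hx.same.a, hx.same.inp⟩
      obtain ⟨s2, hx', hq⟩ := ih k' hk s1 hI' (hs.trans hs1)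
      exact ⟨s2, .loopT _ _ _ _ _ he hx hx', hq⟩

/-! ## The program -/

instance : Add Expr := ⟨.add⟩

instance : Sub Expr := ⟨.sub⟩

instance (c : ℕ) : OfNat Expr c := ⟨.lit c⟩

abbrev V (x : Var) : Expr := .var x

abbrev A (b : Arr) (e : Expr) : Expr := .get b e

@[simp] theorem Expr.eval_add (e f : Expr) (s : State) : (e + f).eval s = e.eval s + f.eval s := rfl

@[simp] theorem Expr.eval_sub (e f : Expr) (s : State) : (e - f).eval s = e.eval s - f.eval s := rfl

@[simp] theorem Expr.eval_ofNat (c : ℕ) (s : State) :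
    (no_index (OfNat.ofNat c) : Expr).eval s = c := rfl

/-- Read owner and membership in `W` of all positions. -/
def readPositions : Cmd :=
  .set .i 0 ;;
  .loop (V .n - V .i)
    (.inp .t (V .p) ;; .put .own (V .i) (V .t) ;;
     .inp .t (V .p + 1) ;; .put .inW (V .i) (V .t) ;;
     .set .p (V .p + 2) ;; .set .i (V .i + 1))

/-- Read the edges and link those with the same target. -/
def readEdges : Cmd :=
  .set .i 0 ;;
  .loop (V .m - V .i)
    (.inp .t (V .p) ;; .put .src (V .i) (V .t) ;;
     .inp .t (V .p + 1) ;; .put .tgt (V .i) (V .t) ;;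
     .put .nxt (V .i) (A .head (V .t)) ;; .put .head (V .t) (V .i + 1) ;;
     .set .p (V .p + 2) ;; .set .i (V .i + 1))

/-- Compute the powers of two. -/
def powers : Cmd :=
  .set .full 1 ;; .set .i 0 ;;
  .loop (V .n - V .i)
    (.put .pow (V .i) (V .full) ;; .set .full (V .full + V .full) ;; .set .i (V .i + 1))

/-- Read the members of `F 0`. -/
def readSets : Cmd :=
  .set .i 0 ;;
  .loop (V .k - V .i)
    (.inp .t (V .p) ;; .put .fl (V .t) 1 ;; .set .p (V .p + 1) ;; .set .i (V .i + 1))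

/-- Decode the current set `X`. -/
def decode : Cmd :=
  .set .y (V .x) ;; .set .z 0 ;; .set .any 0 ;; .set .i (V .n) ;;
  .loop (V .i)
    (.set .i (V .i - 1) ;; .put .deg (V .i) 0 ;;
     .ite (V .y + 1 - A .pow (V .i))
       (.set .y (V .y - A .pow (V .i)) ;; .put .inX (V .i) 1 ;;
        .put .inXW (V .i) (A .inW (V .i)) ;; .set .any (V .i + 1) ;;
        .ite (A .inW (V .i)) (.set .z (V .z + A .pow (V .i))) .skip)
       (.put .inX (V .i) 0 ;; .put .inXW (V .i) 0))

/-- Count the successors in `X`, and look for edges by which Player 1 can leave `X`. -/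
def degrees : Cmd :=
  .set .bad 0 ;; .set .i 0 ;;
  .loop (V .m - V .i)
    (.ite (A .inX (A .tgt (V .i)))
       (.put .deg (A .src (V .i)) (A .deg (A .src (V .i)) + 1))
       (.ite (A .inX (A .src (V .i)) + A .own (A .src (V .i)) - 1) (.set .bad 1) .skip) ;;
     .set .i (V .i + 1))

/-- Initialize the counters for the computation of an attractor. -/
def counters : Cmd :=
  .set .i 0 ;;
  .loop (V .n - V .i)
    (.ite (A .inX (V .i))
       (.ite (1 - ((A .own (V .i) - V .pl) + (V .pl - A .own (V .i))))
         (.put .cnt (V .i) 1) (.put .cnt (V .i) (A .deg (V .i))))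
       (.put .cnt (V .i) 0) ;;
     .set .i (V .i + 1))

/-- Process the edges to a position that has been attracted. -/
def attractStep : Cmd :=
  .loop (V .j)
    (.set .u (A .src (V .j - 1)) ;;
     .ite (A .cnt (V .u))
       (.put .cnt (V .u) (A .cnt (V .u) - 1) ;;
        .ite (1 - A .cnt (V .u))
          (.set .y (V .y - A .pow (V .u)) ;; .put .stk (V .sp) (V .u) ;; .set .sp (V .sp + 1))
          .skip)
       .skip ;;
     .set .j (A .nxt (V .j - 1)))

/-- Remove from `X` the attractor of the position `w` for the player `pl`; the code of the
remaining set is stored in `y`. -/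
def attractor : Cmd :=
  counters ;;
  .put .cnt (V .w) 0 ;; .set .y (V .x - A .pow (V .w)) ;; .put .stk 0 (V .w) ;; .set .sp 1 ;;
  .loop (V .sp)
    (.set .sp (V .sp - 1) ;; .set .j (A .head (A .stk (V .sp))) ;; attractStep)

/-- Look for a position whose attractor leaves a set in which the opponent wins somewhere. -/
def scan (wit : Bool) (b : Arr) : Cmd :=
  .set .q 0 ;;
  .loop (V .hi - V .w)
    (.ite (A b (V .w))
       (attractor ;;
        .ite (A .tab (V .y + V .y + V .op))
          (.set .q (bif wit then A .tab (V .y + V .y + V .op) else 1)) .skip)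
       .skip ;;
     .set .w (V .w + 1))

/-- The positions to look at if the opponent of the owner of `X` wins somewhere. -/
def candidates (wit : Bool) : Cmd :=
  bif wit then .set .w (V .q - 1) ;; .set .hi (V .q) else .set .w 0 ;; .set .hi (V .n)

/-- Compute the table entries of `X`. -/
def solve (wit : Bool) : Cmd :=
  .set .pl (1 - A .fl (V .z)) ;; .set .op (A .fl (V .z)) ;; .set .w 0 ;; .set .hi (V .n) ;;
  scan wit .inXW ;; .put .tab (V .x + V .x + V .op) (V .q) ;;
  .ite (V .q)
    (candidates wit ;; .set .op (V .pl) ;; .set .pl (1 - V .pl) ;; scan wit .inX)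
    (.set .op (V .pl) ;; .set .q (bif wit then V .any else 1)) ;;
  .put .tab (V .x + V .x + V .op) (V .q)

/-- Mark the positions of `X` as won by Player 0, if Player 0 wins everywhere in `X` and Player 1
cannot leave `X`. -/
def mark : Cmd :=
  .set .bad (V .bad + A .tab (V .x + V .x + 1)) ;; .set .i 0 ;;
  .loop (V .n - V .i)
    (.ite (A .inX (V .i)) (.ite (A .deg (V .i)) .skip (.set .bad 1)) .skip ;;
     .set .i (V .i + 1)) ;;
  .ite (V .bad) .skip
    (.set .i 0 ;;
     .loop (V .n - V .i)
       (.ite (A .inX (V .i)) (.put .res (V .i) 1) .skip ;; .set .i (V .i + 1)))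

/-- The array `res` marks wins of Player 0, so its complement is the number of the winner. It
overwrites the front of the input. -/
def output : Cmd :=
  .set .i 0 ;;
  .loop (V .n - V .i) (.out (V .i) (1 - A .res (V .i)) ;; .set .i (V .i + 1))

def readInput : Cmd :=
  .inp .n 0 ;; .inp .m 1 ;; .inp .k 2 ;; .set .p 3 ;;
  readPositions ;; readEdges ;; powers ;; readSets

/-- The decision procedure for McNaughton games. If `wit` is true, the table contains witnesses
for the fact that winning regions are not empty. -/
def decideGames (wit : Bool) : Cmd :=
  readInput ;; .set .x 1 ;;
  .loop (V .full - V .x) (decode ;; degrees ;; solve wit ;; mark ;; .set .x (V .x + 1)) ;;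
  output

theorem decideGames_fits (wit : Bool) : (decideGames wit).fits = true := by
  cases wit <;> rfl

/-! ### Limits -/

/-- The limits for games on `n` positions, if the input is `inp`. -/
def limits (wit : Bool) (n : ℕ) (inp : List ℕ) : Limits where
  len := inp.length
  -- The largest index used is that of the table entry of the full set for Player 1.
  size := 2 * 2 ^ n
  top := 64 * 2 ^ n
  -- The indices 7 and 8 are those of `fl` and `tab`, the only arrays of exponential length. All
  -- others are confined to indices below `n * n`, which covers positions and edges; their further
  -- cells stay 0 and cost one bit each.
  acap j i := if j = 7 then 1 else if j = 8 then (if wit then n else 1) else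
    if i < n * n then 64 * 2 ^ n else 0
  -- The maximum with 1 leaves room for the output bits.
  icap i := max (inp.getD i 0) 1

theorem sq_le_two_pow (n : ℕ) : n * n ≤ 2 * 2 ^ n := by
  rcases lt_or_ge n 4 with h | h
  · interval_cases n <;> norm_num
  · induction n, h using Nat.le_induction with
    | base => norm_num
    | succ n h ih =>
      have : 2 * n + 1 ≤ n * n := by nlinarith
      rw [pow_succ]
      nlinarith

end RAM

/-! ### Binary codes of sets of positions. -/

namespace McNaughtonGame

variable {n : ℕ}

theorem setCode_eq_sum (X : Finset (Fin n)) :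
    setCode X = ∑ v : Fin n, if v ∈ X then 2 ^ (v : ℕ) else 0 := by
  rw [setCode, Finset.sum_ite_mem, Finset.univ_inter]

theorem setCode_filter_lt_succ (X : Finset (Fin n)) {i : ℕ} (h : i < n) :
    setCode (X.filter (fun v => (v : ℕ) < i + 1)) =
      setCode (X.filter (fun v => (v : ℕ) < i)) + if ⟨i, h⟩ ∈ X then 2 ^ i else 0 := by
  have e : (if (⟨i, h⟩ : Fin n) ∈ X then 2 ^ i else 0) =
      ∑ v : Fin n, if v = ⟨i, h⟩ then (if v ∈ X then 2 ^ (v : ℕ) else 0) else 0 := by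
    rw [Finset.sum_ite_eq' Finset.univ (⟨i, h⟩ : Fin n), if_pos (Finset.mem_univ _)]
  rw [setCode_eq_sum, setCode_eq_sum, e, ← Finset.sum_add_distrib]
  refine Finset.sum_congr rfl fun v _ => ?_
  simp only [Finset.mem_filter, Fin.ext_iff]
  by_cases hv : v ∈ X
  · simp only [hv, true_and, if_true]
    split_ifs <;> omega
  · simp [hv]

theorem setCode_filter_ge (X : Finset (Fin n)) {i : ℕ} (h : i < n) :
    setCode (X.filter (fun v => i ≤ (v : ℕ))) =
      setCode (X.filter (fun v => i + 1 ≤ (v : ℕ))) + if ⟨i, h⟩ ∈ X then 2 ^ i else 0 := by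
  have e : (if (⟨i, h⟩ : Fin n) ∈ X then 2 ^ i else 0) =
      ∑ v : Fin n, if v = ⟨i, h⟩ then (if v ∈ X then 2 ^ (v : ℕ) else 0) else 0 := by
    rw [Finset.sum_ite_eq' Finset.univ (⟨i, h⟩ : Fin n), if_pos (Finset.mem_univ _)]
  rw [setCode_eq_sum, setCode_eq_sum, e, ← Finset.sum_add_distrib]
  refine Finset.sum_congr rfl fun v _ => ?_
  simp only [Finset.mem_filter, Fin.ext_iff]
  by_cases hv : v ∈ X
  · simp only [hv, true_and, if_true]
    split_ifs <;> omega
  · simp [hv]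

theorem setCode_filter_lt_lt (X : Finset (Fin n)) {i : ℕ} (h : i ≤ n) :
    setCode (X.filter (fun v => (v : ℕ) < i)) < 2 ^ i := by
  induction i with
  | zero => simp [setCode]
  | succ i ih =>
    rw [setCode_filter_lt_succ X (by omega), pow_succ]
    have := ih (by omega)
    split_ifs <;> omega

theorem setCode_filter_lt_self (X : Finset (Fin n)) :
    setCode (X.filter (fun v => (v : ℕ) < n)) = setCode X := by
  rw [Finset.filter_true_of_mem fun v _ => v.2]

theorem setCode_lt (X : Finset (Fin n)) : setCode X < 2 ^ n := by
  rw [← setCode_filter_lt_self]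
  exact setCode_filter_lt_lt X le_rfl

/-- The digits are compared from the highest one downwards: the lower digits together contribute
less than the next power of two. -/
theorem setCode_injective : Function.Injective (setCode (n := n)) := by
  intro X Y h
  rw [← setCode_filter_lt_self X, ← setCode_filter_lt_self Y] at h
  have key : ∀ i ≤ n, setCode (X.filter (fun v => (v : ℕ) < i)) =
      setCode (Y.filter (fun v => (v : ℕ) < i)) → ∀ v : Fin n, (v : ℕ) < i → (v ∈ X ↔ v ∈ Y) := by
    intro i hi
    induction i with
    | zero => exact fun _ v hv => by omega
    | succ i ih =>
      intro e v hv
      rw [setCode_filter_lt_succ X (by omega), setCode_filter_lt_succ Y (by omega)] at e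
      have h1 := setCode_filter_lt_lt X (i := i) (by omega)
      have h2 := setCode_filter_lt_lt Y (i := i) (by omega)
      by_cases hvi : (v : ℕ) = i
      · have hve : v = ⟨i, by omega⟩ := Fin.ext hvi
        rw [hve]
        split_ifs at e with h3 h4 h4
        · simp [h3, h4]
        · omega
        · omega
        · simp [h3, h4]
      · refine ih (by omega) ?_ v (by omega)
        split_ifs at e <;> omega
  ext v
  exact key n le_rfl h v v.2

/-- The codes are distinct numbers below `2 ^ n`, and there are `2 ^ n` sets, so every number
occurs. -/
theorem exists_setCode_eq {x : ℕ} (h : x < 2 ^ n) : ∃ X : Finset (Fin n), setCode X = x := by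
  let f : Finset (Fin n) → Fin (2 ^ n) := fun X => ⟨setCode X, setCode_lt X⟩
  have hf : Function.Bijective f := by
    rw [Fintype.bijective_iff_injective_and_card]
    refine ⟨fun X Y h => setCode_injective (congrArg Fin.val h), ?_⟩
    rw [Fintype.card_finset, Fintype.card_fin, Fintype.card_fin]
  obtain ⟨X, hX⟩ := hf.2 ⟨x, h⟩
  exact ⟨X, congrArg Fin.val hX⟩

theorem setCode_erase {X : Finset (Fin n)} {v : Fin n} (h : v ∈ X) :
    setCode (X.erase v) = setCode X - 2 ^ (v : ℕ) := by
  rw [setCode, setCode, ← Finset.add_sum_erase X _ h, Nat.add_sub_cancel_left]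

/-- This is why the table can be filled in the order of the codes: everything looked up for `X`
concerns a proper subset. -/
theorem setCode_lt_of_ssubset {X Y : Finset (Fin n)} (h : Y ⊂ X) : setCode Y < setCode X := by
  refine lt_of_le_of_ne (Finset.sum_le_sum_of_subset h.1) fun e => ?_
  exact h.ne (setCode_injective e)

end McNaughtonGame

namespace RAM

set_option linter.constructorNameAsVariable false

open McNaughtonGame

/-! ## Reading the input -/

/-- `inp` is a representation of `G` with the given lists. -/
structure Input {n : ℕ} (G : McNaughtonGame (Fin n)) (es : List (Fin n × Fin n))
    (fs : List (Finset (Fin n))) (inp : List ℕ) : Prop where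
  pos : 0 < n
  es_nodup : es.Nodup
  mem_es : ∀ e, e ∈ es ↔ e ∈ G.E
  fs_nodup : fs.Nodup
  mem_fs : ∀ Z, Z ∈ fs ↔ Z ∈ G.F 0
  inp_eq : inp = [n, es.length, fs.length] ++
      (List.finRange n).flatMap
        (fun v => [if v ∈ G.pos 0 then 0 else 1, if v ∈ G.W then 1 else 0]) ++
      es.flatMap (fun e => [(e.1 : ℕ), (e.2 : ℕ)]) ++
      fs.map setCode

theorem length_flatMap_pair {α : Type*} (f g : α → ℕ) (l : List α) :
    (l.flatMap (fun x => [f x, g x])).length = 2 * l.length := by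
  induction l with
  | nil => rfl
  | cons x l ih => simp [ih]; omega

theorem getElem?_flatMap_pair {α : Type*} (f g : α → ℕ) (l : List α) (i : ℕ) :
    (l.flatMap (fun x => [f x, g x]))[2 * i]? = l[i]?.map f ∧
      (l.flatMap (fun x => [f x, g x]))[2 * i + 1]? = l[i]?.map g := by
  induction l generalizing i with
  | nil => simp
  | cons x l ih =>
    match i with
    | 0 => simp
    | i + 1 => simpa [Nat.mul_add] using ih i

namespace Input

variable {n : ℕ} {G : McNaughtonGame (Fin n)} {es : List (Fin n × Fin n)}
  {fs : List (Finset (Fin n))} {inp : List ℕ} (h : Input G es fs inp)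

include h

theorem length_eq : inp.length = 3 + 2 * n + 2 * es.length + fs.length := by
  rw [h.inp_eq]
  simp only [List.length_append, length_flatMap_pair, List.length_finRange, List.length_map,
    List.length_cons, List.length_nil]

theorem getD_zero : inp.getD 0 0 = n := by rw [h.inp_eq]; rfl

theorem getD_one : inp.getD 1 0 = es.length := by rw [h.inp_eq]; rfl

theorem getD_two : inp.getD 2 0 = fs.length := by rw [h.inp_eq]; rfl

theorem getD_pos (v : Fin n) : inp.getD (3 + 2 * v) 0 = (if v ∈ G.pos 0 then 0 else 1) ∧
    inp.getD (3 + 2 * v + 1) 0 = if v ∈ G.W then 1 else 0 := by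
  have h1 := length_flatMap_pair (fun v => if v ∈ G.pos 0 then 0 else 1)
    (fun v => if v ∈ G.W then 1 else 0) (List.finRange n)
  have h2 := getElem?_flatMap_pair (fun v => if v ∈ G.pos 0 then 0 else 1)
    (fun v => if v ∈ G.W then 1 else 0) (List.finRange n) v
  rw [List.length_finRange] at h1
  have hv := v.2
  rw [h.inp_eq]
  simp only [List.getD_eq_getElem?_getD, List.append_assoc]
  constructor
  · rw [List.getElem?_append_right (by simp), List.getElem?_append_left (by rw [h1]; simp)]
    simp only [List.length_cons, List.length_nil]
    rw [show 3 + 2 * (v : ℕ) - (0 + 1 + 1 + 1) = 2 * v by omega, h2.1]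
    simp
  · rw [List.getElem?_append_right (by simp; omega),
      List.getElem?_append_left (by rw [h1]; simp; omega)]
    simp only [List.length_cons, List.length_nil]
    rw [show 3 + 2 * (v : ℕ) + 1 - (0 + 1 + 1 + 1) = 2 * v + 1 by omega, h2.2]
    simp

theorem getD_edge (i : Fin es.length) : inp.getD (3 + 2 * n + 2 * i) 0 = (es[i].1 : ℕ) ∧
    inp.getD (3 + 2 * n + 2 * i + 1) 0 = (es[i].2 : ℕ) := by
  have h1 := length_flatMap_pair (fun v => if v ∈ G.pos 0 then 0 else 1)
    (fun v => if v ∈ G.W then 1 else 0) (List.finRange n)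
  have h2 := getElem?_flatMap_pair (fun e : Fin n × Fin n => (e.1 : ℕ)) (fun e => (e.2 : ℕ)) es i
  have h3 := length_flatMap_pair (fun e : Fin n × Fin n => (e.1 : ℕ)) (fun e => (e.2 : ℕ)) es
  rw [List.length_finRange] at h1
  have hi := i.2
  rw [h.inp_eq]
  simp only [List.getD_eq_getElem?_getD]
  constructor
  · rw [List.getElem?_append_left (by simp only [List.length_append, h1, h3]; simp),
      List.getElem?_append_right (by simp only [List.length_append, h1]; simp)]
    simp only [List.length_append, h1, List.length_cons, List.length_nil]
    rw [show 3 + 2 * n + 2 * (i : ℕ) - (0 + 1 + 1 + 1 + 2 * n) = 2 * i by omega, h2.1]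
    simp
  · rw [List.getElem?_append_left (by simp only [List.length_append, h1, h3]; simp; omega),
      List.getElem?_append_right (by simp only [List.length_append, h1]; simp; omega)]
    simp only [List.length_append, h1, List.length_cons, List.length_nil]
    rw [show 3 + 2 * n + 2 * (i : ℕ) + 1 - (0 + 1 + 1 + 1 + 2 * n) = 2 * i + 1 by omega, h2.2]
    simp

theorem getD_set {i : ℕ} (hi : i < fs.length) :
    inp.getD (3 + 2 * n + 2 * es.length + i) 0 = setCode fs[i] := by
  have h1 := length_flatMap_pair (fun v => if v ∈ G.pos 0 then 0 else 1)
    (fun v => if v ∈ G.W then 1 else 0) (List.finRange n)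
  have h3 := length_flatMap_pair (fun e : Fin n × Fin n => (e.1 : ℕ)) (fun e => (e.2 : ℕ)) es
  rw [List.length_finRange] at h1
  rw [h.inp_eq]
  simp only [List.getD_eq_getElem?_getD]
  rw [List.getElem?_append_right (by simp only [List.length_append, h1, h3]; simp)]
  simp only [List.length_append, h1, h3, List.length_cons, List.length_nil]
  rw [show 3 + 2 * n + 2 * es.length + i - (0 + 1 + 1 + 1 + 2 * n + 2 * es.length) = i by omega]
  simp [hi]

omit h in
theorem lt_pow : n < 2 ^ n := Nat.lt_two_pow_self

theorem length_es : es.length = G.E.card := by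
  rw [← List.toFinset_card_of_nodup h.es_nodup]
  congr 1
  ext e
  rw [List.mem_toFinset, h.mem_es]

theorem length_es_le : es.length ≤ n * n := by
  rw [h.length_es]
  refine (Finset.card_le_univ _).trans ?_
  simp

/-- Every position has an outgoing edge. This lets the time bound absorb all terms linear in `n`. -/
theorem le_length_es : n ≤ es.length := by
  rw [h.length_es]
  choose f hf using G.exists_out
  refine (le_of_eq (by simp)).trans (Finset.card_le_card_of_injOn (s := (Finset.univ : Finset (Fin n)))
    (fun v => (v, f v)) (fun v _ => hf v) fun v _ w _ e => congrArg Prod.fst e)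

theorem length_fs_le : fs.length ≤ 2 ^ n := by
  rw [← List.toFinset_card_of_nodup h.fs_nodup]
  refine (Finset.card_le_univ _).trans ?_
  simp

/-- Bounds for linear arithmetic. -/
theorem bounds : 0 < n ∧ n < 2 ^ n ∧ n ≤ n * n ∧ n * n ≤ 2 * 2 ^ n ∧ es.length ≤ n * n ∧
    fs.length ≤ 2 ^ n ∧ inp.length = 3 + 2 * n + 2 * es.length + fs.length :=
  ⟨h.pos, lt_pow, Nat.le_mul_self n, sq_le_two_pow n, h.length_es_le, h.length_fs_le,
    h.length_eq⟩

end Input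

/-- The edges of a list are linked, starting at position `j`; an edge with index `e` is denoted
by `e + 1`, and `0` is the end of the list. -/
def Linked {m : ℕ} (f : ℕ → ℕ) : ℕ → List (Fin m) → Prop
  | j, [] => j = 0
  | j, e :: L => j = e + 1 ∧ Linked f (f e) L

theorem Linked.congr {m : ℕ} {f g : ℕ → ℕ} {L : List (Fin m)} :
    ∀ {j : ℕ}, Linked f j L → (∀ e ∈ L, f e = g e) → Linked g j L := by
  induction L with
  | nil => exact fun h _ => h
  | cons e L ih =>
    intro j h hfg
    refine ⟨h.1, ?_⟩
    rw [← hfg e (by simp)]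
    exact ih h.2 fun e' he' => hfg e' (by simp [he'])

section

variable {wit : Bool} {n : ℕ} {G : McNaughtonGame (Fin n)} {es : List (Fin n × Fin n)}
  {fs : List (Finset (Fin n))} {inp : List ℕ}

@[simp] theorem limits_top : (limits wit n inp).top = 64 * 2 ^ n := rfl
@[simp] theorem limits_size : (limits wit n inp).size = 2 * 2 ^ n := rfl
@[simp] theorem limits_len : (limits wit n inp).len = inp.length := rfl

theorem limits_acap (j i : ℕ) : (limits wit n inp).acap j i = if j = 7 then 1 else
    if j = 8 then (if wit then n else 1) else if i < n * n then 64 * 2 ^ n else 0 := rfl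

theorem wp_readPositions (h : Input G es fs inp) {s : State} (hn : s.v .n = n)
    (hp : s.v .p = 3) (hi : s.inp = fun i => inp.getD i 0) :
    WP (limits wit n inp) readPositions (fun s' => s'.v .p = 3 + 2 * n ∧
      (∀ v : Fin n, s'.a .own v = if v ∈ G.pos 0 then 0 else 1) ∧
      (∀ v : Fin n, s'.a .inW v = if v ∈ G.W then 1 else 0) ∧ s'.clk ≤ s.clk + 7 * n + 2) s := by
  obtain ⟨b1, b2, b3, b4, b5, b6, b7⟩ := h.bounds
  rw [readPositions, wp_seq, wp_set]
  refine ⟨by simp, ?_⟩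
  refine WP.loop (k := n) (fun k s' => s'.v .i + k = n ∧ s'.v .p = 3 + 2 * s'.v .i ∧
    (∀ v : Fin n, v < s'.v .i → s'.a .own v = if v ∈ G.pos 0 then 0 else 1) ∧
    (∀ v : Fin n, v < s'.v .i → s'.a .inW v = if v ∈ G.W then 1 else 0) ∧
    s'.clk ≤ s.clk + 7 * s'.v .i + 1) ?_ ?_ ?_
  · simp [hp]
  · rintro k s' ⟨e1, e2, e3, e4, e5⟩ hs hlt
    have en : s'.v .n = n := by rw [hs.v .n rfl]; simp [hn]
    have ei : s'.inp = fun i => inp.getD i 0 := by rw [hs.inp rfl]; simp [hi]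
    simp [en] at hlt
    obtain ⟨g1, g2⟩ := h.getD_pos ⟨s'.v .i, hlt⟩
    simp only at g1 g2
    have c1 : (if ⟨s'.v .i, hlt⟩ ∈ G.pos 0 then 0 else 1) ≤ 1 := by split_ifs <;> omega
    have c2 : (if ⟨s'.v .i, hlt⟩ ∈ G.W then 1 else 0) ≤ 1 := by split_ifs <;> omega
    have c3 : s'.v .i < n * n := by omega
    simp [wp_seq, wp_set, wp_put, wp_inp, ei, e2, g1, g2, -List.getD_eq_getElem?_getD, limits_acap,
      Arr.idx, c3]
    refine ⟨⟨by omega, by omega⟩, ⟨by omega, by omega⟩, ⟨by omega, by omega⟩,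
      ⟨by omega, by omega⟩, by omega, by omega, k - 1, by omega, by omega, by omega, ?_, ?_,
      by omega⟩
    · intro v hv
      by_cases h1 : (v : ℕ) = s'.v .i
      · have h2 : v = ⟨s'.v .i, hlt⟩ := Fin.ext h1
        rw [if_pos h1, h2]
      · rw [if_neg h1, e3 v (by omega)]
    · intro v hv
      by_cases h1 : (v : ℕ) = s'.v .i
      · have h2 : v = ⟨s'.v .i, hlt⟩ := Fin.ext h1
        rw [if_pos h1, h2]
      · rw [if_neg h1, e4 v (by omega)]
  · rintro k s' ⟨e1, e2, e3, e4, e5⟩ hs hle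
    have en : s'.v .n = n := by rw [hs.v .n rfl]; simp [hn]
    simp [en] at hle
    simp only [State.tick_v, State.tick_a, State.tick_clk]
    exact ⟨by omega, fun v => e3 v (by omega), fun v => e4 v (by omega), by omega⟩

/-- The invariant states that each list links precisely the edges read so far with the given target.
A new edge `i` becomes the head of its list, stored as `i + 1`, and its link is the old head;
entries of `nxt` for older edges are not touched. -/
theorem wp_readEdges (h : Input G es fs inp) {s : State} (hm : s.v .m = es.length)
    (hp : s.v .p = 3 + 2 * n) (hi : s.inp = fun i => inp.getD i 0) (hh : ∀ i, s.a .head i = 0) :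
    WP (limits wit n inp) readEdges (fun s' => s'.v .p = 3 + 2 * n + 2 * es.length ∧
      (∀ e : Fin es.length, s'.a .src e = es[e].1 ∧ s'.a .tgt e = es[e].2) ∧
      (∀ v : Fin n, ∃ L : List (Fin es.length), Linked (s'.a .nxt) (s'.a .head v) L ∧ L.Nodup ∧
        ∀ e, e ∈ L ↔ es[e].2 = v) ∧ s'.clk ≤ s.clk + 9 * es.length + 2) s := by
  obtain ⟨b1, b2, b3, b4, b5, b6, b7⟩ := h.bounds
  rw [readEdges, wp_seq, wp_set]
  refine ⟨by simp, ?_⟩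
  refine WP.loop (k := es.length) (fun k s' => s'.v .i + k = es.length ∧
    s'.v .p = 3 + 2 * n + 2 * s'.v .i ∧
    (∀ e : Fin es.length, e < s'.v .i → s'.a .src e = es[e].1 ∧ s'.a .tgt e = es[e].2) ∧
    (∀ v : Fin n, ∃ L : List (Fin es.length), Linked (s'.a .nxt) (s'.a .head v) L ∧ L.Nodup ∧
      ∀ e, e ∈ L ↔ (e : ℕ) < s'.v .i ∧ es[e].2 = v) ∧
    s'.clk ≤ s.clk + 9 * s'.v .i + 1) ?_ ?_ ?_
  · simp [hp, hh]
    exact fun v => ⟨[], rfl, List.nodup_nil, by simp⟩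
  · rintro k s' ⟨e1, e2, e3, e4, e5⟩ hs hlt
    have en : s'.v .m = es.length := by rw [hs.v .m rfl]; simp [hm]
    have ei : s'.inp = fun i => inp.getD i 0 := by rw [hs.inp rfl]; simp [hi]
    simp [en] at hlt
    obtain ⟨g1, g2⟩ := h.getD_edge ⟨s'.v .i, hlt⟩
    simp only [Fin.getElem_fin] at g1 g2
    have c1 := es[s'.v .i].1.2
    have c2 := es[s'.v .i].2.2
    have c3 : s'.v .i < n * n := by omega
    have c4 : (es[s'.v .i].2 : ℕ) < n * n := by omega
    have c5 : s'.a .head es[s'.v .i].2 ≤ es.length := by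
      obtain ⟨L, h1, -, -⟩ := e4 es[s'.v .i].2
      match L with
      | [] => rw [show s'.a .head _ = 0 from h1]; omega
      | e :: L => rw [h1.1]; omega
    simp [wp_seq, wp_set, wp_put, wp_inp, ei, e2, g1, g2, -List.getD_eq_getElem?_getD, limits_acap,
      Arr.idx, c3, c4]
    refine ⟨⟨by omega, by omega⟩, ⟨by omega, by omega⟩, ⟨by omega, by omega⟩,
      ⟨by omega, by omega⟩, ⟨by omega, by omega⟩, ⟨by omega, by omega⟩, by omega, by omega, k - 1,
      by omega, by omega, by omega, ?_, ?_, by omega⟩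
    · intro e he
      by_cases h1 : (e : ℕ) = s'.v .i
      · simp [h1]
      · simp only [if_neg h1]
        exact e3 e (by omega)
    · intro v
      obtain ⟨L, h1, h2, h3⟩ := e4 v
      have hL : ∀ e ∈ L, s'.a .nxt e =
          if (e : ℕ) = s'.v .i then s'.a .head es[s'.v .i].2 else s'.a .nxt e := by
        intro e he
        rw [if_neg (by have := ((h3 e).1 he).1; omega)]
      by_cases hv : es[s'.v .i].2 = v
      · subst hv
        refine ⟨⟨s'.v .i, hlt⟩ :: L, ⟨by simp, ?_⟩, ?_, ?_⟩
        · have h4 := h1.congr (g := fun i => if i = s'.v .i then s'.a .head es[s'.v .i].2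
            else s'.a .nxt i) hL
          convert h4 using 1
          · funext i
            simp
          · simp
        · rw [List.nodup_cons]
          exact ⟨fun hm => by have := ((h3 _).1 hm).1; simp at this, h2⟩
        · intro e
          rw [List.mem_cons, h3, Fin.ext_iff]
          constructor
          · rintro (h | h)
            · exact ⟨h.le, by simp [h]⟩
            · exact ⟨h.1.le, h.2⟩
          · rintro ⟨h, h'⟩
            rcases h.lt_or_eq with h | h
            · exact .inr ⟨h, h'⟩
            · exact .inl h
      · refine ⟨L, ?_, h2, ?_⟩
        · rw [if_neg (fun e => hv (Fin.ext e.symm))]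
          exact h1.congr fun e he => hL e he
        · intro e
          rw [h3]
          refine ⟨fun h => ⟨h.1.le, h.2⟩, fun ⟨h, h'⟩ => ⟨lt_of_le_of_ne h fun e' => hv ?_, h'⟩⟩
          simp only [← e']
          exact h'
  · rintro k s' ⟨e1, e2, e3, e4, e5⟩ hs hle
    have en : s'.v .m = es.length := by rw [hs.v .m rfl]; simp [hm]
    simp [en] at hle
    simp only [State.tick_v, State.tick_a, State.tick_clk]
    refine ⟨by omega, fun e => e3 e (by omega), fun v => ?_, by omega⟩
    obtain ⟨L, h1, h2, h3⟩ := e4 v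
    exact ⟨L, h1, h2, fun e => by rw [h3]; exact ⟨fun h => h.2, fun h => ⟨by omega, h⟩⟩⟩

theorem wp_powers (h : Input G es fs inp) {s : State} (hn : s.v .n = n) :
    WP (limits wit n inp) powers (fun s' => s'.v .full = 2 ^ n ∧
      (∀ v : Fin n, s'.a .pow v = 2 ^ (v : ℕ)) ∧ s'.clk ≤ s.clk + 4 * n + 3) s := by
  obtain ⟨b1, b2, b3, b4, b5, b6, b7⟩ := h.bounds
  rw [powers, wp_seq, wp_set]
  refine ⟨by simp; omega, ?_⟩
  rw [wp_seq, wp_set]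
  refine ⟨by simp, ?_⟩
  refine WP.loop (k := n) (fun k s' => s'.v .i + k = n ∧ s'.v .full = 2 ^ s'.v .i ∧
    (∀ v : Fin n, v < s'.v .i → s'.a .pow v = 2 ^ (v : ℕ)) ∧
    s'.clk ≤ s.clk + 4 * s'.v .i + 2) ?_ ?_ ?_
  · simp
  · rintro k s' ⟨e1, e2, e3, e5⟩ hs hlt
    have en : s'.v .n = n := by rw [hs.v .n rfl]; simp [hn]
    simp [en] at hlt
    have c3 : s'.v .i < n * n := by omega
    have c4 : 2 ^ s'.v .i ≤ 2 ^ n := Nat.pow_le_pow_right (by omega) hlt.le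
    simp [wp_seq, wp_set, wp_put, e2, limits_acap, Arr.idx, c3]
    refine ⟨⟨by omega, by omega⟩, by omega, by omega, k - 1, by omega, by omega,
      by rw [pow_succ]; omega, ?_, by omega⟩
    intro v hv
    split_ifs with h1
    · rw [h1]
    · exact e3 v (by omega)
  · rintro k s' ⟨e1, e2, e3, e5⟩ hs hle
    have en : s'.v .n = n := by rw [hs.v .n rfl]; simp [hn]
    simp [en] at hle
    simp only [State.tick_v, State.tick_a, State.tick_clk]
    refine ⟨?_, fun v => e3 v (by omega), by omega⟩
    rw [e2, show s'.v .i = n by omega]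

theorem wp_readSets (h : Input G es fs inp) {s : State} (hk : s.v .k = fs.length)
    (hp : s.v .p = 3 + 2 * n + 2 * es.length) (hi : s.inp = fun i => inp.getD i 0)
    (hf : ∀ i, s.a .fl i = 0) :
    WP (limits wit n inp) readSets (fun s' =>
      (∀ Z : Finset (Fin n), s'.a .fl (setCode Z) = if Z ∈ G.F 0 then 1 else 0) ∧
      s'.clk ≤ s.clk + 5 * fs.length + 2) s := by
  obtain ⟨b1, b2, b3, b4, b5, b6, b7⟩ := h.bounds
  rw [readSets, wp_seq, wp_set]
  refine ⟨by simp, ?_⟩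
  refine WP.loop (k := fs.length) (fun k s' => s'.v .i + k = fs.length ∧
    s'.v .p = 3 + 2 * n + 2 * es.length + s'.v .i ∧
    (∀ Z : Finset (Fin n), s'.a .fl (setCode Z) = if Z ∈ fs.take (s'.v .i) then 1 else 0) ∧
    s'.clk ≤ s.clk + 5 * s'.v .i + 1) ?_ ?_ ?_
  · simp [hp, hf]
  · rintro k s' ⟨e1, e2, e3, e5⟩ hs hlt
    have en : s'.v .k = fs.length := by rw [hs.v .k rfl]; simp [hk]
    have ei : s'.inp = fun i => inp.getD i 0 := by rw [hs.inp rfl]; simp [hi]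
    simp [en] at hlt
    have g1 := h.getD_set hlt
    have c1 := setCode_lt fs[s'.v .i]
    simp [wp_seq, wp_set, wp_put, wp_inp, ei, e2, g1, -List.getD_eq_getElem?_getD, limits_acap,
      Arr.idx]
    refine ⟨⟨by omega, by omega⟩, by omega, by omega, by omega, k - 1, by omega, by omega,
      by omega, ?_, by omega⟩
    intro Z
    rw [List.take_add_one, List.getElem?_eq_getElem hlt]
    simp only [List.mem_append, Option.toList_some, List.mem_singleton]
    by_cases hZ : Z = fs[s'.v .i]
    · rw [if_pos (by rw [hZ]), if_pos (.inr hZ)]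
    · rw [if_neg (fun e => hZ (setCode_injective e)), e3]
      simp only [hZ, or_false]
  · rintro k s' ⟨e1, e2, e3, e5⟩ hs hle
    have en : s'.v .k = fs.length := by rw [hs.v .k rfl]; simp [hk]
    simp [en] at hle
    simp only [State.tick_a, State.tick_clk]
    refine ⟨fun Z => ?_, by omega⟩
    rw [e3, show s'.v .i = fs.length by omega, List.take_length]
    simp only [h.mem_fs]

end

/-! ## The set under consideration -/

/-- The variables and arrays that describe the game. -/
structure Static {n : ℕ} (G : McNaughtonGame (Fin n)) (es : List (Fin n × Fin n)) (s : State) :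
    Prop where
  vn : s.v .n = n
  vm : s.v .m = es.length
  vfull : s.v .full = 2 ^ n
  own : ∀ v : Fin n, s.a .own v = if v ∈ G.pos 0 then 0 else 1
  inW : ∀ v : Fin n, s.a .inW v = if v ∈ G.W then 1 else 0
  pow : ∀ v : Fin n, s.a .pow v = 2 ^ (v : ℕ)
  src : ∀ e : Fin es.length, s.a .src e = es[e].1
  tgt : ∀ e : Fin es.length, s.a .tgt e = es[e].2
  link : ∀ v : Fin n, ∃ L : List (Fin es.length), Linked (s.a .nxt) (s.a .head v) L ∧ L.Nodup ∧
    ∀ e, e ∈ L ↔ es[e].2 = v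
  fl : ∀ Z : Finset (Fin n), s.a .fl (setCode Z) = if Z ∈ G.F 0 then 1 else 0

/-- Whether a command leaves the description of the game alone. -/
def Cmd.keeps (c : Cmd) : Bool :=
  !(c.wv .n || c.wv .m || c.wv .full || c.wa .own || c.wa .inW || c.wa .pow || c.wa .src ||
    c.wa .tgt || c.wa .nxt || c.wa .head || c.wa .fl)

section

variable {wit : Bool} {n : ℕ} {G : McNaughtonGame (Fin n)} {es : List (Fin n × Fin n)}
  {fs : List (Finset (Fin n))} {inp : List ℕ}

theorem Static.same {c : Cmd} {s s' : State} (h : Static G es s) (hs : Same c s s')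
    (hc : c.keeps = true) : Static G es s' := by
  simp only [Cmd.keeps, Bool.not_eq_true', Bool.or_eq_false_iff] at hc
  obtain ⟨⟨⟨⟨⟨⟨⟨⟨⟨⟨h1, h2⟩, h3⟩, h4⟩, h5⟩, h6⟩, h7⟩, h8⟩, h9⟩, h10⟩, h11⟩ := hc
  constructor
  · rw [hs.v _ h1, h.vn]
  · rw [hs.v _ h2, h.vm]
  · rw [hs.v _ h3, h.vfull]
  · rw [hs.a _ h4]; exact h.own
  · rw [hs.a _ h5]; exact h.inW
  · rw [hs.a _ h6]; exact h.pow
  · rw [hs.a _ h7]; exact h.src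
  · rw [hs.a _ h8]; exact h.tgt
  · rw [hs.a _ h9, hs.a _ h10]; exact h.link
  · rw [hs.a _ h11]; exact h.fl

theorem wp_readInput (h : Input G es fs inp) :
    WP (limits wit n inp) readInput (fun s' => Static G es s' ∧ (∀ i, s'.a .tab i = 0) ∧
      (∀ i, s'.a .res i = 0) ∧ s'.clk ≤ 11 * n + 9 * es.length + 5 * fs.length + 13)
      (.init inp) := by
  obtain ⟨b1, b2, b3, b4, b5, b6, b7⟩ := h.bounds
  have g0 := h.getD_zero
  have g1 := h.getD_one
  have g2 := h.getD_two
  simp only [readInput, wp_seq, wp_inp, wp_set]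
  simp [State.init, g0, g1, g2, -List.getD_eq_getElem?_getD]
  refine ⟨⟨by omega, by omega⟩, ⟨by omega, by omega⟩, ⟨by omega, by omega⟩, by omega, ?_⟩
  set s0 : State := State.setv _ .p 3 with hs0
  have a0 : s0.a = fun _ _ => 0 := rfl
  have i0 : s0.inp = fun i => inp.getD i 0 := rfl
  refine (wp_readPositions h rfl rfl i0).mono fun s1 ⟨p1, own, inW, c1⟩ hs1 => ?_
  have hm1 : s1.v .m = es.length := by rw [hs1.v .m rfl]; rfl
  have i1 : s1.inp = fun i => inp.getD i 0 := by rw [hs1.inp rfl]; rfl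
  have a1 : s1.a .head = fun _ => 0 := by rw [hs1.a .head rfl, a0]
  rw [wp_seq]
  refine (wp_readEdges h hm1 p1 i1 (fun i => by rw [a1])).mono
    fun s2 ⟨p2, st, link, c2⟩ hs2 => ?_
  have hn2 : s2.v .n = n := by rw [hs2.v .n rfl, hs1.v .n rfl]; rfl
  rw [wp_seq]
  refine (wp_powers h hn2).mono fun s3 ⟨full, pow, c3⟩ hs3 => ?_
  have hk3 : s3.v .k = fs.length := by rw [hs3.v .k rfl, hs2.v .k rfl, hs1.v .k rfl]; rfl
  have i3 : s3.inp = fun i => inp.getD i 0 := by rw [hs3.inp rfl, hs2.inp rfl]; exact i1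
  have p3 : s3.v .p = 3 + 2 * n + 2 * es.length := by rw [hs3.v .p rfl]; exact p2
  have f3 : s3.a .fl = fun _ => 0 := by rw [hs3.a .fl rfl, hs2.a .fl rfl, hs1.a .fl rfl, a0]
  refine (wp_readSets h hk3 p3 i3 (fun i => by rw [f3])).mono fun s4 ⟨fl, c4⟩ hs4 => ?_
  refine ⟨⟨?_, ?_, ?_, ?_, ?_, ?_, ?_, ?_, ?_, fl⟩, ?_, ?_, ?_⟩
  · rw [hs4.v _ rfl, hs3.v _ rfl, hn2]
  · rw [hs4.v _ rfl, hs3.v _ rfl, hs2.v _ rfl, hm1]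
  · rw [hs4.v _ rfl, full]
  · rw [hs4.a _ rfl, hs3.a _ rfl, hs2.a _ rfl]; exact own
  · rw [hs4.a _ rfl, hs3.a _ rfl, hs2.a _ rfl]; exact inW
  · rw [hs4.a _ rfl]; exact pow
  · rw [hs4.a _ rfl, hs3.a _ rfl]; exact fun e => (st e).1
  · rw [hs4.a _ rfl, hs3.a _ rfl]; exact fun e => (st e).2
  · rw [hs4.a _ rfl, hs3.a _ rfl, hs4.a _ rfl, hs3.a _ rfl]; exact link
  · rw [hs4.a _ rfl, hs3.a _ rfl, hs2.a _ rfl, hs1.a _ rfl, a0]; exact fun _ => rfl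
  · rw [hs4.a _ rfl, hs3.a _ rfl, hs2.a _ rfl, hs1.a _ rfl, a0]; exact fun _ => rfl
  · have : s0.clk = 4 := rfl
    omega

/-- Digits are extracted from the highest one downwards by comparison and subtraction. After the
digits from `k` on, `y` is the code of the part of `X` below `k`. -/
theorem wp_decode (h : Input G es fs inp) {s : State} (hS : Static G es s) {X : Finset (Fin n)}
    (hx : s.v .x = setCode X) :
    WP (limits wit n inp) decode (fun s' =>
      (∀ v : Fin n, s'.a .inX v = if v ∈ X then 1 else 0) ∧
      (∀ v : Fin n, s'.a .inXW v = if v ∈ X ∧ v ∈ G.W then 1 else 0) ∧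
      (∀ v : Fin n, s'.a .deg v = 0) ∧ s'.v .z = setCode (X ∩ G.W) ∧
      (X.Nonempty → ∃ v ∈ X, s'.v .any = v + 1) ∧ s'.v .any ≤ n ∧
      s'.clk ≤ s.clk + 10 * n + 5) s := by
  obtain ⟨b1, b2, b3, b4, b5, b6, b7⟩ := h.bounds
  have hX := setCode_lt X
  simp only [decode, wp_seq, wp_set]
  simp [hx, hS.vn]
  refine ⟨by omega, by omega, ?_⟩
  refine WP.loop (k := n) (fun k s' => s'.v .i = k ∧ k ≤ n ∧
    s'.v .y = setCode (X.filter (fun v => (v : ℕ) < k)) ∧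
    s'.v .z = setCode ((X ∩ G.W).filter (fun v => k ≤ (v : ℕ))) ∧
    (∀ v : Fin n, k ≤ v → s'.a .inX v = if v ∈ X then 1 else 0) ∧
    (∀ v : Fin n, k ≤ v → s'.a .inXW v = if v ∈ X ∧ v ∈ G.W then 1 else 0) ∧
    (∀ v : Fin n, k ≤ v → s'.a .deg v = 0) ∧
    ((∃ v ∈ X, s'.v .any = v + 1) ∨ s'.v .any = 0 ∧ ∀ v ∈ X, (v : ℕ) < k) ∧
    s'.clk + 10 * k ≤ s.clk + 10 * n + 4) ?_ ?_ ?_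
  · simp only [State.setv_v, State.setv_a, State.setv_clk, reduceCtorEq, if_false, if_true]
    refine ⟨trivial, le_rfl, (setCode_filter_lt_self X).symm, ?_, fun v hv => ?_, fun v hv => ?_,
      fun v hv => ?_, .inr ⟨trivial, fun v _ => v.2⟩, by omega⟩
    · rw [Finset.filter_false_of_mem (fun v _ => by have := v.2; omega)]; rfl
    all_goals have := v.2; omega
  · rintro k s' ⟨e1, e2, e3, e4, e5, e6, e7, e8, e9⟩ hs hlt
    -- The frame is that of the whole command, so that it also covers the assignments made before
    -- the loop.
    have hS' : Static G es s' := Static.same (c := decode) hS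
      ⟨fun x hx => ?_, fun b hb => ?_, fun _ => ?_⟩ rfl
    rotate_left
    · rw [hs.v x (by revert hx; cases x <;> decide)]
      simp only [State.setv_v]
      cases x <;> first | rfl | (exfalso; revert hx; decide)
    · rw [hs.a b (by revert hb; cases b <;> decide)]; rfl
    · rw [hs.inp rfl]; rfl
    simp [e1] at hlt
    obtain ⟨k, rfl⟩ : ∃ k', k = k' + 1 := ⟨k - 1, by omega⟩
    have hk : k < n := by omega
    have c1 : k < n * n := by omega
    have hpow : s'.a .pow k = 2 ^ k := hS'.pow ⟨k, hk⟩
    have hinW : s'.a .inW k = if ⟨k, hk⟩ ∈ G.W then 1 else 0 := hS'.inW ⟨k, hk⟩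
    have c3 : 2 ^ k < 2 ^ n := Nat.pow_lt_pow_right (by omega) hk
    have f1 := setCode_filter_lt_succ X hk
    have f2 := setCode_filter_lt_lt X hk.le
    have f3 := setCode_filter_ge (X ∩ G.W) hk
    have f4 := setCode_lt ((X ∩ G.W).filter (fun v => k ≤ (v : ℕ)))
    have step : ∀ {P : Fin n → Prop}, P ⟨k, hk⟩ →
        (∀ v : Fin n, k + 1 ≤ v → (v : ℕ) ≠ k → P v) → ∀ v : Fin n, k ≤ v → P v := by
      intro P h1 h2 v hv
      by_cases hvk : (v : ℕ) = k
      · rwa [show v = ⟨k, hk⟩ from Fin.ext hvk]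
      · exact h2 v (by omega) hvk
    rw [if_congr (Finset.mem_inter) rfl rfl] at f3
    rw [f1] at e3
    by_cases hv : (⟨k, hk⟩ : Fin n) ∈ X
    · rw [if_pos hv] at e3
      have c2 : 2 ^ k ≤ s'.v .y := by omega
      have c2' : s'.v .y + 1 - 2 ^ k ≠ 0 := by omega
      by_cases hw : (⟨k, hk⟩ : Fin n) ∈ G.W
      · simp only [hv, hw, and_self, if_true] at f3 hinW
        simp [wp_seq, wp_set, wp_put, wp_ite, wp_skip, limits_acap, Arr.idx, e1, hpow, hinW, c1,
          c2, c2']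
        and_intros <;> try omega
        · exact step (by simp [hv]) fun v hv' hne => by rw [if_neg hne, e5 v hv']
        · exact step (by simp [hv, hw]) fun v hv' hne => by rw [if_neg hne, e6 v hv']
        · exact step (fun h => absurd rfl h) fun v hv' _ _ => e7 v hv'
        · exact ⟨_, hv, rfl⟩
      · simp only [hv, hw, and_false, if_false, add_zero] at f3 hinW
        simp [wp_seq, wp_set, wp_put, wp_ite, wp_skip, limits_acap, Arr.idx, e1, hpow, hinW, c1,
          c2, c2']
        and_intros <;> try omega
        · exact step (by simp [hv]) fun v hv' hne => by rw [if_neg hne, e5 v hv']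
        · exact step (by simp [hw]) fun v hv' hne => by rw [if_neg hne, e6 v hv']
        · exact step (fun h => absurd rfl h) fun v hv' _ _ => e7 v hv'
        · exact ⟨_, hv, rfl⟩
    · rw [if_neg hv] at e3
      have c2 : ¬ 2 ^ k ≤ s'.v .y := by omega
      have c2' : s'.v .y + 1 - 2 ^ k = 0 := by omega
      simp only [hv, false_and, if_false, add_zero] at f3
      simp [wp_seq, wp_set, wp_put, wp_ite, wp_skip, limits_acap, Arr.idx, e1, hpow, hinW, c1,
        c2']
      and_intros <;> try omega
      · exact step (by simp [hv]) fun v hv' hne => by rw [if_neg hne, e5 v hv']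
      · exact step (by simp [hv]) fun v hv' hne => by rw [if_neg hne, e6 v hv']
      · exact step (fun h => absurd rfl h) fun v hv' _ _ => e7 v hv'
      · refine e8.imp_right fun h => ⟨h.1, fun v hvX => ?_⟩
        have h1 := h.2 v hvX
        have h2 : (v : ℕ) ≠ k := fun e => hv (by rw [← show v = ⟨k, hk⟩ from Fin.ext e]; exact hvX)
        omega
  · rintro k s' ⟨e1, e2, e3, e4, e5, e6, e7, e8, e9⟩ hs hle
    simp [e1] at hle
    subst hle
    simp only [State.tick_a, State.tick_v, State.tick_clk]
    refine ⟨fun v => e5 v (Nat.zero_le _), fun v => e6 v (Nat.zero_le _),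
      fun v => e7 v (Nat.zero_le _), ?_, ?_, ?_, by omega⟩
    · rw [e4, Finset.filter_true_of_mem fun v _ => Nat.zero_le _]
    · rintro ⟨v, hv⟩
      rcases e8 with h | h
      · exact h
      · exact absurd (h.2 v hv) (by omega)
    · rcases e8 with ⟨v, -, h⟩ | h
      · have := v.2
        omega
      · omega

end

theorem card_filter_lt_succ {m i : ℕ} (h : i < m) (p : Fin m → Prop) [DecidablePred p] :
    (Finset.univ.filter (fun e : Fin m => (e : ℕ) < i + 1 ∧ p e)).card =
      (Finset.univ.filter (fun e : Fin m => (e : ℕ) < i ∧ p e)).card +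
        if p ⟨i, h⟩ then 1 else 0 := by
  split_ifs with hp
  · rw [← Finset.card_insert_of_notMem (a := ⟨i, h⟩) (by simp)]
    congr 1
    ext e
    simp only [Finset.mem_filter, Finset.mem_univ, true_and, Finset.mem_insert, Fin.ext_iff]
    constructor
    · rintro ⟨h1, h2⟩
      rcases Nat.lt_succ_iff_lt_or_eq.1 h1 with h3 | h3
      · exact .inr ⟨h3, h2⟩
      · exact .inl h3
    · rintro (h1 | h1)
      · exact ⟨by omega, by rwa [show e = ⟨i, h⟩ from Fin.ext h1]⟩
      · exact ⟨by omega, h1.2⟩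
  · rw [add_zero]
    congr 1
    ext e
    simp only [Finset.mem_filter, Finset.mem_univ, true_and]
    refine and_congr_left fun h2 => ⟨fun h1 => lt_of_le_of_ne (by omega) fun h3 => hp ?_,
      fun h1 => by omega⟩
    rwa [show (⟨i, h⟩ : Fin m) = e from Fin.ext h3.symm]

/-- The number of edges from `v` to a position in `X`. -/
def outDegree {n : ℕ} (es : List (Fin n × Fin n)) (X : Finset (Fin n)) (v : Fin n) : ℕ :=
  (Finset.univ.filter (fun e : Fin es.length => es[e].1 = v ∧ es[e].2 ∈ X)).card

section

variable {wit : Bool} {n : ℕ} {G : McNaughtonGame (Fin n)} {es : List (Fin n × Fin n)}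
  {fs : List (Finset (Fin n))} {inp : List ℕ}

theorem outDegree_le (X : Finset (Fin n)) (v : Fin n) : outDegree es X v ≤ es.length :=
  (Finset.card_le_univ _).trans (by simp)

theorem wp_degrees (h : Input G es fs inp) {s : State} (hS : Static G es s) {X : Finset (Fin n)}
    (hX : ∀ v : Fin n, s.a .inX v = if v ∈ X then 1 else 0) (hd : ∀ v : Fin n, s.a .deg v = 0) :
    WP (limits wit n inp) degrees (fun s' =>
      (∀ v : Fin n, s'.a .deg v = outDegree es X v) ∧
      (s'.v .bad = 0 ↔
        ∀ e : Fin es.length, es[e].1 ∈ X → es[e].1 ∉ G.pos 0 → es[e].2 ∈ X) ∧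
      s'.v .bad ≤ 1 ∧ s'.clk ≤ s.clk + 5 * es.length + 3) s := by
  obtain ⟨b1, b2, b3, b4, b5, b6, b7⟩ := h.bounds
  rw [degrees, wp_seq, wp_set]
  refine ⟨by simp, ?_⟩
  rw [wp_seq, wp_set]
  refine ⟨by simp, ?_⟩
  refine WP.loop (k := es.length) (fun k s' => s'.v .i + k = es.length ∧
    (∀ v : Fin n, s'.a .deg v = (Finset.univ.filter (fun e : Fin es.length =>
      (e : ℕ) < s'.v .i ∧ es[e].1 = v ∧ es[e].2 ∈ X)).card) ∧
    (s'.v .bad = 0 ↔ ∀ e : Fin es.length, (e : ℕ) < s'.v .i →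
      es[e].1 ∈ X → es[e].1 ∉ G.pos 0 → es[e].2 ∈ X) ∧
    s'.v .bad ≤ 1 ∧ s'.clk ≤ s.clk + 5 * s'.v .i + 2) ?_ ?_ ?_
  · simp [hd]
  · rintro k s' ⟨e1, e2, e3, e4, e5⟩ hs hlt
    have hS' : Static G es s' := Static.same (c := degrees) hS
      ⟨fun x hx => ?_, fun b hb => ?_, fun _ => ?_⟩ rfl
    rotate_left
    · rw [hs.v x (by revert hx; cases x <;> decide)]
      simp only [State.setv_v]
      cases x <;> first | rfl | (exfalso; revert hx; decide)
    · rw [hs.a b (by revert hb; cases b <;> decide)]; rfl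
    · rw [hs.inp rfl]; rfl
    have hX' : s'.a .inX = s.a .inX := by rw [hs.a _ rfl]; rfl
    simp [hS'.vm] at hlt
    have hsrc := hS'.src ⟨s'.v .i, hlt⟩
    have htgt := hS'.tgt ⟨s'.v .i, hlt⟩
    simp only [Fin.getElem_fin] at hsrc htgt
    have c1 := es[s'.v .i].1.2
    have c2 := es[s'.v .i].2.2
    have c4 : (es[s'.v .i].1 : ℕ) < n * n := by omega
    have hstep := fun v => card_filter_lt_succ hlt
      (fun e : Fin es.length => es[e].1 = v ∧ es[e].2 ∈ X)
    have hadv : ∀ {P : Fin es.length → Prop}, (∀ e : Fin es.length, (e : ℕ) ≤ s'.v .i → P e) ↔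
        P ⟨s'.v .i, hlt⟩ ∧ ∀ e : Fin es.length, (e : ℕ) < s'.v .i → P e := by
      intro P
      refine ⟨fun h => ⟨h _ le_rfl, fun e he => h e he.le⟩, fun h e he => ?_⟩
      rcases he.lt_or_eq with he | he
      · exact h.2 e he
      · rw [show e = ⟨s'.v .i, hlt⟩ from Fin.ext he]
        exact h.1
    have hsrc' := hX es[s'.v .i].1
    have htgt' := hX es[s'.v .i].2
    have hown := hS'.own es[s'.v .i].1
    have hdeg := e2 es[s'.v .i].1
    have hle : (Finset.univ.filter (fun e : Fin es.length =>
        (e : ℕ) < s'.v .i ∧ es[e].1 = es[s'.v .i].1 ∧ es[e].2 ∈ X)).card ≤ es.length :=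
      (Finset.card_le_univ _).trans (by simp)
    by_cases hu : es[s'.v .i].2 ∈ X
    · rw [if_pos hu] at htgt'
      simp [wp_seq, wp_set, wp_put, wp_ite, wp_skip, hsrc, htgt, hX', htgt', c4, limits_acap,
        Arr.idx]
      refine ⟨⟨by omega, by omega⟩, by omega, k - 1, by omega, by omega, ?_, ?_, e4, by omega⟩
      · intro v
        have h1 := hstep v
        simp only [Fin.getElem_fin, hu, and_true] at h1
        simp only [← Nat.lt_succ_iff]
        refine Eq.trans ?_ h1.symm
        by_cases hv : es[s'.v .i].1 = v
        · subst hv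
          rw [if_pos rfl, if_pos rfl, hdeg]
          rfl
        · rw [if_neg (fun e => hv (Fin.ext e.symm)), if_neg hv, e2 v]
          rfl
      · rw [hadv, e3]
        simp [hu]
    · rw [if_neg hu] at htgt'
      have hdeg' : ∀ v : Fin n, s'.a .deg v = (Finset.univ.filter (fun e : Fin es.length =>
          (e : ℕ) ≤ s'.v .i ∧ es[e].1 = v ∧ es[e].2 ∈ X)).card := by
        intro v
        have h1 := hstep v
        simp only [Fin.getElem_fin, hu, and_false, if_false, add_zero] at h1
        simp only [← Nat.lt_succ_iff]
        rw [e2 v]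
        exact h1.symm
      by_cases hv : es[s'.v .i].1 ∈ X ∧ es[s'.v .i].1 ∉ G.pos 0
      · rw [if_pos hv.1] at hsrc'
        rw [if_neg hv.2] at hown
        simp [wp_seq, wp_set, wp_put, wp_ite, wp_skip, hsrc, htgt, hX', htgt', hsrc', hown]
        refine ⟨by omega, by omega, k - 1, by omega, by omega, fun v => hdeg' v, ?_, by omega⟩
        exact ⟨⟨s'.v .i, hlt⟩, le_rfl, hv.1, hv.2, hu⟩
      · have hz : s.a .inX es[s'.v .i].1 + s'.a .own es[s'.v .i].1 - 1 = 0 := by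
          rw [hsrc', hown]
          by_cases h1 : es[s'.v .i].1 ∈ X
          · rw [if_pos h1, if_pos (by tauto)]
          · rw [if_neg h1]
            split_ifs <;> rfl
        simp [wp_seq, wp_set, wp_put, wp_ite, wp_skip, hsrc, htgt, hX', htgt']
        refine ⟨fun hc => by omega, fun _ => ⟨by omega, k - 1, by omega, by omega,
          fun v => hdeg' v, ?_, e4, by omega⟩⟩
        rw [hadv, e3]
        exact ⟨fun h1 => ⟨fun h2 h3 => absurd ⟨h2, h3⟩ hv, h1⟩, fun h1 => h1.2⟩
  · rintro k s' ⟨e1, e2, e3, e4, e5⟩ hs hle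
    have en : s'.v .m = es.length := by rw [hs.v .m rfl]; simp [hS.vm]
    simp [en] at hle
    simp only [State.tick_v, State.tick_a, State.tick_clk]
    refine ⟨fun v => ?_, ?_, e4, by omega⟩
    · rw [e2, outDegree]
      congr 1
      refine Finset.filter_congr fun e _ => ?_
      exact ⟨fun h => h.2, fun h => ⟨by omega, h⟩⟩
    · rw [e3]
      exact ⟨fun h1 e => h1 e (by omega), fun h1 e _ => h1 e⟩

end

/-! ## Attractors -/

/-- The list describes the content of a stack, from top to bottom. -/
def Stacked {n : ℕ} (f : ℕ → ℕ) : List (Fin n) → Prop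
  | [] => True
  | v :: S => f S.length = v ∧ Stacked f S

theorem Stacked.congr {n : ℕ} {f g : ℕ → ℕ} {S : List (Fin n)} (h : Stacked f S)
    (hfg : ∀ i < S.length, g i = f i) : Stacked g S := by
  induction S with
  | nil => trivial
  | cons v S ih =>
    exact ⟨(hfg _ (Nat.lt_succ_self _)).trans h.1,
      ih h.2 fun i hi => hfg i (Nat.lt_succ_of_lt hi)⟩

section

variable {wit : Bool} {n : ℕ} {G : McNaughtonGame (Fin n)} {es : List (Fin n × Fin n)}
  {fs : List (Finset (Fin n))} {inp : List ℕ}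

/-- The invariant of the computation of the attractor of `w`: the positions of `R` have not been
attracted yet, the edges of `D` have been processed, all edges to the positions on the stack `S`
and the edges of the list `L` wait for being processed, and `cnt` contains the counters. -/
structure AttrInv (G : McNaughtonGame (Fin n)) (es : List (Fin n × Fin n)) (σ : Fin 2)
    (X : Finset (Fin n)) (w : Fin n) (R : Finset (Fin n)) (D : Finset (Fin es.length))
    (S : List (Fin n)) (L : List (Fin es.length)) (cnt : ℕ → ℕ) : Prop where
  sub : R ⊆ X
  notMem : w ∉ R
  attr : ∀ v ∈ X, v ∉ R → v ∈ G.attr σ X w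
  stack : ∀ v ∈ S, v ∈ X ∧ v ∉ R
  nodup : S.Nodup
  cover : ∀ e : Fin es.length, es[e].2 ∈ X → es[e].2 ∉ R → es[e].2 ∈ S ∨ e ∈ D ∨ e ∈ L
  done : ∀ e ∈ D, es[e].2 ∈ X ∧ es[e].2 ∉ R ∧ es[e].2 ∉ S ∧ e ∉ L
  list : ∀ e ∈ L, es[e].2 ∈ X ∧ es[e].2 ∉ R ∧ es[e].2 ∉ S
  list_nodup : L.Nodup
  own : ∀ u ∈ R, u ∈ G.pos σ → cnt u = 1 ∧ ∀ e ∈ D, es[e].1 ≠ u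
  opp : ∀ u ∈ R, u ∉ G.pos σ → cnt u = (Finset.univ.filter (fun e : Fin es.length =>
    (es[e].1 = u ∧ es[e].2 ∈ X) ∧ e ∉ D)).card ∧ (0 < outDegree es X u → 0 < cnt u)
  out : ∀ u : Fin n, u ∉ R → cnt u = 0

namespace AttrInv

variable {σ : Fin 2} {X R : Finset (Fin n)} {w : Fin n} {D : Finset (Fin es.length)}
  {S : List (Fin n)} {L : List (Fin es.length)} {cnt : ℕ → ℕ} {e : Fin es.length}

theorem init (hw : w ∈ X) (hc : ∀ u : Fin n, cnt u =
      if u = w then 0 else if u ∈ X then if u ∈ G.pos σ then 1 else outDegree es X u else 0) :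
    AttrInv G es σ X w (X.erase w) ∅ [w] [] cnt where
  sub := Finset.erase_subset _ _
  notMem := Finset.notMem_erase _ _
  attr v hv h := by
    have : v = w := by by_contra hne; exact h (Finset.mem_erase.2 ⟨hne, hv⟩)
    exact this ▸ mem_attr_self
  stack v hv := by
    rw [List.mem_singleton] at hv
    exact ⟨hv ▸ hw, hv ▸ Finset.notMem_erase _ _⟩
  nodup := List.nodup_singleton _
  cover e h h' := by
    refine .inl (List.mem_singleton.2 ?_)
    by_contra hne
    exact h' (Finset.mem_erase.2 ⟨hne, h⟩)
  done e he := absurd he (Finset.notMem_empty _)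
  list e he := absurd he List.not_mem_nil
  list_nodup := List.nodup_nil
  own u hu hp := by
    rw [Finset.mem_erase] at hu
    exact ⟨by rw [hc, if_neg hu.1, if_pos hu.2, if_pos hp], fun e he => by simp at he⟩
  opp u hu hp := by
    rw [Finset.mem_erase] at hu
    rw [hc, if_neg hu.1, if_pos hu.2, if_neg hp]
    refine ⟨?_, id⟩
    simp [outDegree]
  out u hu := by
    rw [hc]
    by_cases h : u = w
    · rw [if_pos h]
    · rw [if_neg h, if_neg fun h' => hu (Finset.mem_erase.2 ⟨h, h'⟩)]

theorem pop {t : Fin n} (h : AttrInv G es σ X w R D (t :: S) [] cnt) (hL : L.Nodup)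
    (hL' : ∀ e, e ∈ L ↔ es[e].2 = t) : AttrInv G es σ X w R D S L cnt where
  sub := h.sub
  notMem := h.notMem
  attr := h.attr
  stack v hv := h.stack v (List.mem_cons_of_mem _ hv)
  nodup := (List.nodup_cons.1 h.nodup).2
  cover e h1 h2 := by
    rcases h.cover e h1 h2 with h3 | h3 | h3
    · rcases List.mem_cons.1 h3 with h4 | h4
      · exact .inr (.inr ((hL' e).2 h4))
      · exact .inl h4
    · exact .inr (.inl h3)
    · exact absurd h3 List.not_mem_nil
  done e he := by
    obtain ⟨h1, h2, h3, -⟩ := h.done e he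
    rw [List.mem_cons, not_or] at h3
    exact ⟨h1, h2, h3.2, fun h4 => h3.1 ((hL' e).1 h4)⟩
  list e he := by
    have h1 := h.stack t List.mem_cons_self
    rw [(hL' e).1 he]
    exact ⟨h1.1, h1.2, (List.nodup_cons.1 h.nodup).1⟩
  list_nodup := hL
  own := h.own
  opp := h.opp
  out := h.out

/-- The head of the list is an unprocessed edge into `X`, so processing it lowers the number of
waiting edges of its source by one and affects no other source. -/
theorem card_erase (h : AttrInv G es σ X w R D S (e :: L) cnt) (u : Fin n) :
    (Finset.univ.filter (fun e' : Fin es.length =>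
      (es[e'].1 = u ∧ es[e'].2 ∈ X) ∧ e' ∉ D)).card =
    (Finset.univ.filter (fun e' : Fin es.length =>
      (es[e'].1 = u ∧ es[e'].2 ∈ X) ∧ e' ∉ insert e D)).card + if es[e].1 = u then 1 else 0 := by
  have h1 : e ∉ D := fun he => (h.done e he).2.2.2 List.mem_cons_self
  have h2 := (h.list e List.mem_cons_self).1
  split_ifs with hu
  · rw [← Finset.card_insert_of_notMem (a := e) (by simp)]
    congr 1
    ext e'
    simp only [Finset.mem_filter, Finset.mem_univ, true_and, Finset.mem_insert, not_or]
    by_cases he : e' = e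
    · subst he
      simpa [h1] using ⟨hu, h2⟩
    · simp [he]
  · rw [add_zero]
    congr 1
    ext e'
    simp only [Finset.mem_filter, Finset.mem_univ, true_and, Finset.mem_insert, not_or]
    by_cases he : e' = e
    · subst he
      exact ⟨fun h3 => absurd h3.1.1 hu, fun h3 => absurd h3.1.1 hu⟩
    · simp [he]

theorem mem_of_cnt (h : AttrInv G es σ X w R D S L cnt) {u : Fin n} (hu : 0 < cnt u) : u ∈ R := by
  by_contra hR
  rw [h.out u hR] at hu
  exact lt_irrefl 0 hu

/-- The edge at hand has not been processed. If its source were still in `R`, its counter would be 1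
or would count this very edge, so it could not be zero. -/
theorem notMem_of_cnt (h : AttrInv G es σ X w R D S (e :: L) cnt) (hc : cnt es[e].1 = 0) :
    es[e].1 ∉ R := by
  intro hR
  by_cases hp : es[e].1 ∈ G.pos σ
  · have := (h.own _ hR hp).1
    omega
  · have h1 := (h.opp _ hR hp).1
    have h2 := h.card_erase es[e].1
    rw [if_pos rfl] at h2
    omega

/-- Process an edge without attracting its source. -/
theorem step (h : AttrInv G es σ X w R D S (e :: L) cnt) {cnt' : ℕ → ℕ}
    (hR : es[e].1 ∈ R → es[e].1 ∉ G.pos σ ∧ 0 < cnt' es[e].1)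
    (hc : cnt' es[e].1 = cnt es[e].1 - 1) (hc' : ∀ u : Fin n, u ≠ es[e].1 → cnt' u = cnt u) :
    AttrInv G es σ X w R (insert e D) S L cnt' where
  sub := h.sub
  notMem := h.notMem
  attr := h.attr
  stack := h.stack
  nodup := h.nodup
  cover e' h1 h2 := by
    rcases h.cover e' h1 h2 with h3 | h3 | h3
    · exact .inl h3
    · exact .inr (.inl (Finset.mem_insert_of_mem h3))
    · rcases List.mem_cons.1 h3 with h4 | h4
      · exact .inr (.inl (h4 ▸ Finset.mem_insert_self _ _))
      · exact .inr (.inr h4)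
  done e' he := by
    rcases Finset.mem_insert.1 he with rfl | he
    · obtain ⟨h1, h2, h3⟩ := h.list e' List.mem_cons_self
      exact ⟨h1, h2, h3, (List.nodup_cons.1 h.list_nodup).1⟩
    · obtain ⟨h1, h2, h3, h4⟩ := h.done e' he
      exact ⟨h1, h2, h3, fun h5 => h4 (List.mem_cons_of_mem _ h5)⟩
  list e' he := h.list e' (List.mem_cons_of_mem _ he)
  list_nodup := (List.nodup_cons.1 h.list_nodup).2
  own u hu hp := by
    have hne : es[e].1 ≠ u := fun h1 => (hR (h1 ▸ hu)).1 (h1 ▸ hp)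
    rw [hc' u hne.symm]
    refine ⟨(h.own u hu hp).1, fun e' he => ?_⟩
    rcases Finset.mem_insert.1 he with rfl | he
    · exact hne
    · exact (h.own u hu hp).2 e' he
  opp u hu hp := by
    obtain ⟨h1, h2⟩ := h.opp u hu hp
    have h3 := h.card_erase u
    by_cases hne : es[e].1 = u
    · rw [if_pos hne] at h3
      rw [hne] at hc hR
      exact ⟨by omega, fun _ => (hR hu).2⟩
    · rw [if_neg hne] at h3
      rw [hc' u (Ne.symm hne)]
      exact ⟨by omega, h2⟩
  out u hu := by
    by_cases hne : u = es[e].1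
    · rw [hne, hc, h.out _ (hne ▸ hu)]
    · rw [hc' u hne, h.out u hu]

/-- Process an edge and attract its source. -/
theorem push (hes : ∀ e, e ∈ es ↔ e ∈ G.E) (h : AttrInv G es σ X w R D S (e :: L) cnt)
    (h1 : cnt es[e].1 = 1) {cnt' : ℕ → ℕ}
    (hc : cnt' es[e].1 = 0) (hc' : ∀ u : Fin n, u ≠ es[e].1 → cnt' u = cnt u) :
    AttrInv G es σ X w (R.erase es[e].1) (insert e D) (es[e].1 :: S) L cnt' := by
  have hu : es[e].1 ∈ R := h.mem_of_cnt (by omega)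
  have he := h.list e List.mem_cons_self
  have hedge : (es[e].1, es[e].2) ∈ G.E := (hes _).1 (List.getElem_mem _)
  have hattr : es[e].1 ∈ G.attr σ X w := by
    by_cases hp : es[e].1 ∈ G.pos σ
    · exact mem_attr_of_own (h.sub hu) hp he.1 (h.attr _ he.1 he.2.1) hedge
    · refine mem_attr_of_opp (h.sub hu) hp fun t ht het => ?_
      obtain ⟨i, hi, hi'⟩ := List.getElem_of_mem ((hes _).2 het)
      have h2 := (h.opp _ hu hp).1
      have h3 := h.card_erase es[e].1
      rw [if_pos rfl, ← h2, h1] at h3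
      -- A counter of 1 for an opponent position says that `e` is its only unprocessed edge into
      -- `X`. All its other successors in `X` have therefore been attracted, and so has the target
      -- of `e`.
      have h4 : (⟨i, hi⟩ : Fin es.length) ∈ insert e D := by
        by_contra h5
        have h6 := Finset.card_eq_zero.1 (Nat.succ_injective h3.symm)
        have h7 := Finset.filter_eq_empty_iff.1 h6 (Finset.mem_univ ⟨i, hi⟩)
        simp only [Fin.getElem_fin, hi'] at h7
        exact h7 ⟨⟨trivial, ht⟩, h5⟩
      have h5 : es[(⟨i, hi⟩ : Fin es.length)].2 = t := by
        simp only [Fin.getElem_fin, hi']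
      rcases Finset.mem_insert.1 h4 with h6 | h6
      · rw [← h5, congrArg (fun e : Fin es.length => es[e].2) h6]
        exact h.attr _ he.1 he.2.1
      · have h7 := h.done _ h6
        rw [h5] at h7
        exact h.attr _ h7.1 h7.2.1
  refine ⟨(Finset.erase_subset _ _).trans h.sub, fun hw => h.notMem (Finset.mem_of_mem_erase hw),
    fun v hv hv' => ?_, fun v hv => ?_, ?_, fun e' h2 h3 => ?_, fun e' he' => ?_, fun e' he' => ?_,
    (List.nodup_cons.1 h.list_nodup).2, fun v hv hp => ?_, fun v hv hp => ?_, fun v hv => ?_⟩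
  · by_cases hne : v = es[e].1
    · exact hne ▸ hattr
    · exact h.attr v hv fun h2 => hv' (Finset.mem_erase.2 ⟨hne, h2⟩)
  · rcases List.mem_cons.1 hv with rfl | hv
    · exact ⟨h.sub hu, Finset.notMem_erase _ _⟩
    · exact ⟨(h.stack v hv).1, fun h2 => (h.stack v hv).2 (Finset.mem_of_mem_erase h2)⟩
  · exact List.nodup_cons.2 ⟨fun h2 => (h.stack _ h2).2 hu, h.nodup⟩
  · by_cases hne : es[e'].2 = es[e].1
    · exact .inl (hne ▸ List.mem_cons_self)
    · rcases h.cover e' h2 (fun h4 => h3 (Finset.mem_erase.2 ⟨hne, h4⟩)) with h4 | h4 | h4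
      · exact .inl (List.mem_cons_of_mem _ h4)
      · exact .inr (.inl (Finset.mem_insert_of_mem h4))
      · rcases List.mem_cons.1 h4 with h5 | h5
        · exact .inr (.inl (h5 ▸ Finset.mem_insert_self _ _))
        · exact .inr (.inr h5)
  · have key : es[e'].2 ∈ X ∧ es[e'].2 ∉ R ∧ es[e'].2 ∉ S ∧ e' ∉ L := by
      rcases Finset.mem_insert.1 he' with rfl | he'
      · exact ⟨he.1, he.2.1, he.2.2, (List.nodup_cons.1 h.list_nodup).1⟩
      · obtain ⟨h2, h3, h4, h5⟩ := h.done e' he'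
        exact ⟨h2, h3, h4, fun h6 => h5 (List.mem_cons_of_mem _ h6)⟩
    refine ⟨key.1, fun h2 => key.2.1 (Finset.mem_of_mem_erase h2), fun h2 => ?_, key.2.2.2⟩
    rcases List.mem_cons.1 h2 with h3 | h3
    · exact key.2.1 (h3 ▸ hu)
    · exact key.2.2.1 h3
  · obtain ⟨h2, h3, h4⟩ := h.list e' (List.mem_cons_of_mem _ he')
    refine ⟨h2, fun h5 => h3 (Finset.mem_of_mem_erase h5), fun h5 => ?_⟩
    rcases List.mem_cons.1 h5 with h6 | h6
    · exact h3 (h6 ▸ hu)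
    · exact h4 h6
  · obtain ⟨hne, hv⟩ := Finset.mem_erase.1 hv
    rw [hc' v hne]
    refine ⟨(h.own v hv hp).1, fun e' he' => ?_⟩
    rcases Finset.mem_insert.1 he' with rfl | he'
    · exact hne.symm
    · exact (h.own v hv hp).2 e' he'
  · obtain ⟨hne, hv⟩ := Finset.mem_erase.1 hv
    have h3 := h.card_erase v
    rw [if_neg (Ne.symm hne)] at h3
    rw [hc' v hne]
    exact ⟨by rw [(h.opp v hv hp).1]; omega, (h.opp v hv hp).2⟩
  · by_cases hne : v = es[e].1
    · rw [hne, hc]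
    · rw [hc' v hne, h.out v fun h2 => hv (Finset.mem_erase.2 ⟨hne, h2⟩)]

/-- With nothing left on stack and list, every edge into the attracted part has been processed.
Positions of `σ` in `R` are the source of no such edge, and an opponent position in `R` has a
positive counter, hence an edge that stays in `R`. The latter needs a successor in `X` to begin
with; here `G.Subarena X` enters. -/
theorem isResidue (hes : ∀ e, e ∈ es ↔ e ∈ G.E) (h : AttrInv G es σ X w R D [] [] cnt)
    (hX : G.Subarena X) : G.IsResidue σ X w R := by
  have hD : ∀ e : Fin es.length, es[e].2 ∈ X → es[e].2 ∉ R → e ∈ D := fun e h1 h2 => by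
    rcases h.cover e h1 h2 with h3 | h3 | h3
    · exact absurd h3 List.not_mem_nil
    · exact h3
    · exact absurd h3 List.not_mem_nil
  have hidx : ∀ u v, (u, v) ∈ G.E → ∃ e : Fin es.length, es[e].1 = u ∧ es[e].2 = v := by
    intro u v huv
    obtain ⟨i, hi, hi'⟩ := List.getElem_of_mem ((hes _).2 huv)
    exact ⟨⟨i, hi⟩, by simp [hi'], by simp [hi']⟩
  refine ⟨⟨h.sub, fun u hu hp v hv he => ?_, fun u hu hp => ?_⟩, h.attr, h.notMem⟩
  · by_contra hR
    obtain ⟨e, rfl, rfl⟩ := hidx u v he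
    exact (h.own _ hu hp).2 e (hD e hv hR) rfl
  · obtain ⟨v, hv, he⟩ := hX u (h.sub hu)
    obtain ⟨e, rfl, rfl⟩ := hidx u v he
    obtain ⟨h1, h2⟩ := h.opp _ hu hp
    have h3 := h2 (Finset.card_pos.2 ⟨e, by simpa using hv⟩)
    rw [h1, Finset.card_pos] at h3
    obtain ⟨e', he'⟩ := h3
    simp only [Finset.mem_filter, Finset.mem_univ, true_and] at he'
    refine ⟨es[e'].2, ?_, ?_⟩
    · by_contra hR
      exact he'.2 (hD e' he'.1.2 hR)
    · rw [← he'.1.1]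
      exact (hes _).1 (List.getElem_mem _)

end AttrInv

theorem Static.setv {s : State} (hS : Static G es s) {x : Var} {c : ℕ}
    (hx : (Cmd.set x 0).keeps = true) : Static G es (s.setv x c) := by
  have h : Same (Cmd.set x 0) s (s.setv x c) := by
    refine ⟨fun y hy => ?_, fun _ _ => rfl, fun _ => rfl⟩
    rw [State.setv_v, if_neg (by rintro rfl; simp [Cmd.wv] at hy)]
  exact hS.same h hx

theorem Static.seta {s : State} (hS : Static G es s) {b : Arr} {i c : ℕ}
    (hb : (Cmd.put b 0 0).keeps = true) : Static G es (s.seta b i c) := by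
  have h : Same (Cmd.put b 0 0) s (s.seta b i c) := by
    refine ⟨fun _ _ => rfl, fun b' hb => ?_, fun _ => rfl⟩
    funext j
    rw [State.seta_a, if_neg (by rintro rfl; simp [Cmd.wa] at hb)]
  exact hS.same h hb

theorem Static.tick {s : State} (hS : Static G es s) : Static G es s.tick :=
  ⟨hS.vn, hS.vm, hS.vfull, hS.own, hS.inW, hS.pow, hS.src, hS.tgt, hS.link, hS.fl⟩

theorem mem_pos_iff (G : McNaughtonGame (Fin n)) (σ : Fin 2) (v : Fin n) :
    v ∈ G.pos σ ↔ (if v ∈ G.pos 0 then 0 else 1) = (σ : ℕ) := by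
  match σ with
  | 0 => split_ifs with h <;> simp [h]
  | 1 =>
    have h1 := G.mem_pos_sub 0 v
    rw [show (1 : Fin 2) - 0 = 1 from rfl] at h1
    rw [h1]
    split_ifs with h <;> simp [h]

/-- Initial values of the counters. -/
def initCount (G : McNaughtonGame (Fin n)) (es : List (Fin n × Fin n)) (σ : Fin 2)
    (X : Finset (Fin n)) (u : Fin n) : ℕ :=
  if u ∈ X then if u ∈ G.pos σ then 1 else outDegree es X u else 0

theorem wp_counters (h : Input G es fs inp) {s : State} (hS : Static G es s) {X : Finset (Fin n)}
    {σ : Fin 2} (hX : ∀ v : Fin n, s.a .inX v = if v ∈ X then 1 else 0)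
    (hd : ∀ v : Fin n, s.a .deg v = outDegree es X v) (hpl : s.v .pl = σ) :
    WP (limits wit n inp) counters (fun s' =>
      (∀ v : Fin n, s'.a .cnt v = initCount G es σ X v) ∧ s'.clk ≤ s.clk + 5 * n + 2) s := by
  obtain ⟨b1, b2, b3, b4, b5, b6, b7⟩ := h.bounds
  rw [counters, wp_seq, wp_set]
  refine ⟨by simp, ?_⟩
  have hS0 := hS.setv (x := .i) (c := Expr.eval s 0) rfl
  refine WP.loop (k := n) (fun k s' => s'.v .i + k = n ∧
    (∀ v : Fin n, (v : ℕ) < s'.v .i → s'.a .cnt v = initCount G es σ X v) ∧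
    s'.clk ≤ s.clk + 5 * s'.v .i + 1) ?_ ?_ ?_
  · simp
  · rintro k s' ⟨e1, e2, e3⟩ hs hlt
    have hS' : Static G es s' := hS0.same hs rfl
    have hX' : s'.a .inX = s.a .inX := by rw [hs.a _ rfl]; rfl
    have hd' : s'.a .deg = s.a .deg := by rw [hs.a _ rfl]; rfl
    have hpl' : s'.v .pl = σ := by rw [hs.v _ rfl]; exact hpl
    simp [hS'.vn] at hlt
    have c3 : s'.v .i < n * n := by omega
    have gX := hX ⟨s'.v .i, hlt⟩
    have gd := hd ⟨s'.v .i, hlt⟩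
    have gle := outDegree_le (es := es) X ⟨s'.v .i, hlt⟩
    have go := hS'.own ⟨s'.v .i, hlt⟩
    have gp := mem_pos_iff G σ ⟨s'.v .i, hlt⟩
    have step : ∀ c, c = initCount G es σ X ⟨s'.v .i, hlt⟩ → ∀ v : Fin n, (v : ℕ) ≤ s'.v .i →
        (if (v : ℕ) = s'.v .i then c else s'.a .cnt v) = initCount G es σ X v := by
      intro c hc v hv
      by_cases hvi : (v : ℕ) = s'.v .i
      · rw [if_pos hvi, hc]
        congr 1
        exact Fin.ext hvi.symm
      · rw [if_neg hvi, e2 v (by omega)]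
    simp only [] at gX gd go
    rw [← go] at gp
    by_cases hv : (⟨s'.v .i, hlt⟩ : Fin n) ∈ X
    · rw [if_pos hv] at gX
      by_cases hp : (⟨s'.v .i, hlt⟩ : Fin n) ∈ G.pos σ
      · have heq := gp.1 hp
        simp [wp_seq, wp_set, wp_put, wp_ite, hX', gX, hpl', heq, limits_acap, Arr.idx, c3]
        refine ⟨⟨by omega, by omega⟩, by omega, k - 1, by omega, by omega, ?_, by omega⟩
        exact step 1 (by rw [initCount, if_pos hv, if_pos hp])
      · have hne : s'.a .own (s'.v .i) ≠ σ := fun e => hp (gp.2 e)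
        have hz : 1 - (s'.a .own (s'.v .i) - σ + (σ - s'.a .own (s'.v .i))) = 0 := by omega
        simp only [wp_seq, wp_set, wp_put, wp_ite, State.tick_a, State.tick_v, Expr.eval,
          Expr.eval_sub, hX', gX, hpl', hz, lt_irrefl,
          false_imp_iff, true_and, true_imp_iff, Nat.one_ne_zero, and_true, zero_lt_one, hd', gd]
        simp [limits_acap, Arr.idx, c3]
        refine ⟨⟨by omega, by omega⟩, by omega, k - 1, by omega, by omega, ?_, by omega⟩
        exact step _ (by rw [initCount, if_pos hv, if_neg hp])
    · rw [if_neg hv] at gX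
      simp [wp_seq, wp_set, wp_put, wp_ite, hX', gX, limits_acap, Arr.idx]
      refine ⟨by omega, by omega, k - 1, by omega, by omega, ?_, by omega⟩
      exact step 0 (by rw [initCount, if_neg hv])
  · rintro k s' ⟨e1, e2, e3⟩ hs hle
    have hS' : Static G es s' := hS0.same hs rfl
    simp [hS'.vn] at hle
    simp only [State.tick_a, State.tick_clk]
    exact ⟨fun v => e2 v (by omega), by omega⟩

theorem AttrInv.cnt_le {σ : Fin 2} {X R : Finset (Fin n)} {w : Fin n} {D : Finset (Fin es.length)}
    {S : List (Fin n)} {L : List (Fin es.length)} {cnt : ℕ → ℕ}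
    (h : AttrInv G es σ X w R D S L cnt) (u : Fin n) : cnt u ≤ es.length + 1 := by
  by_cases hu : u ∈ R
  · by_cases hp : u ∈ G.pos σ
    · rw [(h.own u hu hp).1]
      omega
    · rw [(h.opp u hu hp).1]
      refine (Finset.card_le_univ _).trans ?_
      simp
  · rw [h.out u hu]
    omega

/-- The cost is charged to processed edges: at most 9 ticks for each edge added to `D`, and one for
the final test. Since `R.card + S.length` is preserved, it can serve as the variant of the outer
loop. -/
theorem wp_attractStep (h : Input G es fs inp) {s : State} (hS : Static G es s)
    {σ : Fin 2} {X R : Finset (Fin n)} {w : Fin n} {D : Finset (Fin es.length)}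
    {S : List (Fin n)} {L : List (Fin es.length)}
    (hI : AttrInv G es σ X w R D S L (s.a .cnt)) (hst : Stacked (s.a .stk) S)
    (hL : Linked (s.a .nxt) (s.v .j) L) (hy : s.v .y = setCode R) (hsp : s.v .sp = S.length) :
    WP (limits wit n inp) attractStep (fun s' => ∃ R' D' S',
      AttrInv G es σ X w R' D' S' [] (s'.a .cnt) ∧ Stacked (s'.a .stk) S' ∧
      s'.v .y = setCode R' ∧ s'.v .sp = S'.length ∧ R'.card + S'.length = R.card + S.length ∧
      s'.clk + 9 * D.card ≤ s.clk + 9 * D'.card + 1) s := by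
  obtain ⟨b1, b2, b3, b4, b5, b6, b7⟩ := h.bounds
  refine WP.loop (k := L.length) (fun k s' => ∃ R' D' S' L',
      AttrInv G es σ X w R' D' S' L' (s'.a .cnt) ∧ Stacked (s'.a .stk) S' ∧
      s'.v .y = setCode R' ∧ s'.v .sp = S'.length ∧ R'.card + S'.length = R.card + S.length ∧
      Linked (s.a .nxt) (s'.v .j) L' ∧ L'.length = k ∧
      s'.clk + 9 * D.card ≤ s.clk + 9 * D'.card) ?_ ?_ ?_
  · exact ⟨R, D, S, L, hI, hst, hy, hsp, rfl, hL, rfl, le_rfl⟩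
  · rintro k s' ⟨R', D', S', L', hI', hst', hy', hsp', hRS, hL', hk, hc⟩ hs hlt
    have hS' : Static G es s' := hS.same hs rfl
    have hnxt : s'.a .nxt = s.a .nxt := hs.a _ rfl
    match L', hL' with
    | [], hL' =>
      have : s'.v .j = 0 := hL'
      simp [this] at hlt
    | e :: L', ⟨hj, hL'⟩ =>
    simp only [List.length_cons] at hk
    have hsrc := hS'.src e
    have hpow := hS'.pow es[e].1
    have heD : e ∉ D' := fun he => (hI'.done e he).2.2.2 List.mem_cons_self
    have hcard := Finset.card_insert_of_notMem heD
    have hcnt := hI'.cnt_le es[e].1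
    have c1 := es[e].1.2
    have c3 : (es[e].1 : ℕ) < n * n := by omega
    have c5 := setCode_lt R'
    have hj0 : s'.v .j - 1 = e := by omega
    have hle := (Finset.card_le_univ R').trans (by simp : _ ≤ n)
    have hnj : s.a .nxt e ≤ 64 * 2 ^ n := by
      match L', hL' with
      | [], hL' => rw [show s.a .nxt e = 0 from hL']; omega
      | e' :: L', ⟨hj', _⟩ =>
        have := e'.2
        omega
    rw [← hk]
    by_cases hz : s'.a .cnt es[e].1 = 0
    · have hR := hI'.notMem_of_cnt hz
      have hI'' := hI'.step (cnt' := s'.a .cnt) (fun hR' => absurd hR' hR) (by omega)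
        (fun _ _ => rfl)
      simp only [wp_seq, wp_set, wp_ite, wp_skip, State.tick_a, State.tick_v, Expr.eval,
        Expr.eval_sub, hj0, hsrc, State.setv_v, State.setv_a, if_true, hz,
        lt_irrefl, false_imp_iff, true_imp_iff, true_and, hnxt, reduceCtorEq, if_false]
      refine ⟨by simp; omega, by simpa using hnj, L'.length, by omega, R', insert e D', S', L',
        hI'', hst', hy', hsp', hRS, hL', rfl, ?_⟩
      simp only [State.setv_clk, State.tick_clk]
      omega
    · by_cases h1 : s'.a .cnt es[e].1 = 1
      · have hu : es[e].1 ∈ R' := hI'.mem_of_cnt (by omega)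
        have hI'' := hI'.push h.mem_es h1 (cnt' := fun i => if i = es[e].1 then 0 else s'.a .cnt i)
          (if_pos rfl) (fun u hu => if_neg fun e => hu (Fin.ext e))
        have hlen : (es[e].1 :: S').length ≤ n :=
          (List.Nodup.length_le_card hI''.nodup).trans (by simp)
        rw [List.length_cons] at hlen
        have c4 : S'.length < n * n := by omega
        have hRc : (R'.erase es[e].1).card + 1 = R'.card := Finset.card_erase_add_one hu
        have hcode := setCode_erase hu
        simp only [wp_seq, wp_set, wp_put, wp_ite, wp_skip, State.tick_a, State.tick_v, Expr.eval,
          Expr.eval_sub, hj0, hsrc, State.setv_v, State.setv_a,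
          if_true, h1, zero_lt_one, true_imp_iff, hnxt, reduceCtorEq, if_false,
          Nat.one_ne_zero, false_imp_iff, and_true, State.seta_a, State.seta_v, hpow, hsp', hy',
          Nat.sub_self, Nat.sub_zero, limits_top, limits_size, limits_acap, Arr.idx, c3, c4]
        refine ⟨by omega, ⟨by omega, by simp⟩, by omega, ⟨by omega, by simp; omega⟩, by omega,
          by simpa using hnj, L'.length, by omega, R'.erase es[e].1, insert e D', es[e].1 :: S', L',
          hI'', ⟨if_pos rfl, hst'.congr fun i hi => ?_⟩, hcode.symm, rfl, ?_, hL', rfl, ?_⟩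
        · exact if_neg (by omega)
        · rw [List.length_cons]
          omega
        · simp only [State.setv_clk, State.seta_clk, State.tick_clk]
          omega
      · have hu : es[e].1 ∈ R' := hI'.mem_of_cnt (by omega)
        have hI'' := hI'.step
          (cnt' := fun i => if i = es[e].1 then s'.a .cnt es[e].1 - 1 else s'.a .cnt i)
          (fun _ => ⟨fun hp => h1 (hI'.own _ hu hp).1, by rw [if_pos rfl]; omega⟩)
          (if_pos rfl) (fun u hu => if_neg fun e => hu (Fin.ext e))
        have hz' : 0 < s'.a .cnt es[e].1 := by omega
        have h1' : 1 - (s'.a .cnt es[e].1 - 1) = 0 := by omega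
        simp only [wp_seq, wp_set, wp_put, wp_ite, wp_skip, State.tick_a, State.tick_v, Expr.eval,
          Expr.eval_sub, hj0, hsrc, State.setv_v, State.setv_a,
          if_true, hz', hz, true_imp_iff, true_and, hnxt, reduceCtorEq, if_false, lt_irrefl,
          false_imp_iff, and_true, State.seta_a, State.seta_v, h1',
          limits_top, limits_size, limits_acap, Arr.idx, c3]
        refine ⟨by omega, ⟨by omega, le_of_le_of_eq (b := 64 * 2 ^ n) (by omega) (by simp)⟩,
          by simpa using hnj, L'.length, by omega, R', insert e D', S', L',
          hI'', hst', hy', hsp', hRS, hL', rfl, ?_⟩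
        simp only [State.setv_clk, State.seta_clk, State.tick_clk]
        omega
  · rintro k s' ⟨R', D', S', L', hI', hst', hy', hsp', hRS, hL', hk, hc⟩ hs hle
    match L', hL' with
    | e :: L', ⟨hj, hL'⟩ =>
      simp at hle
      omega
    | [], hL' =>
      refine ⟨R', D', S', hI', hst', hy', hsp', hRS, ?_⟩
      simp only [State.tick_clk]
      omega

/-- Each position is popped at most once and each edge is processed at most once over the entire
run, which makes the total cost linear. The run is safe for every `X`; only the claim on the residue
needs a subarena. -/
theorem wp_attractor (h : Input G es fs inp) {s : State} (hS : Static G es s)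
    {X : Finset (Fin n)} {σ : Fin 2} (hX : ∀ v : Fin n, s.a .inX v = if v ∈ X then 1 else 0)
    (hd : ∀ v : Fin n, s.a .deg v = outDegree es X v) (hpl : s.v .pl = σ)
    (hx : s.v .x = setCode X) {w : Fin n} (hw : s.v .w = w) (hwX : w ∈ X) :
    WP (limits wit n inp) attractor (fun s' => ∃ R : Finset (Fin n), s'.v .y = setCode R ∧
      R ⊂ X ∧ (G.Subarena X → G.IsResidue σ X w R) ∧
      s'.clk ≤ s.clk + 9 * n + 9 * es.length + 7) s := by
  obtain ⟨b1, b2, b3, b4, b5, b6, b7⟩ := h.bounds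
  have hXlt := setCode_lt X
  have hXc := (Finset.card_le_univ X).trans (by simp : _ ≤ n)
  have hcode := setCode_erase hwX
  have hcard := Finset.card_erase_add_one hwX
  have hwlt := w.2
  have c3 : (w : ℕ) < n * n := by omega
  have c4 : 0 < n * n := by omega
  rw [attractor, wp_seq]
  refine (wp_counters h hS hX hd hpl).mono fun s1 ⟨hcnt, hclk⟩ hs1 => ?_
  have hS1 : Static G es s1 := hS.same hs1 rfl
  have hw1 : s1.v .w = w := (hs1.v _ rfl).trans hw
  have hx1 : s1.v .x = setCode X := (hs1.v _ rfl).trans hx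
  have hpow := hS1.pow w
  rw [wp_seq, wp_put, wp_seq, wp_set, wp_seq, wp_put, wp_seq, wp_set]
  simp only [Expr.eval, Expr.eval_sub, State.seta_v, State.seta_a, State.setv_v,
    hw1, hx1, hpow, reduceCtorEq, if_false, limits_size, limits_top, limits_acap,
    Arr.idx, c3, c4]
  refine ⟨⟨by omega, by simp⟩, by omega, ⟨by omega, by simp; omega⟩, by omega, ?_⟩
  set s2 : State := State.setv _ .sp 1 with hs2
  have hS2 : Static G es s2 := (((hS1.seta rfl).setv rfl).seta rfl).setv rfl
  have hclk2 : s2.clk = s1.clk + 4 := rfl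
  have hI : AttrInv G es σ X w (X.erase w) ∅ [w] [] (s2.a .cnt) := by
    refine AttrInv.init hwX fun u => ?_
    change (if (u : ℕ) = w then 0 else s1.a .cnt u) = _
    rw [hcnt]
    by_cases huw : u = w
    · rw [if_pos huw, if_pos (by rw [huw])]
    · rw [if_neg huw, if_neg (fun e => huw (Fin.ext e))]
      rfl
  refine WP.loop (k := X.card) (fun k s' => ∃ R D S, AttrInv G es σ X w R D S [] (s'.a .cnt) ∧
      Stacked (s'.a .stk) S ∧ s'.v .y = setCode R ∧ s'.v .sp = S.length ∧
      R.card + S.length = k ∧ s'.clk + 4 * k ≤ s2.clk + 9 * D.card + 4 * X.card) ?_ ?_ ?_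
  · exact ⟨X.erase w, ∅, [w], hI, ⟨rfl, trivial⟩, hcode.symm, rfl, hcard, by omega⟩
  · rintro k s' ⟨R, D, S, hI, hst, hy, hsp, hk, hc⟩ hs hlt
    have hS' : Static G es s' := hS2.same hs rfl
    match S, hst with
    | [], _ =>
      simp [hsp] at hlt
    | t :: S, ⟨ht, hst⟩ =>
    simp only [List.length_cons] at hsp hk
    obtain ⟨L, hL1, hL2, hL3⟩ := hS'.link t
    have hj : s'.a .head t ≤ 64 * 2 ^ n := by
      match L, hL1 with
      | [], hL1 => rw [show s'.a .head t = 0 from hL1]; omega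
      | e :: L, hL1 =>
        have := e.2
        have := hL1.1
        omega
    have hle := (Finset.card_le_univ R).trans (by simp : _ ≤ n)
    have hlen : (t :: S).length ≤ n :=
      (List.Nodup.length_le_card hI.nodup).trans (by simp)
    rw [List.length_cons] at hlen
    have hsp1 : s'.v .sp - 1 = S.length := by omega
    rw [wp_seq, wp_set, wp_seq, wp_set]
    simp only [Expr.eval, Expr.eval_sub, State.setv_v, State.setv_a,
      State.tick_v, State.tick_a, if_true, hsp1, ht, limits_top]
    refine ⟨by omega, hj, ?_⟩
    refine (wp_attractStep (s := (s'.tick.setv .sp S.length).setv .j (s'.a .head t)) h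
      ((hS'.tick.setv rfl).setv rfl) (hI.pop hL2 hL3) hst hL1 hy rfl).mono ?_
    rintro s3 ⟨R', D', S', hI', hst', hy', hsp', hk', hc'⟩ -
    simp only [State.setv_clk, State.tick_clk] at hc'
    exact ⟨R'.card + S'.length, by omega, R', D', S', hI', hst', hy', hsp', rfl, by omega⟩
  · rintro k s' ⟨R, D, S, hI, hst, hy, hsp, hk, hc⟩ hs hle
    have hS0 : S = [] := by
      simp [hsp] at hle
      exact hle
    subst hS0
    have hD : D.card ≤ es.length := (Finset.card_le_univ D).trans (by simp)
    refine ⟨R, hy, ⟨hI.sub, fun hsub => hI.notMem (hsub hwX)⟩, hI.isResidue h.mem_es, ?_⟩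
    simp only [State.tick_clk]
    omega

end

/-! ## The table -/

/-- A bound on the table entries. -/
def entryCap (wit : Bool) (n : ℕ) : ℕ := if wit then n else 1

section

variable {wit : Bool} {n : ℕ} {G : McNaughtonGame (Fin n)} {es : List (Fin n × Fin n)}
  {fs : List (Finset (Fin n))} {inp : List ℕ}

theorem entryCap_le (hn : 0 < n) : entryCap wit n ≤ n := by
  unfold entryCap
  split_ifs <;> omega

/-- The table entry for Player `σ` and the set `X` tells whether `σ` wins the subgame on `X` from
some position, and which one, if witnesses are recorded. -/
def Entry (G : McNaughtonGame (Fin n)) (wit : Bool) (X : Finset (Fin n)) (σ : Fin 2) (q : ℕ) :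
    Prop :=
  (0 < q ↔ (G.winIn σ X).Nonempty) ∧
    (wit = true → 0 < q → ∃ v : Fin n, q = v + 1 ∧ v ∈ G.winIn σ X)

/-- What a scan tells: `q` is positive if and only if `t` is positive at the code of the rest of
`X` for one of the positions of `C` from `lo` on that lie below `hi`. -/
structure Scanned (G : McNaughtonGame (Fin n)) (wit : Bool) (σ : Fin 2) (X C : Finset (Fin n))
    (t : ℕ → ℕ) (lo hi q : ℕ) : Prop where
  pos : ∀ v ∈ C, lo ≤ (v : ℕ) → (v : ℕ) < hi → ∃ R, R ⊂ X ∧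
    (G.Subarena X → G.IsResidue σ X v R) ∧ (0 < t (setCode R) → 0 < q)
  wit : 0 < q → ∃ v R, R ⊂ X ∧ (G.Subarena X → G.IsResidue σ X v R) ∧ 0 < t (setCode R) ∧
    (wit = true → q = t (setCode R))

/-- The number of elements of `C` from `lo` on that lie below `hi`. -/
def countIn (C : Finset (Fin n)) (lo hi : ℕ) : ℕ :=
  (Finset.univ.filter (fun v : Fin n => (v : ℕ) < hi ∧ lo ≤ (v : ℕ) ∧ v ∈ C)).card

/-- The answer `q`, once positive, remains positive, and it always stems from some residue already
examined. Only members of `C` cost an attractor; the other indices cost a constant. -/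
theorem wp_scan (h : Input G es fs inp) {s : State} (hS : Static G es s)
    {X C : Finset (Fin n)} {σ : Fin 2} {b : Arr} {lo hi op : ℕ}
    (hb : (scan wit b).wa b = false)
    (hX : ∀ v : Fin n, s.a .inX v = if v ∈ X then 1 else 0)
    (hC : ∀ v : Fin n, s.a b v = if v ∈ C then 1 else 0) (hCX : C ⊆ X)
    (hd : ∀ v : Fin n, s.a .deg v = outDegree es X v) (hpl : s.v .pl = σ)
    (hx : s.v .x = setCode X) (hop : s.v .op = op) (hlo : s.v .w = lo) (hhi : s.v .hi = hi)
    (hhin : hi ≤ n) (hlohi : lo ≤ hi) (htab : ∀ i, s.a .tab i ≤ entryCap wit n) :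
    WP (limits wit n inp) (scan wit b) (fun s' =>
      Scanned G wit σ X C (fun r => s.a .tab (r + r + op)) lo hi (s'.v .q) ∧
      s'.v .q ≤ entryCap wit n ∧
      s'.clk ≤ s.clk + 2 + 3 * n + (9 * n + 9 * es.length + 9) * countIn C lo hi) s := by
  obtain ⟨b1, b2, b3, b4, b5, b6, b7⟩ := h.bounds
  have hcap := entryCap_le (wit := wit) b1
  rw [scan, wp_seq, wp_set]
  refine ⟨by simp, ?_⟩
  have hS0 := hS.setv (x := .q) (c := Expr.eval s 0) rfl
  set s0 := s.setv .q (Expr.eval s 0) with hs0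
  have hclk0 : s0.clk = s.clk + 1 := rfl
  refine WP.loop (k := hi - lo) (fun k s' => s'.v .w + k = hi ∧ lo ≤ s'.v .w ∧
    Scanned G wit σ X C (fun r => s.a .tab (r + r + op)) lo (s'.v .w) (s'.v .q) ∧
    s'.v .q ≤ entryCap wit n ∧ s'.clk + 3 * k ≤ s0.clk + 3 * (hi - lo) +
      (9 * n + 9 * es.length + 9) * countIn C lo (s'.v .w)) ?_ ?_ ?_
  · have e1 : s0.v .w = lo := hlo
    have e2 : s0.v .q = 0 := rfl
    rw [e1, e2]
    refine ⟨by omega, le_rfl, ⟨fun v _ h1 h2 => by omega, fun h0 => absurd h0 (lt_irrefl 0)⟩,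
      Nat.zero_le _, by omega⟩
  · rintro k s' ⟨e1, e2, e3, e4, e5⟩ hs hlt
    have hS' : Static G es s' := hS0.same hs (by cases wit <;> rfl)
    have hX' : s'.a .inX = s.a .inX := hs.a _ (by cases wit <;> rfl)
    have hd' : s'.a .deg = s.a .deg := hs.a _ (by cases wit <;> rfl)
    have ht' : s'.a .tab = s.a .tab := hs.a _ (by cases wit <;> rfl)
    have hb' : s'.a b = s.a b := hs.a _ hb
    have hpl' : s'.v .pl = σ := (hs.v _ (by cases wit <;> rfl)).trans hpl
    have hop' : s'.v .op = op := (hs.v _ (by cases wit <;> rfl)).trans hop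
    have hx' : s'.v .x = setCode X := (hs.v _ (by cases wit <;> rfl)).trans hx
    have hhi' : s'.v .hi = hi := (hs.v _ (by cases wit <;> rfl)).trans hhi
    simp [hhi'] at hlt
    obtain ⟨w, hw⟩ : ∃ w : Fin n, s'.v .w = w := ⟨⟨s'.v .w, by omega⟩, rfl⟩
    rw [hw] at e1 e2 e3 e5 hlt
    have gC := hC w
    have hcount := card_filter_lt_succ w.2 (fun v : Fin n => lo ≤ (v : ℕ) ∧ v ∈ C)
    change countIn C lo (w + 1) = countIn C lo w + _ at hcount
    rw [wp_seq, wp_ite]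
    simp only [Expr.eval, State.tick_v, State.tick_a, hw, hb', gC]
    by_cases hwC : w ∈ C
    · rw [if_pos (⟨e2, hwC⟩ : lo ≤ (w : ℕ) ∧ w ∈ C)] at hcount
      rw [if_pos hwC]
      refine ⟨fun _ => ?_, fun h0 => absurd h0 Nat.one_ne_zero⟩
      rw [wp_seq]
      refine (wp_attractor h hS'.tick.tick (σ := σ) (X := X) (w := w) (by rwa [← hX'] at hX)
        (by rwa [← hd'] at hd) hpl' hx' hw (hCX hwC)).mono ?_
      rintro s1 ⟨R, hy, hR, hres, hclk⟩ hs1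
      have hw1 : s1.v .w = w := (hs1.v _ rfl).trans hw
      have hop1 : s1.v .op = op := (hs1.v _ rfl).trans hop'
      have ht1 : s1.a .tab = s.a .tab := (hs1.a _ rfl).trans ht'
      have hq1 : s1.v .q = s'.v .q := hs1.v _ rfl
      have hTle := htab (setCode R + setCode R + op)
      have hmul : (9 * n + 9 * es.length + 9) * (countIn C lo w + 1) =
        (9 * n + 9 * es.length + 9) * countIn C lo w + (9 * n + 9 * es.length + 9) := rfl
      simp only [State.tick_clk] at hclk
      rw [wp_ite]
      simp only [Expr.eval, hy, hop1, ht1]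
      constructor
      · intro hT
        have hval : (bif wit then A .tab (V .y + V .y + V .op) else 1 : Expr).eval s1.tick =
            bif wit then s.a .tab (setCode R + setCode R + op) else 1 := by
          cases wit
          · rfl
          · simp [hy, hop1, ht1]
        have hvpos : 0 < (bif wit then s.a .tab (setCode R + setCode R + op) else 1) := by
          cases wit
          · exact zero_lt_one
          · exact hT
        have hvle : (bif wit then s.a .tab (setCode R + setCode R + op) else 1) ≤
            entryCap wit n := by
          cases wit
          · exact le_rfl
          · exact hTle
        rw [wp_set, wp_set, hval]
        refine ⟨by simp only [limits_top]; omega, ?_⟩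
        simp only [Expr.eval, State.setv_v, State.tick_v,
          reduceCtorEq, if_false, if_true, hw1, limits_top, State.setv_clk, State.tick_clk]
        refine ⟨by omega, k - 1, by omega, by omega, by omega, ⟨?_, ?_⟩, hvle, ?_⟩
        · intro v hv h1 h2
          rcases Nat.lt_succ_iff_lt_or_eq.1 h2 with h3 | h3
          · obtain ⟨R', g1, g2, -⟩ := e3.pos v hv h1 h3
            exact ⟨R', g1, g2, fun _ => hvpos⟩
          · exact ⟨R, hR, Fin.ext h3 ▸ hres, fun _ => hvpos⟩
        · refine fun _ => ⟨w, R, hR, hres, hT, ?_⟩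
          rintro rfl
          rfl
        · rw [hcount, hmul]
          omega
      · intro hT
        rw [wp_skip, wp_set]
        simp only [Expr.eval, State.setv_v, State.tick_v,
          reduceCtorEq, if_false, if_true, hw1, limits_top, State.setv_clk, State.tick_clk, hq1]
        refine ⟨by omega, k - 1, by omega, by omega, by omega, ⟨?_, e3.wit⟩, e4, ?_⟩
        · intro v hv h1 h2
          rcases Nat.lt_succ_iff_lt_or_eq.1 h2 with h3 | h3
          · exact e3.pos v hv h1 h3
          · exact ⟨R, hR, Fin.ext h3 ▸ hres, fun h0 => by omega⟩
        · rw [hcount, hmul]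
          omega
    · rw [if_neg (fun hc : lo ≤ (w : ℕ) ∧ w ∈ C => hwC hc.2), add_zero] at hcount
      rw [if_neg hwC]
      refine ⟨fun h0 => absurd h0 (lt_irrefl 0), fun _ => ?_⟩
      rw [wp_skip, wp_set]
      simp only [Expr.eval, State.setv_v, State.tick_v,
        reduceCtorEq, if_false, if_true, hw, limits_top, State.setv_clk, State.tick_clk]
      refine ⟨by omega, k - 1, by omega, by omega, by omega, ⟨?_, e3.wit⟩, e4, ?_⟩
      · intro v hv h1 h2
        rcases Nat.lt_succ_iff_lt_or_eq.1 h2 with h3 | h3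
        · exact e3.pos v hv h1 h3
        · exact absurd (Fin.ext h3 ▸ hv) hwC
      · rw [hcount]
        omega
  · rintro k s' ⟨e1, e2, e3, e4, e5⟩ hs hle
    have hhi' : s'.v .hi = hi := (hs.v _ (by cases wit <;> rfl)).trans hhi
    simp [hhi'] at hle
    have hw : s'.v .w = hi := by omega
    rw [hw] at e3 e5
    exact ⟨e3, e4, by simp only [State.tick_clk]; omega⟩

/-- The table entries for the proper subsets of `X` are right. -/
def TableOk (G : McNaughtonGame (Fin n)) (wit : Bool) (t : ℕ → ℕ) (X : Finset (Fin n)) : Prop :=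
  ∀ Y ⊂ X, G.Subarena Y → ∀ σ : Fin 2, Entry G wit Y σ (t (setCode Y + setCode Y + σ))

/-- Soundness of a positive answer needs no knowledge about the removed position: every residue is a
trap for `σ`, so wins of the opponent there persist on `X`, along with the witness. Completeness is
left as a hypothesis, because it has different reasons in the two scans. -/
theorem TableOk.entry_of_scanned {t : ℕ → ℕ} {σ : Fin 2} {X C : Finset (Fin n)} {lo hi q : ℕ}
    (ht : TableOk G wit t X) (hX : G.Subarena X)
    (hs : Scanned G wit σ X C (fun r => t (r + r + (1 - σ : Fin 2))) lo hi q)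
    (hpos : (G.winIn (1 - σ) X).Nonempty → 0 < q) : Entry G wit X (1 - σ) q := by
  refine ⟨⟨fun hq => ?_, hpos⟩, fun hwit hq => ?_⟩
  · obtain ⟨v, R, hR, hres, hT, -⟩ := hs.wit hq
    have hres := hres hX
    exact ((ht R hR (hres.trap.subarena hX) (1 - σ)).1.1 hT).mono hres.winIn_subset
  · obtain ⟨v, R, hR, hres, hT, hqT⟩ := hs.wit hq
    have hres := hres hX
    obtain ⟨u, hu, hu'⟩ := (ht R hR (hres.trap.subarena hX) (1 - σ)).2 hwit hT
    exact ⟨u, (hqT hwit).trans hu, hres.winIn_subset hu'⟩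

/-- The opponent of the owner of `X` wins somewhere if and only if he wins somewhere in what the
attractor of some position of `X ∩ W` leaves. -/
theorem TableOk.entry_opponent {t : ℕ → ℕ} {σ : Fin 2} {X : Finset (Fin n)} {q : ℕ}
    (ht : TableOk G wit t X) (hX : G.Subarena X) (hF : X ∩ G.W ∈ G.F σ)
    (hs : Scanned G wit σ X (X ∩ G.W) (fun r => t (r + r + (1 - σ : Fin 2))) 0 n q) :
    Entry G wit X (1 - σ) q ∧ (q = 0 → ∀ v ∈ X, v ∈ G.winIn σ X) := by
  have key : q = 0 → ∀ v ∈ X, v ∈ G.winIn σ X := by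
    intro hq v hv
    -- Were the opponent to win somewhere on one of the residues, the scan would have noticed. By
    -- determinacy `σ` wins everywhere on all of them, and the pursuit of targets applies.
    have h1 : ∀ w, ∃ R, w ∈ X ∩ G.W → R ⊂ X ∧ (G.Subarena X → G.IsResidue σ X w R) ∧
        (0 < t (setCode R + setCode R + (1 - σ : Fin 2)) → 0 < q) := by
      intro w
      by_cases hw : w ∈ X ∩ G.W
      · obtain ⟨R, hR⟩ := hs.pos w hw (Nat.zero_le _) w.2
        exact ⟨R, fun _ => hR⟩
      · exact ⟨∅, fun h => absurd h hw⟩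
    choose Y hY using h1
    refine mem_winIn_of_residues hX hF Y (fun w hw => (hY w hw).2.1 hX) (fun w hw y hy => ?_) hv
    obtain ⟨h2, h3, h4⟩ := hY w hw
    have hsub := (h3 hX).trap.subarena hX
    refine (hsub.determined σ hy).resolve_right fun hy' => ?_
    have := h4 ((ht _ h2 hsub (1 - σ)).1.2 ⟨y, hy'⟩)
    omega
  refine ⟨ht.entry_of_scanned hX hs fun ⟨v, hv⟩ => Nat.pos_of_ne_zero fun hq => ?_, key⟩
  exact winIn_disjoint (key hq v (winIn_subset hv)) hv

/-- If `σ` wins from some position that has been looked at, then the opponent wins exactly where he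
wins in what the attractor of this position leaves. -/
theorem TableOk.entry_owner {t : ℕ → ℕ} {σ : Fin 2} {X C : Finset (Fin n)} {lo hi q : ℕ}
    {v : Fin n} (ht : TableOk G wit t X) (hX : G.Subarena X) (hv : v ∈ G.winIn σ X) (hC : v ∈ C)
    (hlo : lo ≤ (v : ℕ)) (hhi : (v : ℕ) < hi)
    (hs : Scanned G wit σ X C (fun r => t (r + r + (1 - σ : Fin 2))) lo hi q) :
    Entry G wit X (1 - σ) q := by
  refine ht.entry_of_scanned hX hs fun hne => ?_
  obtain ⟨R, hR, hres, hq⟩ := hs.pos v hC hlo hhi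
  have hres := hres hX
  rw [← hres.winIn_eq hv] at hne
  exact hq ((ht R hR (hres.trap.subarena hX) (1 - σ)).1.2 hne)

theorem countIn_le (C : Finset (Fin n)) (lo hi : ℕ) : countIn C lo hi ≤ C.card :=
  Finset.card_le_card fun v hv => by simp only [Finset.mem_filter] at hv; exact hv.2.2.2

theorem countIn_le_sub (C : Finset (Fin n)) (lo hi : ℕ) : countIn C lo hi ≤ hi - lo := by
  rw [← Nat.card_Ico lo hi, countIn, ← Finset.card_map Fin.valEmbedding]
  refine Finset.card_le_card fun v hv => ?_
  simp only [Finset.mem_map, Finset.mem_filter] at hv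
  obtain ⟨u, hu, rfl⟩ := hv
  exact Finset.mem_Ico.2 ⟨hu.2.2.1, hu.2.1⟩

/-- The number of positions to be looked at in the second scan. -/
def candidateBound (wit : Bool) (n : ℕ) : ℕ := if wit then 1 else n

/-- The first scan answers the question for the opponent of the owner, the second one, or its
shortcut, for the owner. The entries are claimed to be right only for subarenas, but the bounds on
values and time hold for every `X`, as the main loop does not skip any set. -/
theorem wp_solve (h : Input G es fs inp) {s : State} (hS : Static G es s) {X : Finset (Fin n)}
    (hX : ∀ v : Fin n, s.a .inX v = if v ∈ X then 1 else 0)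
    (hXW : ∀ v : Fin n, s.a .inXW v = if v ∈ X ∩ G.W then 1 else 0)
    (hd : ∀ v : Fin n, s.a .deg v = outDegree es X v) (hx : s.v .x = setCode X)
    (hz : s.v .z = setCode (X ∩ G.W)) (hne : ∃ v ∈ X, s.v .any = v + 1)
    (htab : ∀ i, s.a .tab i ≤ entryCap wit n) :
    WP (limits wit n inp) (solve wit) (fun s' =>
      (∀ i, i < setCode X + setCode X → s'.a .tab i = s.a .tab i) ∧
      (∀ i, s'.a .tab i ≤ entryCap wit n) ∧
      (G.Subarena X → TableOk G wit (s.a .tab) X →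
        ∀ σ : Fin 2, Entry G wit X σ (s'.a .tab (setCode X + setCode X + σ))) ∧
      s'.clk ≤ s.clk + 15 + 6 * n +
        (9 * n + 9 * es.length + 9) * ((X ∩ G.W).card + candidateBound wit n)) s := by
  obtain ⟨b1, b2, b3, b4, b5, b6, b7⟩ := h.bounds
  have hcap := entryCap_le (wit := wit) b1
  have hXlt := setCode_lt X
  have hXc := (Finset.card_le_univ X).trans (by simp : _ ≤ n)
  obtain ⟨σ, hF⟩ := G.exists_mem_F X
  have hfl := hS.fl (X ∩ G.W)
  -- `fl` is 1 on `F 0`, so it is the number of the opponent of the owner.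
  have hfl1 : s.a .fl (setCode (X ∩ G.W)) = (1 - σ : Fin 2) ∧
      1 - s.a .fl (setCode (X ∩ G.W)) = σ := by
    match σ, hF with
    | 0, hF => rw [hfl, if_pos hF]; exact ⟨rfl, rfl⟩
    | 1, hF =>
      have h0 : X ∩ G.W ∉ G.F 0 := fun h0 => by
        have := Finset.mem_inter.2 ⟨h0, hF⟩
        rw [G.F_disjoint] at this
        exact Finset.notMem_empty _ this
      rw [hfl, if_neg h0]; exact ⟨rfl, rfl⟩
  have hσ := σ.2
  have hτ := (1 - σ : Fin 2).2
  rw [solve, wp_seq, wp_set, wp_seq, wp_set, wp_seq, wp_set, wp_seq, wp_set]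
  simp only [Expr.eval, Expr.eval_sub, State.setv_v, State.setv_a, reduceCtorEq, if_false, hz,
    limits_top]
  refine ⟨by omega, by omega, by simp, by rw [hS.vn]; omega, ?_⟩
  rw [hfl1.2, hfl1.1, hS.vn]
  set s0 : State := State.setv _ .hi n with hs0
  have hS0 : Static G es s0 := (((hS.setv rfl).setv rfl).setv rfl).setv rfl
  have hclk0 : s0.clk = s.clk + 4 := rfl
  have ht0 : s0.a .tab = s.a .tab := rfl
  rw [wp_seq]
  refine (wp_scan (σ := σ) (X := X) (C := X ∩ G.W) (lo := 0) (hi := n)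
    (op := (1 - σ : Fin 2)) h hS0 (by cases wit <;> rfl) hX hXW Finset.inter_subset_left hd
    rfl hx rfl rfl rfl le_rfl (Nat.zero_le _) htab).mono ?_
  rintro s1 ⟨hscan, hq1, hclk1⟩ hs1
  have hS1 : Static G es s1 := hS0.same hs1 (by cases wit <;> rfl)
  have ht1 : s1.a .tab = s.a .tab := hs1.a _ (by cases wit <;> rfl)
  have hX1 : s1.a .inX = s.a .inX := hs1.a _ (by cases wit <;> rfl)
  have hd1 : s1.a .deg = s.a .deg := hs1.a _ (by cases wit <;> rfl)
  have hx1 : s1.v .x = setCode X := (hs1.v _ (by cases wit <;> rfl)).trans hx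
  have hop1 : s1.v .op = (1 - σ : Fin 2) := hs1.v _ (by cases wit <;> rfl)
  have hpl1 : s1.v .pl = σ := hs1.v _ (by cases wit <;> rfl)
  have hany1 : s1.v .any = s.v .any := hs1.v _ (by cases wit <;> rfl)
  have hcount1 : countIn (X ∩ G.W) 0 n ≤ (X ∩ G.W).card := countIn_le _ _ _
  have hmul1 := Nat.mul_le_mul_left (9 * n + 9 * es.length + 9) hcount1
  rw [ht0] at hscan
  have hentry := fun (hsub : G.Subarena X) (hok : TableOk G wit (s.a .tab) X) =>
    hok.entry_opponent hsub hF hscan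
  have hput : ∀ (i c : ℕ), i < 2 * 2 ^ n → c ≤ entryCap wit n →
      i < 2 * 2 ^ n ∧ c ≤ (limits wit n inp).acap Arr.tab.idx i := fun i c h1 h2 => ⟨h1, h2⟩
  rw [wp_seq, wp_put, wp_seq, wp_ite]
  simp only [Expr.eval, hx1, hop1, limits_size, State.seta_v]
  refine ⟨hput _ _ (by omega) hq1, fun hpos => ?_, fun hzero => ?_⟩
  · set s2 : State := State.seta s1 .tab _ (s1.v .q) with hs2
    have ht2 : ∀ i, s2.a .tab i = if i = setCode X + setCode X + (1 - σ : Fin 2) then s1.v .q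
        else s.a .tab i := fun i => by rw [← ht1]; rfl
    -- The second scan must meet a position won by the opponent. With witnesses this is `q - 1`
    -- alone, as entries are shifted by one to keep 0 for "nowhere"; without witnesses all positions
    -- are tried.
    have hcand : ∃ lo hi, lo ≤ hi ∧ hi ≤ n ∧ hi - lo ≤ candidateBound wit n ∧
        (G.Subarena X → TableOk G wit (s.a .tab) X → ∃ v ∈ G.winIn (1 - σ) X,
          v ∈ X ∧ lo ≤ (v : ℕ) ∧ (v : ℕ) < hi) ∧
        ∀ Q, (∀ s3 : State, (s3.v .w = lo ∧ s3.v .hi = hi ∧ s3.clk = s2.clk + 3 ∧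
          s3.a .tab = s2.a .tab) → Same (candidates wit) s2.tick s3 → Q s3) →
          WP (limits wit n inp) (candidates wit) Q s2.tick := by
      cases wit
      · refine ⟨0, n, Nat.zero_le _, le_rfl, le_rfl, fun hsub hok => ?_, fun Q hQ => ?_⟩
        · obtain ⟨v, hv⟩ := (hentry hsub hok).1.1.1 hpos
          exact ⟨v, hv, winIn_subset hv, Nat.zero_le _, v.2⟩
        · refine WP.mono (Q := fun s3 => s3.v .w = 0 ∧ s3.v .hi = n ∧ s3.clk = s2.clk + 3 ∧
            s3.a .tab = s2.a .tab) ?_ hQ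
          simp only [candidates, cond_false, wp_seq, wp_set]
          exact ⟨Nat.zero_le _, by change s1.v .n ≤ _; rw [hS1.vn, limits_top]; omega, rfl,
            hS1.vn, rfl, rfl⟩
      · have hq1' : s1.v .q ≤ n := hq1
        refine ⟨s1.v .q - 1, s1.v .q, Nat.sub_le _ _, hq1, ?_, fun hsub hok => ?_, fun Q hQ => ?_⟩
        · change s1.v .q - (s1.v .q - 1) ≤ 1
          omega
        · obtain ⟨v, hv, hv'⟩ := (hentry hsub hok).1.2 rfl hpos
          exact ⟨v, hv', winIn_subset hv', by omega, by omega⟩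
        · refine WP.mono (Q := fun s3 => s3.v .w = s1.v .q - 1 ∧ s3.v .hi = s1.v .q ∧
            s3.clk = s2.clk + 3 ∧ s3.a .tab = s2.a .tab) ?_ hQ
          simp only [candidates, cond_true, wp_seq, wp_set]
          refine ⟨?_, ?_, rfl, rfl, rfl, rfl⟩
          · change s1.v .q - 1 ≤ 64 * 2 ^ n
            omega
          · change s1.v .q ≤ 64 * 2 ^ n
            omega
    obtain ⟨lo, hi, hlohi, hhin, hbound, hcand, hwp⟩ := hcand
    rw [wp_seq]
    refine hwp _ ?_
    rintro s3 ⟨hw3, hhi3, hclk3, ht3⟩ hs3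
    have hclk2 : s2.clk = s1.clk + 1 := rfl
    have hS3 : Static G es s3 := (hS1.seta (b := .tab) rfl).tick.same hs3 (by cases wit <;> rfl)
    have hX3 : s3.a .inX = s.a .inX := (hs3.a _ (by cases wit <;> rfl)).trans hX1
    have hd3 : s3.a .deg = s.a .deg := (hs3.a _ (by cases wit <;> rfl)).trans hd1
    have hx3 : s3.v .x = setCode X := (hs3.v _ (by cases wit <;> rfl)).trans hx1
    have hpl3 : s3.v .pl = σ := (hs3.v _ (by cases wit <;> rfl)).trans hpl1
    rw [wp_seq, wp_set, wp_seq, wp_set]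
    simp only [Expr.eval, Expr.eval_sub, State.setv_v, hpl3, limits_top, reduceCtorEq,
      if_false]
    refine ⟨by omega, by omega, ?_⟩
    have hpl4 : 1 - (σ : ℕ) = (1 - σ : Fin 2) := by rw [← hfl1.2, ← hfl1.1]; omega
    rw [hpl4]
    have hsub1 : (1 - (1 - σ) : Fin 2) = σ := fin2_sub_sub σ
    set s4 : State := State.setv _ .pl _ with hs4
    have hS4 : Static G es s4 := (hS3.setv rfl).setv rfl
    have htab4 : s4.a .tab = s2.a .tab := ht3
    have htab4' : ∀ i, s4.a .tab i ≤ entryCap wit n := by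
      intro i
      rw [htab4, ht2]
      split_ifs
      exacts [hq1, htab i]
    refine (wp_scan (σ := 1 - σ) (X := X) (C := X) (lo := lo) (hi := hi) (op := σ) (b := .inX)
      h hS4 (by cases wit <;> rfl) (fun v => (congrFun hX3 v).trans (hX v))
      (fun v => (congrFun hX3 v).trans (hX v)) (Finset.Subset.refl X)
      (fun v => (congrFun hd3 v).trans (hd v)) rfl hx3 rfl hw3 hhi3 hhin hlohi htab4').mono ?_
    rintro s5 ⟨hscan5, hq5, hclk5⟩ hs5
    have ht5 : s5.a .tab = s2.a .tab := (hs5.a _ (by cases wit <;> rfl)).trans htab4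
    have hx5 : s5.v .x = setCode X := (hs5.v _ (by cases wit <;> rfl)).trans hx3
    have hop5 : s5.v .op = σ := hs5.v _ (by cases wit <;> rfl)
    have hclk4 : s4.clk = s3.clk + 2 := rfl
    have hmul5 := Nat.mul_le_mul_left (9 * n + 9 * es.length + 9)
      ((countIn_le_sub X lo hi).trans hbound)
    rw [wp_put]
    simp only [Expr.eval, hx5, hop5, limits_size, State.seta_a, if_true,
      State.seta_clk, ht5]
    refine ⟨hput _ _ (by omega) hq5, fun i hi => ?_, fun i => ?_, fun hsub hok ρ => ?_, ?_⟩
    · rw [if_neg (by omega), ht2, if_neg (by omega)]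
    · split_ifs
      · exact hq5
      · rw [← htab4]
        exact htab4' i
    · have hok4 : TableOk G wit (s4.a .tab) X := by
        intro Y hY hYsub ρ
        have := setCode_lt_of_ssubset hY
        have := ρ.2
        rw [htab4, ht2, if_neg (by omega)]
        exact hok Y hY hYsub ρ
      obtain ⟨v, hv, hvX, hv1, hv2⟩ := hcand hsub hok
      rcases fin2_eq_or ρ σ with rfl | rfl
      · rw [if_pos rfl]
        -- The players have exchanged roles: attractors are now computed for `1 - σ`, who wins from
        -- `v`.
        have := hok4.entry_owner hsub hv hvX hv1 hv2 (q := s5.v .q) (by rw [hsub1]; exact hscan5)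
        rwa [hsub1] at this
      · have hne' : ((1 - σ : Fin 2) : ℕ) ≠ σ := by omega
        rw [if_neg (by omega), ht2, if_pos rfl]
        exact (hentry hsub hok).1
    · rw [Nat.mul_add]
      omega
  · obtain ⟨v, hv, hany⟩ := hne
    have hv2 := v.2
    have hval : ∀ s' : State, (bif wit then V .any else 1 : Expr).eval s' =
        bif wit then s'.v .any else 1 := by
      cases wit <;> exact fun _ => rfl
    have hvle : (bif wit then s.v .any else 1) ≤ entryCap wit n := by
      cases wit
      · exact le_rfl
      · change s.v .any ≤ n
        omega
    rw [wp_seq, wp_set, wp_set, wp_put]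
    simp only [hval, Expr.eval, State.setv_v, State.tick_v, State.seta_v,
      State.tick_a, State.seta_a, State.setv_a, if_true, reduceCtorEq, if_false, hpl1, hany1, hx1,
      limits_top, limits_size, State.setv_clk, State.seta_clk, State.tick_clk, ht1]
    refine ⟨by omega, by omega, hput _ _ (by omega) hvle, fun i hi => ?_, fun i => ?_,
      fun hsub hok ρ => ?_, ?_⟩
    · rw [if_neg (by omega), if_neg (by omega)]
    · split_ifs
      exacts [hvle, hq1, htab i]
    · obtain ⟨h1, h2⟩ := hentry hsub hok
      have h3 := h2 hzero v hv
      rcases fin2_eq_or ρ σ with rfl | rfl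
      · rw [if_pos rfl]
        refine ⟨⟨fun _ => ⟨v, h3⟩, fun _ => ?_⟩, ?_⟩
        · cases wit
          · exact zero_lt_one
          · change 0 < s.v .any
            omega
        · rintro rfl -
          exact ⟨v, hany, h3⟩
      · have hne' : ((1 - σ : Fin 2) : ℕ) ≠ σ := by
          rw [← hfl1.1, ← hfl1.2]
          omega
        rw [if_neg (by omega), if_pos rfl]
        exact h1
    · rw [Nat.mul_add]
      omega

end

/-! ## The decision procedure -/

section

variable {wit : Bool} {n : ℕ} {G : McNaughtonGame (Fin n)} {es : List (Fin n × Fin n)}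
  {fs : List (Finset (Fin n))} {inp : List ℕ}

/-- `bad` collects the obstacles: an edge by which Player 1 leaves `X`, a win of Player 1 in `X`
according to the table, and a position without successor in `X`. The condition `P` is kept raw here,
as the table is meaningful only after `X` is known to be a subarena. -/
theorem wp_mark (h : Input G es fs inp) {s : State} (hS : Static G es s) {X : Finset (Fin n)}
    (hX : ∀ v : Fin n, s.a .inX v = if v ∈ X then 1 else 0)
    (hd : ∀ v : Fin n, s.a .deg v = outDegree es X v) (hx : s.v .x = setCode X)
    (hbad : s.v .bad ≤ 1) (htab : ∀ i, s.a .tab i ≤ entryCap wit n) :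
    WP (limits wit n inp) mark (fun s' => ∃ P : Prop,
      (P ↔ (s.v .bad = 0 ∧ s.a .tab (setCode X + setCode X + 1) = 0) ∧
        ∀ v ∈ X, 0 < outDegree es X v) ∧
      (P → ∀ v : Fin n, s'.a .res v = if v ∈ X then 1 else s.a .res v) ∧
      (¬ P → s'.a .res = s.a .res) ∧ s'.clk ≤ s.clk + 9 * n + 6) s := by
  obtain ⟨b1, b2, b3, b4, b5, b6, b7⟩ := h.bounds
  have hcap := (htab (setCode X + setCode X + 1)).trans (entryCap_le (wit := wit) b1)
  rw [mark, wp_seq, wp_set, wp_seq, wp_set, wp_seq]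
  simp only [Expr.eval, hx, limits_top]
  refine ⟨by omega, by simp, ?_⟩
  set s0 : State := State.setv _ .i 0 with hs0
  have hS0 : Static G es s0 := (hS.setv rfl).setv rfl
  have hclk0 : s0.clk = s.clk + 2 := rfl
  have hbad0 : s0.v .bad = s.v .bad + s.a .tab (setCode X + setCode X + 1) := rfl
  have hX0 : s0.a .inX = s.a .inX := rfl
  have hd0 : s0.a .deg = s.a .deg := rfl
  have hr0 : s0.a .res = s.a .res := rfl
  have hi0 : s0.v .i = 0 := rfl
  clear_value s0
  refine WP.loop (k := n) (fun k s' => s'.v .i + k = n ∧ s'.v .bad ≤ n + 1 ∧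
    (s'.v .bad = 0 ↔ (s.v .bad = 0 ∧ s.a .tab (setCode X + setCode X + 1) = 0) ∧
      ∀ v ∈ X, (v : ℕ) < s'.v .i → 0 < outDegree es X v) ∧
    s'.clk ≤ s.clk + 5 * s'.v .i + 2) ?_ ?_ ?_
  · rw [hi0, hbad0]
    refine ⟨by omega, by omega, ?_, by omega⟩
    simp
  · rintro k s' ⟨e1, e2, e3, e4⟩ hs hlt
    have hS' : Static G es s' := hS0.same hs rfl
    have hX' : s'.a .inX = s.a .inX := (hs.a _ rfl).trans hX0
    have hd' : s'.a .deg = s.a .deg := (hs.a _ rfl).trans hd0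
    simp [hS'.vn] at hlt
    obtain ⟨w, hw⟩ : ∃ w : Fin n, s'.v .i = w := ⟨⟨s'.v .i, hlt⟩, rfl⟩
    rw [hw] at e1 e3 e4
    have hadv : ∀ P : Fin n → Prop, (∀ v ∈ X, (v : ℕ) < w + 1 → P v) ↔
        (w ∈ X → P w) ∧ ∀ v ∈ X, (v : ℕ) < w → P v := by
      intro P
      refine ⟨fun hP => ⟨fun hwX => hP w hwX (Nat.lt_succ_self _),
        fun v hv hvw => hP v hv (Nat.lt_succ_of_lt hvw)⟩, fun hP v hv hvw => ?_⟩
      rcases Nat.lt_succ_iff_lt_or_eq.1 hvw with h1 | h1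
      · exact hP.2 v hv h1
      · exact Fin.ext h1 ▸ hP.1 (Fin.ext h1 ▸ hv)
    have gX := hX w
    have gd := hd w
    by_cases hwX : w ∈ X
    · rw [if_pos hwX] at gX
      rcases Nat.eq_zero_or_pos (outDegree es X w) with hz | hz
      · simp [wp_seq, wp_set, wp_ite, wp_skip, hw, hX', gX, hd', gd, hz]
        refine ⟨by omega, by omega, k - 1, by omega, by omega, ?_, by omega⟩
        exact fun _ _ => ⟨w, hwX, le_rfl, hz⟩
      · simp [wp_seq, wp_set, wp_ite, wp_skip, hw, hX', gX, hd', gd, hz, hz.ne',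
          -Order.lt_add_one_iff]
        refine ⟨by omega, k - 1, by omega, by omega, by omega, ?_, by omega⟩
        rw [hadv, e3]
        simp [hz]
    · rw [if_neg hwX] at gX
      simp [wp_seq, wp_set, wp_ite, wp_skip, hw, hX', gX, -Order.lt_add_one_iff]
      refine ⟨by omega, k - 1, by omega, by omega, by omega, ?_, by omega⟩
      rw [hadv, e3]
      simp [hwX]
  · rintro k s' ⟨e1, e2, e3, e4⟩ hs hle
    have hS' : Static G es s' := hS0.same hs rfl
    have hX' : s'.a .inX = s.a .inX := (hs.a _ rfl).trans hX0
    have hr' : s'.a .res = s.a .res := (hs.a _ rfl).trans hr0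
    simp [hS'.vn] at hle
    have hin : s'.v .i = n := by omega
    rw [hin] at e3 e4
    have hP : s'.v .bad = 0 ↔ (s.v .bad = 0 ∧ s.a .tab (setCode X + setCode X + 1) = 0) ∧
        ∀ v ∈ X, 0 < outDegree es X v := by
      rw [e3]
      exact and_congr_right fun _ => ⟨fun h1 v hv => h1 v hv v.2, fun h1 v hv _ => h1 v hv⟩
    rw [wp_ite]
    simp only [Expr.eval, State.tick_v]
    refine ⟨fun hpos => ?_, fun hzero => ?_⟩
    · rw [wp_skip]
      refine ⟨_, hP, fun h0 => by omega, fun _ => hr', ?_⟩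
      simp only [State.tick_clk]
      omega
    · rw [wp_seq, wp_set]
      refine ⟨by simp, ?_⟩
      set s1 : State := State.setv _ .i _ with hs1
      have hS1 : Static G es s1 := hS'.tick.tick.setv rfl
      have hX1 : s1.a .inX = s.a .inX := hX'
      have hr1 : s1.a .res = s.a .res := hr'
      have hi1 : s1.v .i = 0 := rfl
      have hclk1 : s1.clk = s'.clk + 3 := rfl
      clear_value s1
      refine WP.loop (k := n) (fun k s2 => s2.v .i + k = n ∧
        (∀ v : Fin n, s2.a .res v = if v ∈ X ∧ (v : ℕ) < s2.v .i then 1 else s.a .res v) ∧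
        s2.clk ≤ s1.clk + 4 * s2.v .i) ?_ ?_ ?_
      · rw [hi1, hr1]
        exact ⟨by omega, fun v => by simp, by omega⟩
      · rintro k s2 ⟨f1, f2, f3⟩ hs2 hlt
        have hS2 : Static G es s2 := hS1.same hs2 rfl
        have hX2 : s2.a .inX = s.a .inX := (hs2.a _ rfl).trans hX1
        simp [hS2.vn] at hlt
        obtain ⟨w, hw⟩ : ∃ w : Fin n, s2.v .i = w := ⟨⟨s2.v .i, hlt⟩, rfl⟩
        rw [hw] at f1 f2 f3
        have gX := hX w
        have c3 : (w : ℕ) < n * n := by omega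
        by_cases hwX : w ∈ X
        · rw [if_pos hwX] at gX
          simp [wp_seq, wp_set, wp_ite, wp_skip, wp_put, hw, hX2, gX, limits_acap, Arr.idx, c3]
          refine ⟨⟨by omega, by omega⟩, by omega, k - 1, by omega, by omega, fun v => ?_, by omega⟩
          by_cases hv : (v : ℕ) = w
          · rw [if_pos hv, if_pos ⟨(Fin.ext hv).symm ▸ hwX, hv.le⟩]
          · rw [if_neg hv, f2]
            exact if_congr (and_congr_right fun _ => by omega) rfl rfl
        · rw [if_neg hwX] at gX
          simp [wp_seq, wp_set, wp_ite, wp_skip, hw, hX2, gX]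
          refine ⟨by omega, k - 1, by omega, by omega, fun v => ?_, by omega⟩
          rw [f2]
          refine if_congr (and_congr_right fun hv => ⟨fun h1 => h1.le, fun h1 => ?_⟩) rfl rfl
          exact lt_of_le_of_ne h1 fun h2 => hwX (Fin.ext h2 ▸ hv)
      · rintro k s2 ⟨f1, f2, f3⟩ hs2 hle
        have hS2 : Static G es s2 := hS1.same hs2 rfl
        simp [hS2.vn] at hle
        refine ⟨_, hP, fun _ v => ?_, fun h0 => absurd hzero h0, ?_⟩
        · rw [State.tick_a, f2]
          exact if_congr (and_iff_left (by omega)) rfl rfl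
        · simp only [State.tick_clk]
          omega

theorem wp_output {s : State} (hn : s.v .n = n) (hlen : n ≤ inp.length) (hn' : n < 2 ^ n) :
    WP (limits wit n inp) output (fun s' => (∀ v : Fin n, s'.inp v = 1 - s.a .res v) ∧
      s'.clk ≤ s.clk + 3 * n + 2) s := by
  rw [output, wp_seq, wp_set]
  refine ⟨by simp, ?_⟩
  refine WP.loop (k := n) (fun k s' => s'.v .i + k = n ∧
    (∀ v : Fin n, (v : ℕ) < s'.v .i → s'.inp v = 1 - s.a .res v) ∧
    s'.clk ≤ s.clk + 3 * s'.v .i + 1) ?_ ?_ ?_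
  · simp
  · rintro k s' ⟨e1, e2, e3⟩ hs hlt
    have en : s'.v .n = n := (hs.v _ rfl).trans hn
    have er : s'.a .res = s.a .res := hs.a _ rfl
    simp [en] at hlt
    have hicap : 1 - s.a .res (s'.v .i) ≤ (limits wit n inp).icap (s'.v .i) :=
      (Nat.sub_le _ _).trans (le_max_right _ _)
    simp [wp_seq, wp_set, wp_out, er]
    refine ⟨⟨by omega, by omega⟩, by omega, k - 1, by omega, by omega, fun v hv => ?_, by omega⟩
    by_cases hvi : (v : ℕ) = s'.v .i
    · rw [if_pos hvi, hvi]
    · rw [if_neg hvi, e2 v (by omega)]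
  · rintro k s' ⟨e1, e2, e3⟩ hs hle
    have en : s'.v .n = n := (hs.v _ rfl).trans hn
    simp [en] at hle
    exact ⟨fun v => e2 v (by omega), by simp only [State.tick_clk]; omega⟩

theorem Input.exists_index (h : Input G es fs inp) {u v : Fin n} (huv : (u, v) ∈ G.E) :
    ∃ e : Fin es.length, es[e].1 = u ∧ es[e].2 = v := by
  obtain ⟨i, hi, hi'⟩ := List.getElem_of_mem ((h.mem_es _).2 huv)
  exact ⟨⟨i, hi⟩, by simp [hi'], by simp [hi']⟩

theorem Input.edge_mem (h : Input G es fs inp) (e : Fin es.length) :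
    (es[e].1, es[e].2) ∈ G.E := (h.mem_es _).1 (List.getElem_mem _)

/-- The test whether Player 1 is trapped in `X`. -/
theorem Input.isTrap_iff (h : Input G es fs inp) (X : Finset (Fin n)) :
    G.IsTrap 1 Finset.univ X ↔
      (∀ e : Fin es.length, es[e].1 ∈ X → es[e].1 ∉ G.pos 0 → es[e].2 ∈ X) ∧
        ∀ v ∈ X, 0 < outDegree es X v := by
  have hp : ∀ v, v ∈ G.pos 1 ↔ v ∉ G.pos 0 := fun v => G.mem_pos_sub 0 v
  have hdeg : ∀ v, 0 < outDegree es X v ↔ ∃ u ∈ X, (v, u) ∈ G.E := by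
    intro v
    rw [outDegree, Finset.card_pos]
    constructor
    · rintro ⟨e, he⟩
      simp only [Finset.mem_filter, Finset.mem_univ, true_and] at he
      exact ⟨es[e].2, he.2, he.1 ▸ h.edge_mem e⟩
    · rintro ⟨u, hu, huv⟩
      obtain ⟨e, rfl, rfl⟩ := h.exists_index huv
      exact ⟨e, by simpa using hu⟩
  constructor
  · intro hT
    refine ⟨fun e h1 h2 => hT.closed _ h1 ((hp _).2 h2) _ (Finset.mem_univ _) (h.edge_mem e),
      fun v hv => (hdeg v).2 (hT.subarena G.subarena_univ v hv)⟩
  · rintro ⟨h1, h2⟩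
    refine ⟨Finset.subset_univ _, fun u hu hu' v _ huv => ?_, fun u hu _ => (hdeg u).1 (h2 u hu)⟩
    obtain ⟨e, rfl, rfl⟩ := h.exists_index huv
    exact h1 e hu ((hp _).1 hu')

/-- `X` is a trap for Player 1 in which Player 1 wins nowhere. -/
def Marked (G : McNaughtonGame (Fin n)) (X : Finset (Fin n)) : Prop :=
  G.IsTrap 1 Finset.univ X ∧ ∀ v, v ∉ G.winIn 1 X

/-- In a trap for Player 1 where Player 1 wins nowhere, Player 0 wins everywhere by determinacy, and
this carries over to the whole game. Conversely, the winning region of Player 0 is itself such a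
trap. -/
theorem exists_marked_iff (v : Fin n) :
    (∃ X, v ∈ X ∧ Marked G X) ↔ v ∈ G.winIn 0 Finset.univ := by
  constructor
  · rintro ⟨X, hv, hT, hX⟩
    exact IsTrap.winIn_subset (σ := 0) hT
      (((hT.subarena G.subarena_univ).determined 0 hv).resolve_right (hX v))
  · intro hv
    obtain ⟨Y, hT, hv, hY⟩ := exists_trap_of_mem_winIn hv
    exact ⟨Y, hv, hT, fun y hy => winIn_disjoint (hY y (winIn_subset hy)) hy⟩

/-- A bound on the running time for one set of positions. -/
def stepBound (wit : Bool) (n m b : ℕ) : ℕ :=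
  31 + 25 * n + 5 * m + (9 * n + 9 * m + 9) * (b + candidateBound wit n)

/-- After the codes below `x`, the table is right for all subarenas among these sets, and `res`
marks the union of the marked ones. At the end this union is the region of Player 0. -/
theorem wp_decideGames (h : Input G es fs inp) :
    WP (limits wit n inp) (decideGames wit) (fun s' =>
      (∀ v : Fin n, (v ∈ G.winIn 0 Finset.univ → s'.inp v = 0) ∧
        (v ∉ G.winIn 0 Finset.univ → s'.inp v = 1)) ∧
      s'.clk ≤ 17 + 14 * n + 9 * es.length + 5 * fs.length +
        2 ^ n * stepBound wit n es.length G.W.card) (.init inp) := by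
  obtain ⟨b1, b2, b3, b4, b5, b6, b7⟩ := h.bounds
  rw [decideGames, wp_seq]
  refine (wp_readInput h).mono fun s0 ⟨hS0, htab0, hres0, hclk0⟩ _ => ?_
  rw [wp_seq, wp_set, wp_seq]
  refine ⟨by simp only [Expr.eval, limits_top]; omega, ?_⟩
  set s1 : State := State.setv _ .x _ with hs1
  have hS1 : Static G es s1 := hS0.setv rfl
  have htab1 : ∀ i, s1.a .tab i = 0 := htab0
  have hres1 : ∀ i, s1.a .res i = 0 := hres0
  have hx1 : s1.v .x = 1 := rfl
  have hclk1 : s1.clk = s0.clk + 1 := rfl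
  clear_value s1
  set T := stepBound wit n es.length G.W.card with hT
  refine WP.loop (k := 2 ^ n - 1) (fun k s' => s'.v .x + k = 2 ^ n ∧ 0 < s'.v .x ∧
    (∀ i, s'.a .tab i ≤ entryCap wit n) ∧
    (∀ Y : Finset (Fin n), setCode Y < s'.v .x → G.Subarena Y → ∀ σ : Fin 2,
      Entry G wit Y σ (s'.a .tab (setCode Y + setCode Y + σ))) ∧
    (∀ v : Fin n, ((∃ X, v ∈ X ∧ Marked G X ∧ setCode X < s'.v .x) → s'.a .res v = 1) ∧
      ((¬ ∃ X, v ∈ X ∧ Marked G X ∧ setCode X < s'.v .x) → s'.a .res v = 0)) ∧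
    s'.clk + k * T ≤ s1.clk + 2 ^ n * T) ?_ ?_ ?_
  · have hempty : ∀ Y : Finset (Fin n), setCode Y < 1 → Y = ∅ := fun Y hY =>
      setCode_injective ((Nat.lt_one_iff.1 hY).trans rfl)
    rw [hx1]
    refine ⟨by omega, Nat.one_pos, fun i => by rw [htab1]; exact Nat.zero_le _,
      fun Y hY _ σ => ?_, fun v => ⟨?_, fun _ => hres1 v⟩, ?_⟩
    · rw [htab1, hempty Y hY]
      refine ⟨⟨fun h0 => absurd h0 (lt_irrefl 0), fun ⟨v, hv⟩ => ?_⟩,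
        fun _ h0 => absurd h0 (lt_irrefl 0)⟩
      exact absurd (winIn_subset hv) (Finset.notMem_empty v)
    · rintro ⟨X, hv, -, hX⟩
      rw [hempty X hX] at hv
      exact absurd hv (Finset.notMem_empty v)
    · exact Nat.add_le_add_left (Nat.mul_le_mul_right _ (Nat.sub_le _ _)) _
  · rintro k s2 ⟨e1, e2, e3, e4, e5, e6⟩ hs2 hlt
    have hS2 : Static G es s2 := hS1.same hs2 (by cases wit <;> rfl)
    simp [hS2.vfull] at hlt
    obtain ⟨X, hX⟩ := exists_setCode_eq hlt
    rw [← hX] at e1 e2 e4 e5 hlt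
    have hXne : X.Nonempty := by
      rw [Finset.nonempty_iff_ne_empty]
      rintro rfl
      exact lt_irrefl 0 e2
    have hsub : ∀ Y : Finset (Fin n), setCode Y < setCode X + 1 ↔ Y = X ∨ setCode Y < setCode X :=
      fun Y => ⟨fun hY => (Nat.lt_succ_iff_lt_or_eq.1 hY).symm.imp_left
        fun hY => setCode_injective hY, by rintro (rfl | hY) <;> omega⟩
    rw [wp_seq]
    refine (wp_decode h hS2.tick hX.symm).mono ?_
    rintro s3 ⟨g1, g2, g3, g4, g5, g6, g7⟩ hs3
    have hS3 : Static G es s3 := hS2.tick.same hs3 rfl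
    have hx3 : s3.v .x = setCode X := (hs3.v _ rfl).trans hX.symm
    have ht3 : s3.a .tab = s2.a .tab := hs3.a _ rfl
    have hr3 : s3.a .res = s2.a .res := hs3.a _ rfl
    rw [wp_seq]
    refine (wp_degrees h hS3 g1 g3).mono ?_
    rintro s4 ⟨d1, d2, d3, d4⟩ hs4
    have hS4 : Static G es s4 := hS3.same hs4 rfl
    have hx4 : s4.v .x = setCode X := (hs4.v _ rfl).trans hx3
    have ht4 : s4.a .tab = s2.a .tab := (hs4.a _ rfl).trans ht3
    have hr4 : s4.a .res = s2.a .res := (hs4.a _ rfl).trans hr3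
    have hX4 : s4.a .inX = s3.a .inX := hs4.a _ rfl
    have hXW4 : s4.a .inXW = s3.a .inXW := hs4.a _ rfl
    have hz4 : s4.v .z = s3.v .z := hs4.v _ rfl
    have hany4 : s4.v .any = s3.v .any := hs4.v _ rfl
    rw [wp_seq]
    refine (wp_solve h hS4 (X := X) (by rwa [hX4])
      (by rw [hXW4]; exact fun v => (g2 v).trans (if_congr Finset.mem_inter.symm rfl rfl))
      d1 hx4 (hz4.trans g4) (by rw [hany4]; exact g5 hXne) (by rwa [ht4])).mono ?_
    rintro s5 ⟨f1, f2, f3, f4⟩ hs5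
    have hS5 : Static G es s5 := hS4.same hs5 (by cases wit <;> rfl)
    have hx5 : s5.v .x = setCode X := (hs5.v _ (by cases wit <;> rfl)).trans hx4
    have hr5 : s5.a .res = s2.a .res := (hs5.a _ (by cases wit <;> rfl)).trans hr4
    have hX5 : s5.a .inX = s3.a .inX := (hs5.a _ (by cases wit <;> rfl)).trans hX4
    have hd5 : s5.a .deg = s4.a .deg := hs5.a _ (by cases wit <;> rfl)
    have hbad5 : s5.v .bad = s4.v .bad := hs5.v _ (by cases wit <;> rfl)
    have hentry : G.Subarena X → ∀ σ : Fin 2,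
        Entry G wit X σ (s5.a .tab (setCode X + setCode X + σ)) := by
      refine fun hXsub => f3 hXsub fun Y hY hYsub σ => ?_
      rw [ht4]
      exact e4 Y (setCode_lt_of_ssubset hY) hYsub σ
    rw [wp_seq]
    refine (wp_mark h hS5 (X := X) (by rwa [hX5]) (by rwa [hd5]) hx5 (by rwa [hbad5]) f2).mono ?_
    rintro s6 ⟨P, p1, p2, p3, p4⟩ hs6
    have hx6 : s6.v .x = setCode X := (hs6.v _ rfl).trans hx5
    have ht6 : s6.a .tab = s5.a .tab := hs6.a _ rfl
    have hP : P ↔ Marked G X := by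
      rw [p1, hbad5, d2, Marked, h.isTrap_iff]
      -- The table entry of Player 1 may be trusted only if the other two tests succeed: they make
      -- `X` a trap for Player 1 and thus a subarena.
      have hor : (∀ v ∈ X, 0 < outDegree es X v) →
          (∀ e : Fin es.length, es[e].1 ∈ X → es[e].1 ∉ G.pos 0 → es[e].2 ∈ X) →
          (s5.a .tab (setCode X + setCode X + 1) = 0 ↔ ∀ v, v ∉ G.winIn 1 X) := by
        intro h1 h2
        have hXsub := ((h.isTrap_iff X).2 ⟨h2, h1⟩).subarena G.subarena_univ
        have h3 := (hentry hXsub 1).1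
        rw [← Set.eq_empty_iff_forall_notMem, ← Set.not_nonempty_iff_eq_empty, ← h3]
        change _ ↔ ¬ 0 < s5.a .tab (setCode X + setCode X + 1)
        omega
      constructor
      · rintro ⟨⟨h1, h2⟩, h3⟩
        exact ⟨⟨h1, h3⟩, (hor h3 h1).1 h2⟩
      · rintro ⟨⟨h1, h3⟩, h2⟩
        exact ⟨⟨h1, (hor h3 h1).2 h2⟩, h3⟩
    rw [wp_set]
    simp only [Expr.eval, hx6, limits_top, State.setv_v, if_true, State.setv_a, State.setv_clk,
      ht6]
    have hmul : k * T = (k - 1) * T + T := by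
      rw [← Nat.succ_mul]
      congr 1
      omega
    have hT' : 31 + 25 * n + 5 * es.length +
        (9 * n + 9 * es.length + 9) * ((X ∩ G.W).card + candidateBound wit n) ≤ T := by
      rw [hT, stepBound]
      refine Nat.add_le_add_left (Nat.mul_le_mul_left _ (Nat.add_le_add_right ?_ _)) _
      exact Finset.card_le_card Finset.inter_subset_right
    simp only [State.tick_clk] at g7
    refine ⟨by omega, k - 1, by omega, by omega, Nat.succ_pos _, f2, fun Y hY hYsub σ => ?_,
      fun v => ?_, by omega⟩
    · rcases (hsub Y).1 hY with rfl | hY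
      · exact hentry hYsub σ
      · have := σ.2
        rw [f1 _ (by omega), ht4]
        exact e4 Y hY hYsub σ
    · have hex : (∃ Z, v ∈ Z ∧ Marked G Z ∧ setCode Z < setCode X + 1) ↔
          (v ∈ X ∧ P) ∨ ∃ Z, v ∈ Z ∧ Marked G Z ∧ setCode Z < setCode X := by
        rw [hP]
        constructor
        · rintro ⟨Z, h1, h2, h3⟩
          rcases (hsub Z).1 h3 with rfl | h3
          · exact .inl ⟨h1, h2⟩
          · exact .inr ⟨Z, h1, h2, h3⟩
        · rintro (⟨h1, h2⟩ | ⟨Z, h1, h2, h3⟩)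
          · exact ⟨X, h1, h2, Nat.lt_succ_self _⟩
          · exact ⟨Z, h1, h2, Nat.lt_succ_of_lt h3⟩
      rw [hex]
      by_cases hp : P
      · rw [p2 hp v, hr5]
        by_cases hvX : v ∈ X
        · rw [if_pos hvX]
          exact ⟨fun _ => rfl, fun h0 => absurd (.inl ⟨hvX, hp⟩) h0⟩
        · rw [if_neg hvX]
          simp only [hvX, false_and, false_or]
          exact e5 v
      · rw [p3 hp, hr5]
        simp only [hp, and_false, false_or]
        exact e5 v
  · rintro k s2 ⟨e1, e2, e3, e4, e5, e6⟩ hs2 hle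
    have hS2 : Static G es s2 := hS1.same hs2 (by cases wit <;> rfl)
    simp [hS2.vfull] at hle
    have hk : k = 0 := by omega
    subst hk
    refine (wp_output (s := s2.tick) hS2.vn (by omega) b2).mono fun s3 ⟨o1, o2⟩ _ => ?_
    simp only [State.tick_clk] at o2
    refine ⟨fun v => ?_, by omega⟩
    have hx2 : ∀ X : Finset (Fin n), setCode X < s2.v .x := fun X =>
      (setCode_lt X).trans_le (by omega)
    have hex : (∃ X, v ∈ X ∧ Marked G X ∧ setCode X < s2.v .x) ↔
        v ∈ G.winIn 0 Finset.univ := by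
      rw [← exists_marked_iff]
      simp only [hx2, and_true]
    have h5 := e5 v
    rw [hex] at h5
    rw [o1 v, State.tick_a]
    exact ⟨fun hv => by rw [h5.1 hv], fun hv => by rw [h5.2 hv]⟩

end

/-! ## Time and space -/

/-- Arrays with at most `n * n` entries of `O(n)` bits then fit into `O(2 ^ n)` bits, even in the
procedure without witnesses. -/
theorem cube_le_two_pow (n : ℕ) : n * n * n ≤ 8 * 2 ^ n := by
  rcases lt_or_ge n 4 with h | h
  · interval_cases n <;> norm_num
  · induction n, h using Nat.le_induction with
    | base => norm_num
    | succ n h ih =>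
      rw [pow_succ]
      nlinarith [Nat.mul_le_mul h h, Nat.mul_le_mul (Nat.mul_le_mul h h) h,
        Nat.mul_le_mul_right (n * n) h]

theorem size_mul_two_pow_le {a k n : ℕ} (h : a < 2 ^ k) : Nat.size (a * 2 ^ n) ≤ k + n := by
  rw [Nat.size_le, pow_add]
  exact Nat.mul_lt_mul_of_pos_right h (Nat.two_pow_pos n)

section

variable {wit : Bool} {n : ℕ} {G : McNaughtonGame (Fin n)} {es : List (Fin n × Fin n)}
  {fs : List (Finset (Fin n))} {inp : List ℕ}

theorem size_acap_le (hn : 0 < n) (c : ℕ) :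
    Nat.size ((limits wit n inp).acap (c % 16) (c / 16)) ≤
      Nat.size (entryCap wit n) + if c < 16 * (n * n) then n + 7 else 0 := by
  have h1 : 1 ≤ Nat.size (entryCap wit n) := by
    refine Nat.size_pos.2 ?_
    unfold entryCap
    split_ifs <;> omega
  have h2 := size_mul_two_pow_le (a := 64) (k := 7) (n := n) (by norm_num)
  change Nat.size (if c % 16 = 7 then 1 else if c % 16 = 8 then entryCap wit n else
    if c / 16 < n * n then 64 * 2 ^ n else 0) ≤ _
  split_ifs with h3 h4 h5 h6 h6
  any_goals first | omega | (rw [Nat.size_one]; omega)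
  all_goals first | exact Nat.le_add_right _ _ | (rw [Nat.size_zero]; exact Nat.zero_le _)

/-- Three kinds of cells are added up: work cells of `O(n)` bits; input cells, which at most double
when a 0 is replaced by an output bit; and array cells, each with room for a table entry, where only
those with index below `n * n` need `n + 7` further bits. -/
theorem Input.space_le (h : Input G es fs inp) :
    ∑ a ∈ Finset.range (64 + (limits wit n inp).len + 16 * (limits wit n inp).size),
        (Nat.size ((limits wit n inp).cell a) + 1) ≤
      2000 * (bitLength inp + 2 ^ n * Nat.size (entryCap wit n)) := by
  obtain ⟨b1, b2, b3, b4, b5, b6, b7⟩ := h.bounds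
  have hcube := cube_le_two_pow n
  set D := Nat.size (entryCap wit n) with hD
  have hD1 : 1 ≤ D := by
    refine Nat.size_pos.2 ?_
    unfold entryCap
    split_ifs <;> omega
  have hDp := Nat.mul_le_mul_left (2 ^ n) hD1
  rw [Finset.sum_range_add, Finset.sum_range_add]
  have e1 : ∑ a ∈ Finset.range 64, (Nat.size ((limits wit n inp).cell a) + 1) ≤
      64 * (n + 19) := by
    refine (Finset.sum_le_card_nsmul _ _ (n + 19) fun a ha => ?_).trans (by simp)
    have ha := Finset.mem_range.1 ha
    have h1 : (limits wit n inp).cell a ≤ 131072 * 2 ^ n := by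
      unfold Limits.cell
      rw [limits_top]
      split_ifs <;> omega
    have h2 := size_mul_two_pow_le (a := 131072) (k := 18) (n := n) (by norm_num)
    have h3 := Nat.size_le_size h1
    omega
  have e2 : ∑ i ∈ Finset.range (limits wit n inp).len,
      (Nat.size ((limits wit n inp).cell (64 + i)) + 1) ≤ 2 * bitLength inp := by
    rw [bitLength_eq, Finset.mul_sum]
    refine Finset.sum_le_sum fun i hi => ?_
    rw [Limits.cell_inp _ (Finset.mem_range.1 hi)]
    change Nat.size (max (read inp i) 1) + 1 ≤ _
    rcases le_total (read inp i) 1 with h1 | h1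
    · rw [max_eq_right h1, Nat.size_one]
      omega
    · rw [max_eq_left h1]
      omega
  have e3 : ∑ c ∈ Finset.range (16 * (limits wit n inp).size),
      (Nat.size ((limits wit n inp).cell (64 + (limits wit n inp).len + c)) + 1) ≤
        32 * 2 ^ n * (D + 1) + 16 * (n * n) * (n + 7) := by
    have h1 : ∀ c ∈ Finset.range (16 * (limits wit n inp).size),
        Nat.size ((limits wit n inp).cell (64 + (limits wit n inp).len + c)) + 1 ≤
          (D + 1) + if c < 16 * (n * n) then n + 7 else 0 := by
      intro c _
      rw [Limits.cell, if_neg (by omega), if_neg (by omega), if_neg (by omega),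
        show 64 + (limits wit n inp).len + c - 64 - (limits wit n inp).len = c by omega]
      have := size_acap_le (wit := wit) (inp := inp) b1 c
      omega
    refine (Finset.sum_le_sum h1).trans ?_
    rw [Finset.sum_add_distrib, Finset.sum_const, Finset.card_range, smul_eq_mul, limits_size,
      ← Finset.sum_filter, Finset.sum_const, smul_eq_mul]
    refine Nat.add_le_add (le_of_eq (by ring)) (Nat.mul_le_mul_right _ ?_)
    refine (Finset.card_le_card (t := Finset.range (16 * (n * n))) fun c hc => ?_).trans (by simp)
    exact Finset.mem_range.2 (Finset.mem_filter.1 hc).2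
  have e4 : 32 * 2 ^ n * (D + 1) + 16 * (n * n) * (n + 7) =
      32 * (2 ^ n * D) + 32 * 2 ^ n + 16 * (n * n * n) + 112 * (n * n) := by ring
  have e5 : 2000 * (bitLength inp + 2 ^ n * D) = 2000 * bitLength inp + 2000 * (2 ^ n * D) := by
    ring
  rw [mul_one] at hDp
  omega

theorem stepBound_le {m b B : ℕ} (hn : 0 < n) (hm : n ≤ m) (hb : b ≤ B)
    (hc : candidateBound wit n ≤ B) (hB : 1 ≤ B) : stepBound wit n m b ≤ 115 * (B * m) := by
  have h1 : (9 * n + 9 * m + 9) * (b + candidateBound wit n) ≤ (27 * m) * (2 * B) :=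
    Nat.mul_le_mul (by omega) (by omega)
  have h2 : 1 * m ≤ B * m := Nat.mul_le_mul_right m hB
  have h3 : (27 * m) * (2 * B) = 54 * (B * m) := by ring
  rw [stepBound]
  omega

/-- The constant in the bounds for time, space, and the length of words. -/
def decideConst (wit : Bool) : ℕ := ((decideGames wit).code 6).length * 160 + 2006

/-- `B` bounds both the number of attractors in the first scan and that in the second one; `D`
bounds the bits of a table entry. The two claims differ only in these parameters. -/
theorem computesWithin_decideGames (h : Input G es fs inp) {B D : ℕ} (hB : 1 ≤ B)
    (hW : G.W.card ≤ B) (hc : candidateBound wit n ≤ B) (hD : Nat.size (entryCap wit n) ≤ D) :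
    ComputesWithin (decideGames wit).program inp (G.IsSolution (decideGames wit).program.work)
      (decideConst wit * (2 ^ n * B * G.E.card)) (decideConst wit * (bitLength inp + 2 ^ n * D))
      (decideConst wit * n) := by
  obtain ⟨b1, b2, b3, b4, b5, b6, b7⟩ := h.bounds
  have hm := h.le_length_es
  have hcap := entryCap_le (wit := wit) b1
  obtain ⟨s, he, hs, hclk⟩ := wp_decideGames (wit := wit) h
  have hinp : ∀ i, inp.getD i 0 ≤ 64 * 2 ^ n := by
    intro i
    rcases lt_or_ge i inp.length with hi | hi
    swap
    · rw [List.getD_eq_default _ _ hi]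
      exact Nat.zero_le _
    by_cases h0 : i < 3
    · have g0 := h.getD_zero
      have g1 := h.getD_one
      have g2 := h.getD_two
      interval_cases i <;> omega
    by_cases h1 : i < 3 + 2 * n
    · obtain ⟨g1, g2⟩ := h.getD_pos ⟨(i - 3) / 2, by omega⟩
      simp only [] at g1 g2
      rcases Nat.even_or_odd' (i - 3) with ⟨k, hk | hk⟩
      · rw [show i = 3 + 2 * ((i - 3) / 2) by omega, g1]
        split_ifs <;> omega
      · rw [show i = 3 + 2 * ((i - 3) / 2) + 1 by omega, g2]
        split_ifs <;> omega
    by_cases h2 : i < 3 + 2 * n + 2 * es.length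
    · obtain ⟨g1, g2⟩ := h.getD_edge ⟨(i - (3 + 2 * n)) / 2, by omega⟩
      simp only [] at g1 g2
      rcases Nat.even_or_odd' (i - (3 + 2 * n)) with ⟨k, hk | hk⟩
      · rw [show i = 3 + 2 * n + 2 * ((i - (3 + 2 * n)) / 2) by omega, g1]
        omega
      · rw [show i = 3 + 2 * n + 2 * ((i - (3 + 2 * n)) / 2) + 1 by omega, g2]
        omega
    · have g1 := h.getD_set (i := i - (3 + 2 * n + 2 * es.length)) (by omega)
      rw [show 3 + 2 * n + 2 * es.length + (i - (3 + 2 * n + 2 * es.length)) = i by omega] at g1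
      rw [g1]
      have := setCode_lt fs[i - (3 + 2 * n + 2 * es.length)]
      omega
  have hok : (limits wit n inp).Ok := by
    refine ⟨?_, fun j i => ?_, fun i => ?_⟩
    · rw [limits_len, limits_top]
      omega
    · rw [limits_acap, limits_top]
      change (if j = 7 then 1 else if j = 8 then entryCap wit n else _) ≤ _
      split_ifs <;> omega
    · exact max_le (hinp i) (by rw [limits_top]; omega)
  refine computesWithin_of_exec hok rfl ?_ (fun i => le_max_left _ _) (decideGames_fits wit) he
    (fun m hm v => ?_) ?_ ?_ ?_
  · rw [h.getD_zero, h.getD_one, h.getD_two]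
    exact b7
  · have hv := v.2
    have hr : read m ((decideGames wit).program.work + v) = s.inp v :=
      hm v (by rw [limits_len]; omega)
    rw [hr]
    rcases G.subarena_univ.determined 0 (Finset.mem_univ v) with hw | hw
    · rw [(hs v).1 hw]
      refine ⟨⟨0, rfl⟩, fun σ => ?_⟩
      rw [G.Win_eq_winIn]
      rcases fin2_eq_or σ 0 with rfl | rfl
      · exact ⟨fun _ => hw, fun _ => rfl⟩
      · exact ⟨fun h0 => absurd h0 (by decide), fun h1 => (winIn_disjoint hw h1).elim⟩
    · rw [(hs v).2 fun h0 => winIn_disjoint h0 hw]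
      refine ⟨⟨1, rfl⟩, fun σ => ?_⟩
      rw [G.Win_eq_winIn]
      rcases fin2_eq_or σ 0 with rfl | rfl
      · exact ⟨fun h0 => absurd h0 (by decide), fun h1 => (winIn_disjoint h1 hw).elim⟩
      · exact ⟨fun _ => hw, fun _ => rfl⟩
  · have h1 := Nat.mul_le_mul_left (2 ^ n) (stepBound_le b1 hm hW hc hB)
    rw [← h.length_es]
    set U := 2 ^ n * B * es.length with hU
    have h2 : 2 ^ n * (115 * (B * es.length)) = 115 * U := by rw [hU]; ring
    -- The time for reading the input, including the listed members of `F 0`, is absorbed because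
    -- there are at most `2 ^ n` such members.
    have h3 : 2 ^ n ≤ U := by
      rw [hU, Nat.mul_assoc]
      exact Nat.le_mul_of_pos_right _ (Nat.mul_pos hB (by omega))
    have h4 : es.length ≤ U := Nat.le_mul_of_pos_left _ (Nat.mul_pos (by omega) hB)
    have h5 : s.clk ≤ 160 * U := by omega
    have h6 := Nat.mul_le_mul_left ((decideGames wit).code 6).length h5
    rw [decideConst, Nat.add_mul, Nat.mul_assoc]
    omega
  · refine h.space_le.trans (Nat.mul_le_mul ?_ ?_)
    · rw [decideConst]
      omega
    · exact Nat.add_le_add_left (Nat.mul_le_mul_left _ hD) _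
  · have h1 := size_mul_two_pow_le (a := 131072) (k := 18) (n := n) (by norm_num)
    rw [limits_top, ← Nat.mul_assoc]
    refine h1.trans ((show 18 + n ≤ 2006 * n by omega).trans (Nat.mul_le_mul_right n ?_))
    rw [decideConst]
    omega

theorem exists_input (hn : 0 < n) (h : G.IsRepresentation inp) :
    ∃ es fs, Input G es fs inp := by
  obtain ⟨es, fs, h1, h2, h3, h4, h5⟩ := h
  exact ⟨es, fs, hn, h1, fun e => by rw [← h2, List.mem_toFinset], h3,
    fun Z => by rw [← h4, List.mem_toFinset], h5⟩

end

end RAM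

theorem mainTheorem7 :
    (∃ (p : RAM.Program) (C : ℕ), DecidesMcNaughton p
      (time := fun {n} G => C * (2 ^ n * max 1 G.W.card * G.E.card))
      (space := fun {n} _ size => C * (size + 2 ^ n * n))
      (word := fun {n} _ => C * n)) ∧
    (∃ (p : RAM.Program) (C : ℕ), DecidesMcNaughton p
      (time := fun {n} G => C * (2 ^ n * n * G.E.card))
      (space := fun {n} _ size => C * (size + 2 ^ n))
      (word := fun {n} _ => C * n)) := by
  -- With witnesses: one candidate in the second scan, and entries up to `n`, which have at most `n`
  -- bits. Without witnesses: up to `n` candidates, and entries of one bit.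
  refine ⟨⟨(RAM.decideGames true).program, RAM.decideConst true, fun n hn G inp hrep => ?_⟩,
    ⟨(RAM.decideGames false).program, RAM.decideConst false, fun n hn G inp hrep => ?_⟩⟩
  · obtain ⟨es, fs, h⟩ := RAM.exists_input hn hrep
    refine RAM.computesWithin_decideGames h (le_max_left _ _) (le_max_right _ _) (le_max_left _ _) ?_
    exact Nat.size_le.2 Nat.lt_two_pow_self
  · obtain ⟨es, fs, h⟩ := RAM.exists_input hn hrep
    have := RAM.computesWithin_decideGames (wit := false) (B := n) (D := 1) h hn
      ((Finset.card_le_univ _).trans (by simp)) le_rfl (le_of_eq Nat.size_one)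
    rwa [Nat.mul_one] at this
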